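/- Let $\Lambda=(\lambda_n)_{n\ge1}$ be a strictly increasing sequence of positive real numbers with $\sum_n 1/\lambda_n<\infty$. Let $M^2_\Lambda$ be the closed linear span of the monomials $x^{\lambda_n}$ in $L^2([0,1])$ (Lebesgue measure, real or complex scalars), let $d_n$ be the distance in $L^2([0,1])$ from $x^{\lambda_n}$ to the linear span of the $x^{\lambda_m}$, $m\ne n$, and put $$\psi(x)=\sum_{n\ge1}d_n^{-1}x^{\lambda_n},\qquad \psi_{k}(x)=\sum_{n:\,\lambda_n\ge k}d_n^{-1}x^{\lambda_n}.$$ Then $d_n>0$ for every $n$; the series $\psi$ converges on $[0,1)$ whenever $\inf_n(\lambda_{n+1}-\lambda_n)>0$; and if it converges on $[0,1)$, then $\psi$ is $C^\infty$ on $(0,1)$. Let $\mu$ be a finite positive Borel measure on $[0,1]$, of total mass $\|\mu\|$, with $\operatorname{supp}\mu\subset[0,1-\varepsilon]$ for some $0<\varepsilon<1$. Then the embedding $i_\mu:M^2_\Lambda\to L^2(\mu)$ (every $f\in M^2_\Lambda$ has a representative that is continuous on $[0,1)$, and $i_\mu f$ is its class in $L^2(\mu)$) is a well-defined bounded operator,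 and it belongs to the Schatten--von Neumann class $\mathcal S_q$ for every $q>0$. Moreover, write $b=1-\varepsilon$ and suppose that the series $\psi$ converges on $[0,1)$. Let $k\ge1$ be an integer and let $b<b'<1$. If $\lambda_n\ge k$ for all $n$, then $$\|i_\mu\|_{2/k}\le 2^{-k/2}\,{b'}^{-1/2}\,\psi^{(k)}(b')\,\psi(b/b')\,\sqrt{\|\mu\|}.$$ Without this restriction on $k$, $$\|i_\mu\|_{2/k}^{2/k}\le\Bigl(2^{-k/2}\,{b'}^{-1/2}\,\psi_k^{(k)}(b')\,\psi(b/b')\,\sqrt{\|\mu\|}\Bigr)^{2/k}+N_k\Bigl(\psi(b)\sqrt{\|\mu\|}\Bigr)^{2/k},$$ where $N_k$ is the number of indices $n$ with $\lambda_n<k$. Here $\|T\|_q=(\sum_n s_n(T)^q)^{1/q}$, where the $s_n(T)$ are the nonzero eigenvalues of $|T|=\sqrt{T^*T}$ counted with multiplicity. -/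

import Mathlib

open MeasureTheory Set
open scoped NNReal ENNReal unitInterval ContDiff

/-! ### Schatten-von Neumann classes -/

section Schatten

variable {𝕜 H₁ H₂ : Type*} [RCLike 𝕜]
  [NormedAddCommGroup H₁] [InnerProductSpace 𝕜 H₁] [CompleteSpace H₁]
  [NormedAddCommGroup H₂] [InnerProductSpace 𝕜 H₂] [CompleteSpace H₂]

/-- The multiplicity of `s > 0` as an eigenvalue of `|T| = (T* T)^{1/2}`. The eigenspace of `|T|`
for `s` is the eigenspace of `T* T` for `s ^ 2`; it is finite dimensional if `T` is compact. -/
noncomputable def singularMultiplicity (T : H₁ →L[𝕜] H₂) (s : ℝ) : ℕ :=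
  Module.finrank 𝕜
    (Module.End.eigenspace ((ContinuousLinearMap.adjoint T ∘L T : H₁ →L[𝕜] H₁) : H₁ →ₗ[𝕜] H₁)
      ((s ^ 2 : ℝ) : 𝕜))

/-- The sum `∑ s_n(T) ^ q` over the nonzero singular values of the compact operator `T`,
each counted with its multiplicity. -/
noncomputable def schattenSum (q : ℝ) (T : H₁ →L[𝕜] H₂) : ℝ≥0∞ :=
  ∑' s : Ioi (0 : ℝ), (singularMultiplicity T s : ℝ≥0∞) * ENNReal.ofReal ((s : ℝ) ^ q)

/-- The Schatten-von Neumann (quasi)norm of a compact operator. -/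
noncomputable def schattenNorm (q : ℝ) (T : H₁ →L[𝕜] H₂) : ℝ≥0∞ :=
  schattenSum q T ^ (1 / q)

/-- Membership in the Schatten-von Neumann class of exponent `q`. -/
def IsSchatten (q : ℝ) (T : H₁ →L[𝕜] H₂) : Prop :=
  IsCompactOperator T ∧ schattenSum q T < ⊤

end Schatten

/-! ### Müntz spaces -/

section Muntz

variable (𝕜 : Type*) [RCLike 𝕜]

/-- The monomial `x ^ s` as a continuous function on `[0, 1]`. -/
noncomputable def muntzMonomial (s : ℝ≥0) : C(I, 𝕜) where
  toFun x := (((x : ℝ) ^ (s : ℝ) : ℝ) : 𝕜)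
  continuous_toFun :=
    RCLike.continuous_ofReal.comp
      ((Real.continuous_rpow_const s.coe_nonneg).comp continuous_subtype_val)

/-- The monomial `x ^ s` as an element of `L²([0, 1])` with Lebesgue measure. -/
noncomputable def muntzMonomialL2 (s : ℝ≥0) : Lp 𝕜 2 (volume : Measure I) :=
  ContinuousMap.toLp 2 volume 𝕜 (muntzMonomial 𝕜 s)

/-- The Müntz space: the closed linear span of the monomials `x ^ Λ n` in `L²([0, 1])`. -/
noncomputable def muntzSpace (Λ : ℕ → ℝ≥0) : Submodule 𝕜 (Lp 𝕜 2 (volume : Measure I)) :=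
  (Submodule.span 𝕜 (range fun n => muntzMonomialL2 𝕜 (Λ n))).topologicalClosure

instance (Λ : ℕ → ℝ≥0) : CompleteSpace (muntzSpace 𝕜 Λ) :=
  (Submodule.isClosed_topologicalClosure _).completeSpace_coe

/-- The distance `d_n` in `L²([0, 1])` from `x ^ Λ n` to the span of the `x ^ Λ m`, `m ≠ n`. -/
noncomputable def muntzDist (Λ : ℕ → ℝ≥0) (n : ℕ) : ℝ :=
  Metric.infDist (muntzMonomialL2 𝕜 (Λ n))
    (Submodule.span 𝕜 ((fun m => muntzMonomialL2 𝕜 (Λ m)) '' {m | m ≠ n}) :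
      Set (Lp 𝕜 2 (volume : Measure I)))

/-- The function `ψ(x) = ∑ d_n⁻¹ x ^ Λ n`. -/
noncomputable def muntzPsi (Λ : ℕ → ℝ≥0) (x : ℝ) : ℝ :=
  ∑' n, (muntzDist 𝕜 Λ n)⁻¹ * x ^ (Λ n : ℝ)

/-- The part `∑_{Λ n ≥ k} d_n⁻¹ x ^ Λ n` of the sum defining `ψ`. -/
noncomputable def muntzPsiFrom (Λ : ℕ → ℝ≥0) (k : ℕ) (x : ℝ) : ℝ :=
  ∑' n : {n : ℕ // (k : ℝ≥0) ≤ Λ n}, (muntzDist 𝕜 Λ n)⁻¹ * x ^ (Λ n : ℝ)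

/-- The series defining `ψ` converges on `[0, 1)`. -/
def MuntzPsiConverges (Λ : ℕ → ℝ≥0) : Prop :=
  ∀ x ∈ Ico (0 : ℝ) 1, Summable fun n => (muntzDist 𝕜 Λ n)⁻¹ * x ^ (Λ n : ℝ)

/-- `T` is the embedding of the Müntz space in `L²(μ)`: every `f` in the Müntz space has a
representative that is continuous on `[0, 1)`, and `T f` is the class of this representative
modulo `μ`-null sets. (If `μ {1} = 0`, then this determines `T`.) -/
def IsMuntzEmbedding {Λ : ℕ → ℝ≥0} {μ : Measure I} (T : muntzSpace 𝕜 Λ →L[𝕜] Lp 𝕜 2 μ) : Prop :=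
  ∀ f : muntzSpace 𝕜 Λ, ∃ g : I → 𝕜, ContinuousOn g {x | (x : ℝ) < 1} ∧
    ((f : Lp 𝕜 2 (volume : Measure I)) : I → 𝕜) =ᵐ[volume] g ∧ (T f : I → 𝕜) =ᵐ[μ] g

end Muntz

/-!
The proof rests on norm estimates for Müntz polynomials `p = ∑ c n * x ^ λ n`, on which everything
else is built.

**Duality.** With `l n = λ n + 1 / 2`, the square of the norm of `p` in `L²([0, 1])` is the quadratic
form of the Cauchy matrix `1 / (l n + l m)` (`cauchyForm`). Multiplying `∑ c n / (l n - w)` by the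
Blaschke product with zeros `l n` gives `∑ b n / (l n + w)` with new coefficients `b` (`dualCoeff`),
and this is an isometry (`cauchyForm_dualCoeff`). As `∑ b n / (l n + w)` is bounded in the right half
plane by the Cauchy-Schwarz inequality, `∑ c n / (l n - w)` is bounded there by the inverse of the
Blaschke product (`norm_sum_div_sub_le`), and its residues `c n` are bounded (`abs_coeff_le`). The
latter bound is uniform in the number of terms because `∑ 1 / λ n` converges, so `0 < d n`. If the
gaps of the exponents are bounded below, it is subexponential in `λ n`
(`exists_sqrt_mul_prod_erase_le`), so `ψ` converges.

**Point evaluations.** The value `p (exp (-y))` is an integral of `exp (-y z) ∑ c n / (λ n - z)` over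
the boundary of the sector `|arg z| < π / 4`. On this boundary the inverse of the Blaschke product
grows more slowly than any exponential (`exists_prod_one_add_mul_le`), so the evaluation at `t` is a
bounded functional, uniformly for `t ≤ b < 1` (`exists_abs_sum_exp_le`). The representation is proved
by differentiation in `y` instead of the residue theorem (`integral_wedgeKernel_im`). Evaluations and
coefficients extend to the Müntz space by continuity (`muntzEval`, `muntzCoeff`). If `ψ` converges,
then the evaluation at `t` has norm at most `ψ t`, since the coefficient functionals have norm at
most `(d n)⁻¹`.

**Hilbert-Schmidt operators.** A bounded family of functionals defines a Hilbert-Schmidt operator to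
`L²(μ)` (`exists_operator_of_functionals`). This applies to the embedding `T` and to the dilations
`f ↦ f (ρ ·)`, `ρ < 1`. For each `k`, `T` is a bounded operator after the `k`-th power of a dilation.

**Schatten sums.** If `‖T z‖ ≤ C * ‖A ^ k (D z)‖` for a Hilbert-Schmidt operator `A`, then the
singular values of `T` are summable with exponent `2 / k` (`sum_rpow_le_of_dominated`). Instead of
the multiplicative inequalities for singular values, the proof compares lengths of Gram-Schmidt
vectors: each factor `A` shrinks the `i`-th of them by some `a i` with `∑ a i ^ 2` bounded, and
Hölder's inequality applies to the product of `k` such sequences. If the domination holds only on the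
kernel of a map of rank `N`, then `N` singular values have to be estimated by `‖T‖`.

**The explicit bound.** Here `T` is the composition of the evaluation `f ↦ f (· / b')`, whose norm is
at most `ψ (b / b') * √‖μ‖`, and the dilation by `b'`. On the functions without terms of exponent less
than `k`, the dilation by `b'` is `V ^ k ∘ D'`, where `V` is the Volterra operator, whose
Hilbert-Schmidt norm is `√(1 / 2)`, and `D' f` is the `k`-th derivative of `f (b' ·)`. The expansion
of `D'` in coefficient functionals shows that its norm is at most the `k`-th derivative of `ψ_k` at
`b'` (`IsMuntzSequence.exists_derivedDilation`).
-/


/-! ### Hilbert-Schmidt bounds and Gram-Schmidt orthogonalization -/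

section HilbertSchmidt

open InnerProductSpace

variable {𝕜 H K G : Type*} [RCLike 𝕜]
  [NormedAddCommGroup H] [InnerProductSpace 𝕜 H]
  [NormedAddCommGroup K] [InnerProductSpace 𝕜 K]
  [NormedAddCommGroup G] [InnerProductSpace 𝕜 G]

/-- The square of the Hilbert-Schmidt norm of `A` is at most `h`: the sums `∑ ‖A g_i‖ ^ 2` over
finite orthonormal families are bounded by `h`. -/
def HilbertSchmidtBound (A : H →L[𝕜] K) (h : ℝ) : Prop :=
  ∀ (r : ℕ) (g : Fin r → H), Orthonormal 𝕜 g → ∑ i, ‖A (g i)‖ ^ 2 ≤ h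

theorem HilbertSchmidtBound.sum_le {A : H →L[𝕜] K} {h : ℝ} (hA : HilbertSchmidtBound A h)
    {ι : Type*} [Fintype ι] {g : ι → H} (hg : Orthonormal 𝕜 g) : ∑ i, ‖A (g i)‖ ^ 2 ≤ h := by
  let e := Fintype.equivFin ι
  have := hA _ (g ∘ e.symm) (hg.comp _ e.symm.injective)
  rwa [← Equiv.sum_comp e.symm (fun i => ‖A (g i)‖ ^ 2)]

theorem gramSchmidt_eq_sub {r : ℕ} (w : Fin r → H) (i : Fin r) :
    ∃ y ∈ Submodule.span 𝕜 (w '' Iio i), gramSchmidt 𝕜 w i = w i - y := by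
  refine ⟨w i - gramSchmidt 𝕜 w i, ?_, by abel⟩
  rw [← span_gramSchmidt_Iio 𝕜 w i, gramSchmidt_def, sub_sub_cancel]
  refine Submodule.sum_mem _ fun l hl => ?_
  refine (Submodule.span_mono ?_) (Submodule.coe_mem
    ((𝕜 ∙ gramSchmidt 𝕜 w l).orthogonalProjectionOnto (w i)))
  simpa using ⟨l, by simpa using hl, rfl⟩

/-- The `i`-th Gram-Schmidt vector is the shortest vector in `w i + span {w l | l < i}`. -/
theorem norm_gramSchmidt_le {r : ℕ} (w : Fin r → H) (i : Fin r) {y : H}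
    (hy : y ∈ Submodule.span 𝕜 (w '' Iio i)) : ‖gramSchmidt 𝕜 w i‖ ≤ ‖w i - y‖ := by
  have h1 : w i - gramSchmidt 𝕜 w i ∈ Submodule.span 𝕜 (w '' Iio i) := by
    obtain ⟨z, hz, h⟩ := gramSchmidt_eq_sub (𝕜 := 𝕜) w i
    rwa [h, sub_sub_cancel]
  have h2 : inner 𝕜 (gramSchmidt 𝕜 w i) (w i - gramSchmidt 𝕜 w i - y) = 0 := by
    have h3 := Submodule.sub_mem _ h1 hy
    rw [← span_gramSchmidt_Iio 𝕜 w i] at h3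
    refine Submodule.span_induction (p := fun z _ => inner 𝕜 (gramSchmidt 𝕜 w i) z = 0)
      ?_ ?_ ?_ ?_ h3
    · rintro _ ⟨l, hl, rfl⟩
      exact gramSchmidt_orthogonal 𝕜 w (ne_of_gt hl)
    · simp
    · intro a b _ _ ha hb; simp [inner_add_right, ha, hb]
    · intro c a _ ha; simp [inner_smul_right, ha]
  have h4 : w i - y = gramSchmidt 𝕜 w i + (w i - gramSchmidt 𝕜 w i - y) := by abel
  have h5 := norm_add_sq_eq_norm_sq_add_norm_sq_of_inner_eq_zero _ _ h2
  rw [← h4] at h5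
  nlinarith [norm_nonneg (gramSchmidt 𝕜 w i), norm_nonneg (w i - y),
    mul_self_nonneg ‖w i - gramSchmidt 𝕜 w i - y‖]

/-- Orthogonalizing the images is not longer than mapping the orthogonalized vectors. -/
theorem norm_gramSchmidt_map_le {r : ℕ} (A : H →L[𝕜] K) (w : Fin r → H) (i : Fin r) :
    ‖gramSchmidt 𝕜 (fun j => A (w j)) i‖ ≤ ‖A (gramSchmidt 𝕜 w i)‖ := by
  obtain ⟨y, hy, h⟩ := gramSchmidt_eq_sub (𝕜 := 𝕜) w i
  rw [h, map_sub]
  refine norm_gramSchmidt_le (fun j => A (w j)) i ?_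
  have := Submodule.mem_map_of_mem (f := (A : H →ₗ[𝕜] K)) hy
  rw [Submodule.map_span, ← image_comp] at this
  exact this

/-- A Hilbert-Schmidt operator shrinks the Gram-Schmidt vectors by square-summable factors. -/
theorem HilbertSchmidtBound.exists_factor {A : H →L[𝕜] K} {h : ℝ} (hA : HilbertSchmidtBound A h)
    {r : ℕ} (w : Fin r → H) :
    ∃ a : Fin r → ℝ, (∀ i, 0 ≤ a i) ∧ ∑ i, a i ^ 2 ≤ h ∧
      ∀ i, ‖gramSchmidt 𝕜 (fun j => A (w j)) i‖ ≤ a i * ‖gramSchmidt 𝕜 w i‖ := by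
  refine ⟨fun i => ‖A (gramSchmidtNormed 𝕜 w i)‖, fun i => norm_nonneg _, ?_, fun i => ?_⟩
  · classical
    have h1 := hA.sum_le (gramSchmidtNormed_orthonormal' (𝕜 := 𝕜) w)
    refine le_trans (le_of_eq ?_) h1
    rw [← Finset.sum_subset (Finset.subset_univ
      (Finset.univ.filter fun i => gramSchmidtNormed 𝕜 w i ≠ 0))]
    · exact (Finset.sum_subtype _ (by simp) fun i => ‖A (gramSchmidtNormed 𝕜 w i)‖ ^ 2)
    · intro i _ hi
      have : gramSchmidtNormed 𝕜 w i = 0 := by simpa using hi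
      simp [this]
  · refine (norm_gramSchmidt_map_le A w i).trans (le_of_eq ?_)
    by_cases h0 : gramSchmidt 𝕜 w i = 0
    · simp [h0]
    · have : ‖gramSchmidt 𝕜 w i‖ ≠ 0 := by simpa using h0
      simp only [gramSchmidtNormed, map_smul, norm_smul, norm_inv, RCLike.norm_ofReal, abs_norm]
      field_simp

theorem HilbertSchmidtBound.exists_factor_pow {A : G →L[𝕜] G} {h : ℝ}
    (hA : HilbertSchmidtBound A h) {r : ℕ} (w : Fin r → G) (k : ℕ) :
    ∃ a : Fin k → Fin r → ℝ, (∀ l i, 0 ≤ a l i) ∧ (∀ l, ∑ i, a l i ^ 2 ≤ h) ∧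
      ∀ i, ‖gramSchmidt 𝕜 (fun j => (A ^ k) (w j)) i‖ ≤ (∏ l, a l i) * ‖gramSchmidt 𝕜 w i‖ := by
  induction k with
  | zero => exact ⟨fun _ _ => 0, by simp, fun l => l.elim0, by simp⟩
  | succ k ih =>
    obtain ⟨a, ha0, ha, hw⟩ := ih
    obtain ⟨c, hc0, hc, hw'⟩ := hA.exists_factor (fun j => (A ^ k) (w j))
    refine ⟨Fin.cons c a, ?_, ?_, fun i => ?_⟩
    · intro l; refine Fin.cases ?_ ?_ l
      · simpa using hc0
      · intro l; simpa using ha0 l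
    · intro l; refine Fin.cases ?_ ?_ l
      · simpa using hc
      · intro l; simpa using ha l
    · have h1 : (fun j => (A ^ (k + 1)) (w j)) = fun j => A ((A ^ k) (w j)) := by
        funext j; rw [pow_succ']; rfl
      rw [h1, Fin.prod_univ_succ]
      simp only [Fin.cons_zero, Fin.cons_succ]
      calc _ ≤ c i * ‖gramSchmidt 𝕜 (fun j => (A ^ k) (w j)) i‖ := hw' i
        _ ≤ c i * ((∏ l, a l i) * ‖gramSchmidt 𝕜 w i‖) := by gcongr; exacts [hc0 i, hw i]
        _ = _ := by ring

/-- Hölder's inequality in the form needed for products of `k` Hilbert-Schmidt operators, derived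
from the inequality between the geometric and the arithmetic mean. -/
theorem sum_prod_rpow_le {r k : ℕ} (hk : 1 ≤ k) {h : ℝ} (a : Fin k → Fin r → ℝ)
    (ha0 : ∀ l i, 0 ≤ a l i) (ha : ∀ l, ∑ i, a l i ^ 2 ≤ h) :
    ∑ i, (∏ l, a l i) ^ (2 / k : ℝ) ≤ h := by
  have hk' : (0 : ℝ) < k := by exact_mod_cast hk
  have h1 : ∀ i, (∏ l, a l i) ^ (2 / k : ℝ) ≤ ∑ l, (1 / k : ℝ) * a l i ^ 2 := by
    intro i
    have := Real.geom_mean_le_arith_mean_weighted Finset.univ (fun _ : Fin k => (1 / k : ℝ))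
      (fun l => a l i ^ 2) (fun _ _ => by positivity) (by simp [hk'.ne']) (fun l _ => sq_nonneg _)
    refine le_trans (le_of_eq ?_) this
    rw [← Real.finsetProd_rpow _ _ (fun l _ => ha0 l i)]
    refine Finset.prod_congr rfl fun l _ => ?_
    rw [← Real.rpow_natCast, ← Real.rpow_mul (ha0 l i)]
    congr 1; push_cast; ring
  calc _ ≤ ∑ i, ∑ l, (1 / k : ℝ) * a l i ^ 2 := Finset.sum_le_sum fun i _ => h1 i
    _ = ∑ l, (1 / k : ℝ) * ∑ i, a l i ^ 2 := by
      rw [Finset.sum_comm]; simp_rw [Finset.mul_sum]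
    _ ≤ ∑ l : Fin k, (1 / k : ℝ) * h := by gcongr with l; exact ha l
    _ = h := by simp; field_simp

/-- The key estimate for singular values. Let `‖T z‖ ≥ s j ‖z‖` on the span of
`e 0, …, e j`. If `T` is dominated by `A ^ k ∘ D`, with `A` a Hilbert-Schmidt operator, on the
kernel of a map `P` of rank at most `N`, then all but `N` of the `s j` are bounded by products of
`k` square-summable factors: away from `N` indices there are `x j ∈ ker P` that are triangular in
the `e j`, and the lengths of the Gram-Schmidt vectors of `x` and of `A ^ k (D x)` are compared. -/
theorem sum_rpow_le_of_dominated {W : Type*} [NormedAddCommGroup W] [InnerProductSpace 𝕜 W]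
    [FiniteDimensional 𝕜 W] {T : H →L[𝕜] K} {P : H →ₗ[𝕜] W} {D : H →L[𝕜] G} {A : G →L[𝕜] G}
    {h C : ℝ} {k N r : ℕ} (hk : 1 ≤ k) (hN : Module.finrank 𝕜 W ≤ N)
    (hA : HilbertSchmidtBound A h) (hC : 0 ≤ C) (hTD : ∀ z, P z = 0 → ‖T z‖ ≤ C * ‖(A ^ k) (D z)‖)
    {e : Fin r → H} (he : Orthonormal 𝕜 e) {s : Fin r → ℝ} (hs : ∀ j, 0 < s j)
    (hsT : ∀ j, ∀ z ∈ Submodule.span 𝕜 (e '' Iic j), s j * ‖z‖ ≤ ‖T z‖) :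
    ∑ j, s j ^ (2 / k : ℝ) ≤ N * ‖T‖ ^ (2 / k : ℝ) + (C * ‖D‖) ^ (2 / k : ℝ) * h := by
  classical
  have hk' : (0 : ℝ) < 2 / k := by have : (0 : ℝ) < k := by exact_mod_cast hk
                                   positivity
  set J : Finset (Fin r) := Finset.univ.filter fun j => gramSchmidt 𝕜 (fun j => P (e j)) j = 0
    with hJ
  have hmemJ : ∀ j, j ∈ J ↔ gramSchmidt 𝕜 (fun j => P (e j)) j = 0 := by simp [hJ]
  -- The nonzero Gram-Schmidt vectors of `P ∘ e` are independent, so there are at most `N`.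
  have hcard : Jᶜ.card ≤ N := by
    have h1 := (gramSchmidtNormed_orthonormal' (𝕜 := 𝕜) (fun j => P (e j))).linearIndependent
      |>.fintype_card_le_finrank
    refine le_trans (le_of_eq ?_) (h1.trans hN)
    rw [Fintype.card_subtype]
    congr 1
    ext j
    simp [hJ, gramSchmidtNormed]
  -- For the other `j`, `P (e j)` is a combination of the earlier ones, which yields `x j`.
  have hx : ∀ j, ∃ x : H, (j ∉ J → x = 0) ∧ (j ∈ J → P x = 0 ∧
      ∃ y ∈ Submodule.span 𝕜 (e '' Iio j), x = e j - y) := by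
    intro j
    by_cases hj : j ∈ J
    · obtain ⟨y, hy, h1⟩ := gramSchmidt_eq_sub (𝕜 := 𝕜) (fun j => P (e j)) j
      rw [(hmemJ j).1 hj] at h1
      have h2 : (fun j => P (e j)) '' Iio j = P '' (e '' Iio j) := by rw [image_image]
      rw [h2, ← Submodule.map_span] at hy
      obtain ⟨y', hy', rfl⟩ := hy
      exact ⟨e j - y', fun h => absurd hj h, fun _ => ⟨by rw [map_sub]; exact h1.symm,
        y', hy', rfl⟩⟩
    · exact ⟨0, fun _ => rfl, fun h => absurd h hj⟩
  choose x hx0 hx1 using hx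
  have hxP : ∀ j, P (x j) = 0 := by
    intro j
    by_cases hj : j ∈ J
    · exact (hx1 j hj).1
    · rw [hx0 j hj, map_zero]
  have hxmem : ∀ j, x j ∈ Submodule.span 𝕜 (e '' Iic j) := by
    intro j
    by_cases hj : j ∈ J
    · obtain ⟨y, hy, hxy⟩ := (hx1 j hj).2
      rw [hxy]
      refine Submodule.sub_mem _ (Submodule.subset_span ⟨j, self_mem_Iic, rfl⟩)
        (Submodule.span_mono (image_mono Iio_subset_Iic_self) hy)
    · rw [hx0 j hj]; exact Submodule.zero_mem _
  have hspan : ∀ j, Submodule.span 𝕜 (x '' Iio j) ≤ Submodule.span 𝕜 (e '' Iio j) := by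
    intro j
    rw [Submodule.span_le]
    rintro _ ⟨l, hl, rfl⟩
    refine Submodule.span_mono (image_mono ?_) (hxmem l)
    exact Iic_subset_Iio.2 hl
  have hspanP : ∀ j, ∀ y ∈ Submodule.span 𝕜 (x '' Iio j), P y = 0 := by
    intro j y hy
    have : Submodule.span 𝕜 (x '' Iio j) ≤ LinearMap.ker P := by
      rw [Submodule.span_le]
      rintro _ ⟨l, _, rfl⟩
      exact hxP l
    exact this hy
  have hgs : ∀ j ∈ J, gramSchmidt 𝕜 x j ≠ 0 := by
    intro j hj h0
    obtain ⟨y, hy, h1⟩ := gramSchmidt_eq_sub (𝕜 := 𝕜) x j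
    obtain ⟨y', hy', h2⟩ := (hx1 j hj).2
    have h3 : e j ∈ Submodule.span 𝕜 (e '' Iio j) := by
      have : e j = y + y' := by
        rw [h0, h2, eq_comm, sub_sub, sub_eq_zero] at h1
        rw [h1]; abel
      rw [this]
      exact Submodule.add_mem _ (hspan j hy) hy'
    exact he.linearIndependent.notMem_span_image (s := Iio j) (by simp) h3
  obtain ⟨a, ha0, ha, hw⟩ := hA.exists_factor_pow (fun j => D (x j)) k
  have hbound : ∀ j ∈ J, s j ≤ C * ‖D‖ * ∏ l, a l j := by
    intro j hj
    obtain ⟨y, hy, h1⟩ := gramSchmidt_eq_sub (𝕜 := 𝕜) (fun j => (A ^ k) (D (x j))) j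
    have h2 : (fun j => (A ^ k) (D (x j))) '' Iio j
        = (((A ^ k).comp D : H →L[𝕜] G) : H →ₗ[𝕜] G) '' (x '' Iio j) := by
      rw [image_image]; rfl
    rw [h2, ← Submodule.map_span] at hy
    obtain ⟨y', hy', rfl⟩ := hy
    have h3 : gramSchmidt 𝕜 (fun j => (A ^ k) (D (x j))) j = (A ^ k) (D (x j - y')) := by
      rw [h1, map_sub, map_sub]; rfl
    have h4 : s j * ‖gramSchmidt 𝕜 x j‖ ≤ C * ‖D‖ * (∏ l, a l j) * ‖gramSchmidt 𝕜 x j‖ := by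
      calc s j * ‖gramSchmidt 𝕜 x j‖ ≤ s j * ‖x j - y'‖ := by
            have := hs j
            gcongr
            exact norm_gramSchmidt_le x j hy'
        _ ≤ ‖T (x j - y')‖ := by
            refine hsT j _ (Submodule.sub_mem _ (hxmem j) ?_)
            exact Submodule.span_mono (image_mono Iio_subset_Iic_self) (hspan j hy')
        _ ≤ C * ‖(A ^ k) (D (x j - y'))‖ := by
            refine hTD _ ?_
            rw [map_sub, hxP, hspanP j y' hy', sub_zero]
        _ ≤ C * ((∏ l, a l j) * (‖D‖ * ‖gramSchmidt 𝕜 x j‖)) := by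
            rw [← h3]
            have h5 : 0 ≤ ∏ l, a l j := Finset.prod_nonneg fun l _ => ha0 l j
            gcongr
            refine (hw j).trans ?_
            gcongr
            exact (norm_gramSchmidt_map_le D x j).trans (D.le_opNorm _)
        _ = _ := by ring
    exact le_of_mul_le_mul_right h4 (norm_pos_iff.2 (hgs j hj))
  rw [← Finset.sum_compl_add_sum J]
  refine add_le_add ?_ ?_
  · calc ∑ j ∈ Jᶜ, s j ^ (2 / k : ℝ) ≤ ∑ j ∈ Jᶜ, ‖T‖ ^ (2 / k : ℝ) := by
          refine Finset.sum_le_sum fun j _ => ?_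
          refine Real.rpow_le_rpow (hs j).le ?_ hk'.le
          have h1 := hsT j (e j) (Submodule.subset_span ⟨j, self_mem_Iic, rfl⟩)
          have h2 := T.le_opNorm (e j)
          rw [he.1 j, mul_one] at h1 h2
          exact h1.trans h2
      _ = Jᶜ.card * ‖T‖ ^ (2 / k : ℝ) := by rw [Finset.sum_const, nsmul_eq_mul]
      _ ≤ _ := by gcongr
  · calc ∑ j ∈ J, s j ^ (2 / k : ℝ)
        ≤ ∑ j ∈ J, (C * ‖D‖) ^ (2 / k : ℝ) * (∏ l, a l j) ^ (2 / k : ℝ) := by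
          refine Finset.sum_le_sum fun j hj => ?_
          rw [← Real.mul_rpow (by positivity) (Finset.prod_nonneg fun l _ => ha0 l j)]
          exact Real.rpow_le_rpow (hs j).le (hbound j hj) hk'.le
      _ ≤ ∑ j, (C * ‖D‖) ^ (2 / k : ℝ) * (∏ l, a l j) ^ (2 / k : ℝ) := by
          refine Finset.sum_le_sum_of_subset_of_nonneg (Finset.subset_univ _) fun j _ _ => ?_
          have h5 : 0 ≤ ∏ l, a l j := Finset.prod_nonneg fun l _ => ha0 l j
          positivity
      _ ≤ _ := by
          rw [← Finset.mul_sum]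
          gcongr
          exact sum_prod_rpow_le hk a ha0 ha

end HilbertSchmidt

/-! ### Compactness of Hilbert-Schmidt operators and Schatten sums -/

section HilbertSchmidtCompact

variable {𝕜 H K : Type*} [RCLike 𝕜]
  [NormedAddCommGroup H] [InnerProductSpace 𝕜 H]
  [NormedAddCommGroup K] [InnerProductSpace 𝕜 K]

/-- A finite orthonormal family that almost exhausts the Hilbert-Schmidt norm of `A` spans a
subspace off which `A` is small, so `A` is a limit of operators of finite rank. -/
theorem HilbertSchmidtBound.isCompactOperator [CompleteSpace K] {A : H →L[𝕜] K} {h : ℝ}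
    (hA : HilbertSchmidtBound A h) : IsCompactOperator A := by
  have hcl := isClosed_setOfPred_isCompactOperator (M₁ := H) (M₂ := K) (σ₁₂ := RingHom.id 𝕜)
  have : A ∈ {f : H →L[𝕜] K | IsCompactOperator f} := by
    rw [← hcl.closure_eq, Metric.mem_closure_iff]
    intro ε hε
    set S : Set ℝ := {t | ∃ (r : ℕ) (g : Fin r → H), Orthonormal 𝕜 g ∧ t = ∑ i, ‖A (g i)‖ ^ 2}
      with hS
    have hbdd : BddAbove S := ⟨h, by rintro _ ⟨r, g, hg, rfl⟩; exact hA r g hg⟩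
    have hne : S.Nonempty := ⟨_, 0, Fin.elim0, ⟨fun i => i.elim0, fun i => i.elim0⟩, rfl⟩
    obtain ⟨_, ⟨r, g, hg, rfl⟩, hlt⟩ := exists_lt_of_lt_csSup hne
      (show sSup S - (ε / 2) ^ 2 < sSup S by have := pow_pos (half_pos hε) 2; linarith)
    set U := Submodule.span 𝕜 (range g) with hU
    have : FiniteDimensional 𝕜 U := FiniteDimensional.span_of_finite 𝕜 (finite_range g)
    have hperp : ∀ v ∈ Uᗮ, ‖A v‖ ≤ ε / 2 * ‖v‖ := by
      have hunit : ∀ v ∈ Uᗮ, ‖v‖ = 1 → ‖A v‖ ≤ ε / 2 := by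
        intro v hv hv1
        have hon : Orthonormal 𝕜 (Fin.cons v g : Fin (r + 1) → H) := by
          have h0 : ∀ i, inner 𝕜 (g i) v = 0 := fun i =>
            (Submodule.mem_orthogonal U v).1 hv _ (Submodule.subset_span ⟨i, rfl⟩)
          have h0' : ∀ i, inner 𝕜 v (g i) = 0 := fun i => inner_eq_zero_symm.1 (h0 i)
          refine ⟨fun i => Fin.cases (by simpa using hv1) (fun i => by simpa using hg.1 i) i, ?_⟩
          intro i j
          refine Fin.cases ?_ (fun i => ?_) i <;> refine Fin.cases ?_ (fun j => ?_) j
          · simp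
          · simp [h0']
          · simp [h0]
          · intro hij
            simpa using hg.2 (fun h => hij (by rw [h]))
        have h1 := le_csSup hbdd ⟨r + 1, _, hon, rfl⟩
        rw [Fin.sum_univ_succ] at h1
        simp only [Fin.cons_zero, Fin.cons_succ] at h1
        exact le_of_sq_le_sq (by linarith) (half_pos hε).le
      intro v hv
      by_cases hv0 : v = 0
      · simp [hv0]
      · have hv0' : ‖v‖ ≠ 0 := by simpa using hv0
        have h1 := hunit (((‖v‖⁻¹ : ℝ) : 𝕜) • v) (Submodule.smul_mem _ _ hv)
          (by rw [norm_smul]; simp [hv0'])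
        rw [map_smul, norm_smul] at h1
        simp only [RCLike.norm_ofReal, abs_inv, abs_norm] at h1
        rwa [inv_mul_le_iff₀ (by positivity), mul_comm] at h1
    refine ⟨A ∘L U.starProjection, ?_, ?_⟩
    · have : ProperSpace U := FiniteDimensional.proper 𝕜 U
      have h1 : IsCompactOperator (A ∘L U.subtypeL) :=
        isCompactOperator_of_locallyCompactSpace_rng (A ∘L U.subtypeL)
      exact h1.comp_clm (U.orthogonalProjectionOnto)
    · rw [dist_eq_norm]
      refine lt_of_le_of_lt (ContinuousLinearMap.opNorm_le_bound _ (half_pos hε).le fun x => ?_)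
        (half_lt_self hε)
      have h1 : (A - A ∘L U.starProjection) x = A (x - U.starProjection x) := by simp
      rw [h1]
      refine (hperp _ (U.sub_starProjection_mem_orthogonal x)).trans ?_
      gcongr
      have h2 := norm_add_sq_eq_norm_sq_add_norm_sq_of_inner_eq_zero (𝕜 := 𝕜)
        (U.starProjection x) (x - U.starProjection x)
        ((Submodule.mem_orthogonal U _).1 (U.sub_starProjection_mem_orthogonal x) _
          (U.starProjection_apply_mem x))
      rw [add_sub_cancel] at h2
      nlinarith [norm_nonneg x, norm_nonneg (x - U.starProjection x),
        mul_self_nonneg ‖U.starProjection x‖]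
  exact this

/-- The eigenspaces for different squares are orthogonal, so orthonormal bases of finitely many of
them form an orthonormal family. An eigenspace of infinite dimension has `finrank` zero and
contributes nothing. -/
theorem exists_orthonormal_eigenvectors {L : H →ₗ[𝕜] H} (hL : L.IsSymmetric)
    (F : Finset (Ioi (0 : ℝ))) (d : Ioi (0 : ℝ) → ℕ)
    (hd : ∀ s, d s = Module.finrank 𝕜 (Module.End.eigenspace L (((s : ℝ) ^ 2 : ℝ) : 𝕜))) :
    ∃ v : (Σ s : F, Fin (d s)) → H, Orthonormal 𝕜 v ∧
      ∀ a, L (v a) = (((((a.1 : Ioi (0 : ℝ)) : ℝ) ^ 2 : ℝ)) : 𝕜) • v a := by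
  have hbasis : ∀ s : F, ∃ b : Fin (d s) →
      Module.End.eigenspace L ((((s : Ioi (0 : ℝ)) : ℝ) ^ 2 : ℝ) : 𝕜), Orthonormal 𝕜 b := by
    intro s
    rw [hd s]
    rcases Nat.eq_zero_or_pos (Module.finrank 𝕜
      (Module.End.eigenspace L ((((s : Ioi (0 : ℝ)) : ℝ) ^ 2 : ℝ) : 𝕜))) with h0 | h0
    · rw [h0]
      exact ⟨isEmptyElim, fun i => isEmptyElim i, fun i => isEmptyElim i⟩
    · have := Module.finite_of_finrank_pos h0
      exact ⟨_, (stdOrthonormalBasis 𝕜 _).orthonormal⟩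
  choose b hb using hbasis
  have hinj : Function.Injective fun s : F => ((((s : Ioi (0 : ℝ)) : ℝ) ^ 2 : ℝ) : 𝕜) := by
    intro s t hst
    have h1 : (((s : Ioi (0 : ℝ)) : ℝ) ^ 2) = ((t : Ioi (0 : ℝ)) : ℝ) ^ 2 :=
      RCLike.ofReal_injective hst
    have h2 := (pow_left_inj₀ (le_of_lt (s : Ioi (0 : ℝ)).2) (le_of_lt (t : Ioi (0 : ℝ)).2)
      two_ne_zero).1 h1
    exact Subtype.ext (Subtype.ext h2)
  refine ⟨_, (hL.orthogonalFamily_eigenspaces.comp hinj).orthonormal_sigma_orthonormal hb, ?_⟩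
  intro a
  exact Module.End.mem_eigenspace_iff.1 (b a.1 a.2).2

end HilbertSchmidtCompact

section SchattenSum

variable {𝕜 H₁ H₂ : Type*} [RCLike 𝕜]
  [NormedAddCommGroup H₁] [InnerProductSpace 𝕜 H₁] [CompleteSpace H₁]
  [NormedAddCommGroup H₂] [InnerProductSpace 𝕜 H₂] [CompleteSpace H₂]

/-- On the span of the first eigenvectors of `T* T`, in decreasing order of the singular values,
`T` is bounded below by the last singular value. -/
theorem mul_norm_le_norm_of_mem_span {T : H₁ →L[𝕜] H₂} {r : ℕ} {e : Fin r → H₁} {s : Fin r → ℝ}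
    (he : Orthonormal 𝕜 e) (hs : ∀ j, 0 < s j) (hanti : Antitone s)
    (hT : ∀ j, (ContinuousLinearMap.adjoint T) (T (e j)) = ((s j ^ 2 : ℝ) : 𝕜) • e j)
    (j : Fin r) {z : H₁} (hz : z ∈ Submodule.span 𝕜 (e '' Iic j)) : s j * ‖z‖ ≤ ‖T z‖ := by
  have h0 : (Iic j : Set (Fin r)) = (Finset.Iic j : Finset (Fin r)) := by simp
  rw [h0, Submodule.mem_span_image_finset_iff_exists_fun] at hz
  obtain ⟨c, rfl⟩ := hz
  have he' := he.comp (fun i : Finset.Iic j => (i : Fin r)) Subtype.val_injective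
  have he'' : ∀ a b : Finset.Iic j → 𝕜, inner 𝕜 (∑ i : Finset.Iic j, a i • e i)
      (∑ i : Finset.Iic j, b i • e i) = ∑ i, (starRingEnd 𝕜) (a i) * b i :=
    fun a b => he'.inner_sum a b Finset.univ
  have h1 : ‖T (∑ i : Finset.Iic j, c i • e i)‖ ^ 2 = ∑ i : Finset.Iic j, s i ^ 2 * ‖c i‖ ^ 2 := by
    have : ((‖T (∑ i : Finset.Iic j, c i • e i)‖ ^ 2 : ℝ) : 𝕜)
        = ((∑ i : Finset.Iic j, s i ^ 2 * ‖c i‖ ^ 2 : ℝ) : 𝕜) := by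
      push_cast
      rw [← inner_self_eq_norm_sq_to_K (𝕜 := 𝕜), ← ContinuousLinearMap.adjoint_inner_left]
      simp only [map_sum, map_smul, hT, smul_smul]
      rw [he'']
      refine Finset.sum_congr rfl fun i _ => ?_
      rw [map_mul, RCLike.conj_ofReal, mul_right_comm, RCLike.conj_mul]
      push_cast; ring
    exact_mod_cast this
  have h2 : ‖∑ i : Finset.Iic j, c i • e i‖ ^ 2 = ∑ i : Finset.Iic j, ‖c i‖ ^ 2 := by
    have : ((‖∑ i : Finset.Iic j, c i • e i‖ ^ 2 : ℝ) : 𝕜)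
        = ((∑ i : Finset.Iic j, ‖c i‖ ^ 2 : ℝ) : 𝕜) := by
      push_cast
      rw [← inner_self_eq_norm_sq_to_K (𝕜 := 𝕜), he'']
      exact Finset.sum_congr rfl fun i _ => RCLike.conj_mul _
    exact_mod_cast this
  refine le_of_sq_le_sq ?_ (norm_nonneg _)
  rw [mul_pow, h1, h2, Finset.mul_sum]
  refine Finset.sum_le_sum fun i hi => ?_
  have := hs j
  have h3 := hanti (Finset.mem_Iic.1 i.2)
  gcongr

theorem sum_rpow_le_of_eigenvectors {T : H₁ →L[𝕜] H₂} {q B : ℝ}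
    (hB : ∀ (r : ℕ) (e : Fin r → H₁) (s : Fin r → ℝ), Orthonormal 𝕜 e → (∀ j, 0 < s j) →
      (∀ j, ∀ z ∈ Submodule.span 𝕜 (e '' Iic j), s j * ‖z‖ ≤ ‖T z‖) → ∑ j, s j ^ q ≤ B)
    {ι : Type*} [Fintype ι] {v : ι → H₁} {s : ι → ℝ} (hv : Orthonormal 𝕜 v) (hs : ∀ i, 0 < s i)
    (hT : ∀ i, (ContinuousLinearMap.adjoint T) (T (v i)) = ((s i ^ 2 : ℝ) : 𝕜) • v i) :
    ∑ i, s i ^ q ≤ B := by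
  let f := (Fintype.equivFin ι).symm
  let g : Fin _ → ℝ := fun i => -s (f i)
  let τ := Tuple.sort g
  have hmono : Monotone (g ∘ τ) := Tuple.monotone_sort g
  have hon : Orthonormal 𝕜 fun i => v (f (τ i)) := hv.comp _ (f.injective.comp τ.injective)
  have hmain := hB _ (fun i => v (f (τ i))) (fun i => s (f (τ i))) hon (fun i => hs _)
    (fun j z hz => mul_norm_le_norm_of_mem_span hon (fun i => hs _)
      (fun i j hij => by simpa [g] using hmono hij) (fun i => hT _) j hz)
  have hre := Equiv.sum_comp (τ.trans f) fun a => s a ^ q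
  simp only [Equiv.trans_apply] at hre
  rwa [hre] at hmain

/-- To bound the Schatten sum, it is enough to bound the sum over finite orthonormal families of
eigenvectors of `T* T`, ordered by decreasing singular values. -/
theorem schattenSum_le_ofReal {T : H₁ →L[𝕜] H₂} {q B : ℝ}
    (hB : ∀ (r : ℕ) (e : Fin r → H₁) (s : Fin r → ℝ), Orthonormal 𝕜 e → (∀ j, 0 < s j) →
      (∀ j, ∀ z ∈ Submodule.span 𝕜 (e '' Iic j), s j * ‖z‖ ≤ ‖T z‖) → ∑ j, s j ^ q ≤ B) :
    schattenSum q T ≤ ENNReal.ofReal B := by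
  rw [schattenSum, ENNReal.tsum_eq_iSup_sum]
  refine iSup_le fun F => ?_
  have hsymm : ((ContinuousLinearMap.adjoint T ∘L T : H₁ →L[𝕜] H₁) : H₁ →ₗ[𝕜] H₁).IsSymmetric := by
    intro x y
    simp [ContinuousLinearMap.adjoint_inner_left, ContinuousLinearMap.adjoint_inner_right]
  obtain ⟨d, hd⟩ : ∃ d : Ioi (0 : ℝ) → ℕ, ∀ s : Ioi (0 : ℝ), singularMultiplicity T s = d s :=
    ⟨_, fun _ => rfl⟩
  obtain ⟨v, hfam, hv⟩ := exists_orthonormal_eigenvectors hsymm F d fun s => (hd s).symm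
  have hmain := sum_rpow_le_of_eigenvectors hB
    (s := fun a : (Σ s : F, Fin (d s)) => ((a.1 : Ioi (0 : ℝ)) : ℝ)) hfam
    (fun a => (a.1 : Ioi (0 : ℝ)).2) hv
  rw [Fintype.sum_sigma] at hmain
  refine le_trans (le_of_eq ?_) (ENNReal.ofReal_le_ofReal hmain)
  have hnn : ∀ s : Ioi (0 : ℝ), 0 ≤ (s : ℝ) ^ q := fun s => Real.rpow_nonneg (le_of_lt s.2) q
  rw [ENNReal.ofReal_sum_of_nonneg (fun s _ => Finset.sum_nonneg fun _ _ => hnn _),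
    ← Finset.sum_coe_sort F]
  refine Finset.sum_congr rfl fun s _ => ?_
  simp only [hd, Finset.sum_const, Finset.card_univ, Fintype.card_fin, nsmul_eq_mul]
  rw [ENNReal.ofReal_mul (by positivity), ENNReal.ofReal_natCast]

/-- The quantitative bound for an operator that is dominated by `A ^ k ∘ D` on a subspace of
codimension at most `N`. -/
theorem schattenSum_le_of_dominated {W G : Type*} [NormedAddCommGroup W] [InnerProductSpace 𝕜 W]
    [FiniteDimensional 𝕜 W] [NormedAddCommGroup G] [InnerProductSpace 𝕜 G]
    {T : H₁ →L[𝕜] H₂} {P : H₁ →ₗ[𝕜] W} {D : H₁ →L[𝕜] G} {A : G →L[𝕜] G}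
    {h C : ℝ} {k N : ℕ} (hk : 1 ≤ k) (hN : Module.finrank 𝕜 W ≤ N)
    (hA : HilbertSchmidtBound A h) (hC : 0 ≤ C)
    (hTD : ∀ z, P z = 0 → ‖T z‖ ≤ C * ‖(A ^ k) (D z)‖) :
    schattenSum (2 / k) T
      ≤ ENNReal.ofReal (N * ‖T‖ ^ (2 / k : ℝ) + (C * ‖D‖) ^ (2 / k : ℝ) * h) :=
  schattenSum_le_ofReal fun _ _ _ he hs hsT => sum_rpow_le_of_dominated hk hN hA hC hTD he hs hsT

/-- An operator that is dominated by arbitrarily high powers of Hilbert-Schmidt operators belongs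
to all Schatten classes. -/
theorem schattenSum_lt_top_of_dominated {T : H₁ →L[𝕜] H₂}
    (hT : ∀ k : ℕ, 1 ≤ k → ∃ (A : H₁ →L[𝕜] H₁) (h C : ℝ), HilbertSchmidtBound A h ∧ 0 ≤ C ∧
      ∀ z, ‖T z‖ ≤ C * ‖(A ^ k) z‖) {q : ℝ} (hq : 0 < q) : schattenSum q T < ⊤ := by
  obtain ⟨n, hn⟩ := exists_nat_gt (2 / q)
  set k := n + 1 with hk
  have hk0 : (0 : ℝ) < k := by positivity
  have hkq : 2 / (k : ℝ) ≤ q := by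
    rw [div_le_iff₀ hk0]
    rw [div_lt_iff₀ hq] at hn
    push_cast [hk]; nlinarith
  obtain ⟨A, h, C, hA, hC, hTA⟩ := hT k (by omega)
  -- For `k ≥ 2 / q`, one has `s ^ q ≤ ‖T‖ ^ (q - 2 / k) * s ^ (2 / k)`.
  refine lt_of_le_of_lt (schattenSum_le_ofReal (B := ‖T‖ ^ (q - 2 / k) *
    (((0 : ℕ) : ℝ) * ‖T‖ ^ (2 / k : ℝ) +
      (C * ‖ContinuousLinearMap.id 𝕜 H₁‖) ^ (2 / k : ℝ) * h)) ?_) ENNReal.ofReal_lt_top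
  intro r e s he hs hsT
  have h1 := sum_rpow_le_of_dominated (T := T) (P := (0 : H₁ →ₗ[𝕜] EuclideanSpace 𝕜 (Fin 0)))
    (D := ContinuousLinearMap.id 𝕜 H₁) (N := 0) (by omega : 1 ≤ k) (by simp) hA hC
    (fun z _ => hTA z) he hs hsT
  refine le_trans ?_ (mul_le_mul_of_nonneg_left h1 (by positivity))
  rw [Finset.mul_sum]
  refine Finset.sum_le_sum fun j _ => ?_
  have h2 := hsT j (e j) (Submodule.subset_span ⟨j, self_mem_Iic, rfl⟩)
  have h3 := T.le_opNorm (e j)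
  rw [he.1 j, mul_one] at h2 h3
  calc s j ^ q = s j ^ (q - 2 / k) * s j ^ (2 / k : ℝ) := by
        rw [← Real.rpow_add (hs j)]; congr 1; ring
    _ ≤ _ := by
        have := hs j
        gcongr
        exact h2.trans h3

end SchattenSum

/-! ### Cauchy matrices -/

section Cauchy

variable {ι : Type*} {F : Finset ι} {l : ι → ℝ}

/-- The quadratic form of the Cauchy matrix `1 / (l n + l m)`. It is the square of the norm of
`∑ c n • x ^ (l n - 1 / 2)` in `L²([0, 1])`. -/
noncomputable def cauchyForm (F : Finset ι) (l c : ι → ℝ) : ℝ :=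
  ∑ n ∈ F, ∑ m ∈ F, c n * c m / (l n + l m)

theorem integral_exp_neg_mul_Ioi {a : ℝ} (ha : 0 < a) :
    ∫ t in Ioi (0 : ℝ), Real.exp (-(a * t)) = 1 / a := by
  have := integral_exp_mul_Ioi (a := -a) (by linarith) 0
  simpa [neg_div_neg_eq] using this

theorem integrableOn_exp_neg_mul_Ioi {a : ℝ} (ha : 0 < a) :
    IntegrableOn (fun t : ℝ => Real.exp (-(a * t))) (Ioi 0) := by
  have := integrableOn_exp_mul_Ioi (a := -a) (by linarith) 0
  simpa using this

theorem sum_mul_exp_sq (b : ι → ℝ) (t : ℝ) : (∑ n ∈ F, b n * Real.exp (-(l n * t))) ^ 2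
    = ∑ n ∈ F, ∑ m ∈ F, b n * b m * Real.exp (-((l n + l m) * t)) := by
  rw [sq, Finset.sum_mul_sum]
  refine Finset.sum_congr rfl fun n _ => Finset.sum_congr rfl fun m _ => ?_
  rw [show -((l n + l m) * t) = -(l n * t) + -(l m * t) by ring, Real.exp_add]
  ring

theorem integrableOn_sum_mul_exp_sq (hpos : ∀ n ∈ F, 0 < l n) (b : ι → ℝ) :
    IntegrableOn (fun t => (∑ n ∈ F, b n * Real.exp (-(l n * t))) ^ 2) (Ioi 0) := by
  simp_rw [sum_mul_exp_sq]
  exact integrable_finsetSum _ fun n hn => integrable_finsetSum _ fun m hm =>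
    (integrableOn_exp_neg_mul_Ioi (add_pos (hpos n hn) (hpos m hm))).const_mul _

theorem integral_sum_mul_exp_sq (hpos : ∀ n ∈ F, 0 < l n) (b : ι → ℝ) :
    ∫ t in Ioi (0 : ℝ), (∑ n ∈ F, b n * Real.exp (-(l n * t))) ^ 2 = cauchyForm F l b := by
  have hint : ∀ n ∈ F, ∀ m ∈ F, IntegrableOn
      (fun t => b n * b m * Real.exp (-((l n + l m) * t))) (Ioi 0) := fun n hn m hm =>
    (integrableOn_exp_neg_mul_Ioi (add_pos (hpos n hn) (hpos m hm))).const_mul _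
  simp_rw [sum_mul_exp_sq]
  rw [integral_finsetSum _ fun n hn => integrable_finsetSum _ fun m hm => hint n hn m hm]
  refine Finset.sum_congr rfl fun n hn => ?_
  rw [integral_finsetSum _ fun m hm => hint n hn m hm]
  refine Finset.sum_congr rfl fun m hm => ?_
  rw [integral_const_mul, integral_exp_neg_mul_Ioi (add_pos (hpos n hn) (hpos m hm)), mul_one_div]

theorem cauchyForm_nonneg (hpos : ∀ n ∈ F, 0 < l n) (b : ι → ℝ) : 0 ≤ cauchyForm F l b := by
  rw [← integral_sum_mul_exp_sq hpos]
  exact integral_nonneg fun t => sq_nonneg _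

/-- The Cauchy-Schwarz inequality for `∑ b n * exp (-l n * t)` and `exp (-w * t)` on `(0, ∞)`. -/
theorem norm_sum_div_add_le (hpos : ∀ n ∈ F, 0 < l n) (b : ι → ℝ) {w : ℂ} (hw : 0 < w.re) :
    ‖∑ n ∈ F, (b n : ℂ) / ((l n : ℂ) + w)‖ ≤ √(cauchyForm F l b) * √(1 / (2 * w.re)) := by
  set u : ℝ → ℝ := fun t => ∑ n ∈ F, b n * Real.exp (-(l n * t)) with hu
  have hu2int : IntegrableOn (fun t => u t ^ 2) (Ioi 0) := integrableOn_sum_mul_exp_sq hpos b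
  have hform : ∫ t in Ioi (0 : ℝ), u t ^ 2 = cauchyForm F l b := integral_sum_mul_exp_sq hpos b
  set v : ℝ → ℝ := fun t => Real.exp (-(w.re * t)) with hv
  have hv2 : ∀ t, v t ^ 2 = Real.exp (-((2 * w.re) * t)) := by
    intro t; rw [hv, sq, ← Real.exp_add]; congr 1; ring
  have hucont : Continuous u := by fun_prop
  have hvcont : Continuous v := by fun_prop
  have huL : MemLp (fun t => |u t|) (ENNReal.ofReal 2) (volume.restrict (Ioi 0)) := by
    rw [show ENNReal.ofReal 2 = 2 by simp, memLp_two_iff_integrable_sq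
      hucont.abs.aestronglyMeasurable]
    simp only [sq_abs]
    exact hu2int
  have hvL : MemLp v (ENNReal.ofReal 2) (volume.restrict (Ioi 0)) := by
    rw [show ENNReal.ofReal 2 = 2 by simp, memLp_two_iff_integrable_sq
      hvcont.aestronglyMeasurable]
    simp_rw [hv2]
    exact integrableOn_exp_neg_mul_Ioi (by linarith)
  have hterm : ∀ n ∈ F, ∫ t in Ioi (0 : ℝ), (b n : ℂ) * Complex.exp (-((l n : ℂ) + w) * t)
      = (b n : ℂ) / ((l n : ℂ) + w) := by
    intro n hn
    have h1 : (-((l n : ℂ) + w)).re < 0 := by simpa using by linarith [hpos n hn]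
    rw [integral_const_mul, integral_exp_mul_complex_Ioi h1]
    rw [Complex.ofReal_zero, mul_zero, Complex.exp_zero, neg_div_neg_eq, mul_one_div]
  have hintC : ∀ n ∈ F, IntegrableOn
      (fun t : ℝ => (b n : ℂ) * Complex.exp (-((l n : ℂ) + w) * t)) (Ioi 0) := by
    intro n hn
    have h1 : (-((l n : ℂ) + w)).re < 0 := by simpa using by linarith [hpos n hn]
    exact (integrableOn_exp_mul_complex_Ioi h1 0).const_mul _
  rw [← Finset.sum_congr rfl hterm, ← integral_finsetSum _ hintC]
  calc _ ≤ ∫ t in Ioi (0 : ℝ), |u t| * v t := by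
        refine (norm_integral_le_integral_norm _).trans (le_of_eq ?_)
        congr 1
        funext t
        have h2 : ∑ n ∈ F, (b n : ℂ) * Complex.exp (-((l n : ℂ) + w) * t)
            = (u t : ℂ) * Complex.exp (-w * t) := by
          rw [hu]; push_cast
          rw [Finset.sum_mul]
          refine Finset.sum_congr rfl fun n _ => ?_
          rw [mul_assoc, ← Complex.exp_add]; congr 2; ring
        rw [h2, norm_mul, Complex.norm_real, Complex.norm_exp, Real.norm_eq_abs]
        simp [hv]
    _ ≤ _ := integral_mul_le_Lp_mul_Lq_of_nonneg (p := 2) (q := 2) Real.HolderConjugate.two_two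
        (Filter.Eventually.of_forall fun t => abs_nonneg _)
        (Filter.Eventually.of_forall fun t => (Real.exp_pos _).le) huL hvL
    _ = _ := by
        have e1 : ∀ t, |u t| ^ (2 : ℝ) = u t ^ 2 := fun t => by
          rw [Real.rpow_two, sq_abs]
        have e2 : ∀ t, v t ^ (2 : ℝ) = Real.exp (-((2 * w.re) * t)) := fun t => by
          rw [Real.rpow_two, hv2]
        simp_rw [e1, e2]
        rw [hform, integral_exp_neg_mul_Ioi (by linarith), Real.sqrt_eq_rpow, Real.sqrt_eq_rpow]

variable [DecidableEq ι]

/-- The residue factor at `l n` of the Blaschke product with zeros `l m`, `m ∈ F`. -/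
noncomputable def blaschkeWeight (F : Finset ι) (l : ι → ℝ) (n : ι) : ℝ :=
  (∏ m ∈ F, (l m + l n)) / ∏ m ∈ F.erase n, (l m - l n)

/-- The coefficients of the partial fractions that remain when `∑ c n / (l n - w)` is multiplied
by the Blaschke product with zeros `l m`. -/
noncomputable def dualCoeff (F : Finset ι) (l c : ι → ℝ) (n : ι) : ℝ :=
  blaschkeWeight F l n * ∑ j ∈ F, c j / (l j + l n)

theorem prod_erase_sub_ne_zero (hinj : InjOn l F) {n : ι} (hn : n ∈ F) :
    ∏ m ∈ F.erase n, (l m - l n) ≠ 0 :=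
  Finset.prod_ne_zero_iff.2 fun _ hm => sub_ne_zero.2 fun h =>
    (Finset.mem_erase.1 hm).1 (hinj (Finset.mem_erase.1 hm).2 hn h)

theorem blaschkeWeight_ne_zero (hpos : ∀ n ∈ F, 0 < l n) (hinj : InjOn l F) {n : ι} (hn : n ∈ F) :
    blaschkeWeight F l n ≠ 0 :=
  div_ne_zero (Finset.prod_ne_zero_iff.2 fun m hm => (add_pos (hpos m hm) (hpos n hn)).ne')
    (prod_erase_sub_ne_zero hinj hn)

theorem sum_mul_prod_erase {K : Type*} [Field K] (c x : ι → K) (hx : ∀ m ∈ F, x m ≠ 0) :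
    ∑ n ∈ F, c n * ∏ m ∈ F.erase n, x m = (∏ m ∈ F, x m) * ∑ n ∈ F, c n / x n := by
  rw [Finset.mul_sum]
  refine Finset.sum_congr rfl fun n hn => ?_
  rw [← Finset.mul_prod_erase F x hn]
  field_simp [hx n hn]

open Polynomial in
/-- Both sides are polynomials in `w` of degree less than `#F`; they agree at the `-l n`. -/
theorem sum_mul_prod_sub_eq (hpos : ∀ n ∈ F, 0 < l n) (hinj : InjOn l F) (c : ι → ℝ) (w : ℂ) :
    ∑ n ∈ F, (c n : ℂ) * ∏ m ∈ F.erase n, ((l m : ℂ) - w)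
      = ∑ n ∈ F, (dualCoeff F l c n : ℂ) * ∏ m ∈ F.erase n, ((l m : ℂ) + w) := by
  set Q : ℂ[X] := ∑ n ∈ F, C (c n : ℂ) * ∏ m ∈ F.erase n, (C (l m : ℂ) - X) with hQ
  set R : ℂ[X] := ∑ n ∈ F, C (dualCoeff F l c n : ℂ) * ∏ m ∈ F.erase n, (C (l m : ℂ) + X) with hR
  rcases F.eq_empty_or_nonempty with rfl | hne
  · simp
  have hcard : 0 < F.card := hne.card_pos
  have hdeg : ∀ (a : ℂ) (n : ι) (f : ι → ℂ[X]), n ∈ F → (∀ m, (f m).natDegree ≤ 1) →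
      (C a * ∏ m ∈ F.erase n, f m).degree < F.card := by
    intro a n f hn hf
    have h1 : (C a * ∏ m ∈ F.erase n, f m).natDegree ≤ F.card - 1 := by
      refine (natDegree_C_mul_le _ _).trans ((natDegree_prod_le _ _).trans ?_)
      refine (Finset.sum_le_sum fun m _ => hf m).trans ?_
      simp [Finset.card_erase_of_mem hn]
    refine (degree_le_natDegree).trans_lt ?_
    exact_mod_cast lt_of_le_of_lt h1 (by omega)
  have hsum : ∀ G : ι → ℂ[X], (∀ n ∈ F, (G n).degree < F.card) →
      (∑ n ∈ F, G n).degree < F.card := by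
    intro G hG
    refine (degree_sum_le _ _).trans_lt ?_
    rw [Finset.sup_lt_iff (by simp)]
    exact hG
  have hQd : Q.degree < F.card := hsum _ fun n hn => hdeg _ _ _ hn fun m =>
    (natDegree_sub_le _ _).trans (by simp)
  have hRd : R.degree < F.card := hsum _ fun n hn => hdeg _ _ _ hn fun m =>
    (natDegree_add_le _ _).trans (by simp)
  have hv : InjOn (fun n => -(l n : ℂ)) F := by
    intro a ha b hb hab
    exact hinj ha hb (by simpa using hab)
  have hQR : Q = R := by
    refine eq_of_degrees_lt_of_eval_index_eq F hv hQd hRd fun n hn => ?_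
    have hQn : Q.eval (-(l n : ℂ)) = ((∏ m ∈ F, (l m + l n)) * ∑ j ∈ F, c j / (l j + l n) : ℝ) := by
      rw [← sum_mul_prod_erase c (fun m => l m + l n)
        (fun m hm => (add_pos (hpos m hm) (hpos n hn)).ne')]
      simp [hQ, eval_finsetSum, eval_prod]
    have hRn : R.eval (-(l n : ℂ)) = (dualCoeff F l c n * ∏ m ∈ F.erase n, (l m - l n) : ℝ) := by
      rw [hR, eval_finsetSum, Finset.sum_eq_single_of_mem n hn]
      · simp [eval_prod, sub_eq_add_neg]
      · intro j hj hjn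
        rw [eval_mul, eval_prod, Finset.prod_eq_zero (Finset.mem_erase.2 ⟨hjn.symm, hn⟩)]
        · simp
        · simp
    rw [hQn, hRn, dualCoeff, blaschkeWeight]
    congr 1
    field_simp [prod_erase_sub_ne_zero hinj hn]
  have := congrArg (eval w) hQR
  simpa [hQ, hR, eval_finsetSum, eval_prod] using this

/-- Passing to dual coefficients can be undone: the two partial fraction expansions are compared at
the poles `l n`. -/
theorem coeff_eq_blaschkeWeight_mul (hpos : ∀ n ∈ F, 0 < l n) (hinj : InjOn l F) (c : ι → ℝ)
    {n : ι} (hn : n ∈ F) :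
    c n = blaschkeWeight F l n * ∑ j ∈ F, dualCoeff F l c j / (l j + l n) := by
  have h1 := sum_mul_prod_sub_eq hpos hinj c (l n : ℂ)
  have h2 : ∑ j ∈ F, c j * ∏ m ∈ F.erase j, (l m - l n)
      = ∑ j ∈ F, dualCoeff F l c j * ∏ m ∈ F.erase j, (l m + l n) := by exact_mod_cast h1
  rw [sum_mul_prod_erase _ _ (fun m hm => (add_pos (hpos m hm) (hpos n hn)).ne'),
    Finset.sum_eq_single_of_mem n hn] at h2
  · have h3 := prod_erase_sub_ne_zero hinj hn
    rw [blaschkeWeight, div_mul_eq_mul_div, ← h2]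
    field_simp
  · intro j hj hjn
    rw [Finset.prod_eq_zero (Finset.mem_erase.2 ⟨hjn.symm, hn⟩) (sub_self _), mul_zero]

/-- Multiplication by the Blaschke product is isometric on the line `re w = 0`, so the dual
coefficients have the same norm. -/
theorem cauchyForm_dualCoeff (hpos : ∀ n ∈ F, 0 < l n) (hinj : InjOn l F) (c : ι → ℝ) :
    cauchyForm F l (dualCoeff F l c) = cauchyForm F l c := by
  have h1 : ∀ b : ι → ℝ, cauchyForm F l b = ∑ n ∈ F, b n * ∑ m ∈ F, b m / (l m + l n) := by
    intro b
    refine Finset.sum_congr rfl fun n _ => ?_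
    rw [Finset.mul_sum]
    refine Finset.sum_congr rfl fun m _ => ?_
    rw [add_comm (l m), mul_div_assoc]
  rw [h1, h1]
  refine Finset.sum_congr rfl fun n hn => ?_
  have h2 := blaschkeWeight_ne_zero hpos hinj hn
  have h3 : ∑ m ∈ F, dualCoeff F l c m / (l m + l n) = c n / blaschkeWeight F l n := by
    rw [eq_div_iff h2, mul_comm]
    exact (coeff_eq_blaschkeWeight_mul hpos hinj c hn).symm
  rw [h3, dualCoeff]
  field_simp

/-- The coefficients of a Müntz polynomial are bounded by its norm: the residue at `l n` is expressed
by the dual coefficients, to which the Cauchy-Schwarz inequality applies. -/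
theorem abs_coeff_le (hpos : ∀ n ∈ F, 0 < l n) (hinj : InjOn l F) (c : ι → ℝ) {n : ι}
    (hn : n ∈ F) : |c n| ≤ √(cauchyForm F l c) * √(2 * l n) *
      ∏ m ∈ F.erase n, ((l m + l n) / |l m - l n|) := by
  have hln := hpos n hn
  have h1 := norm_sum_div_add_le hpos (dualCoeff F l c) (w := (l n : ℂ)) (by simpa using hln)
  rw [cauchyForm_dualCoeff hpos hinj] at h1
  have h2 : ‖∑ j ∈ F, (dualCoeff F l c j : ℂ) / ((l j : ℂ) + (l n : ℂ))‖
      = |∑ j ∈ F, dualCoeff F l c j / (l j + l n)| := by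
    rw [← Real.norm_eq_abs, ← Complex.norm_real]; push_cast; rfl
  rw [h2, Complex.ofReal_re] at h1
  have h3 : |blaschkeWeight F l n| = 2 * l n * ∏ m ∈ F.erase n, ((l m + l n) / |l m - l n|) := by
    rw [blaschkeWeight, ← Finset.mul_prod_erase F _ hn, abs_div, abs_mul, Finset.abs_prod,
      Finset.abs_prod, Finset.prod_div_distrib, ← two_mul, abs_of_pos (by positivity : 0 < 2 * l n),
      mul_div_assoc]
    congr 2
    refine Finset.prod_congr rfl fun m hm => abs_of_pos ?_
    exact add_pos (hpos m (Finset.mem_of_mem_erase hm)) hln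
  have h4 : 0 ≤ ∏ m ∈ F.erase n, ((l m + l n) / |l m - l n|) :=
    Finset.prod_nonneg fun m hm => div_nonneg
      (add_pos (hpos m (Finset.mem_of_mem_erase hm)) hln).le (abs_nonneg _)
  calc |c n| = |blaschkeWeight F l n| * |∑ j ∈ F, dualCoeff F l c j / (l j + l n)| := by
        rw [← abs_mul, ← coeff_eq_blaschkeWeight_mul hpos hinj c hn]
    _ ≤ |blaschkeWeight F l n| * (√(cauchyForm F l c) * √(1 / (2 * l n))) := by gcongr
    _ = _ := by
        rw [h3]
        have h5 : 2 * l n * √(1 / (2 * l n)) = √(2 * l n) := by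
          rw [Real.sqrt_div zero_le_one, Real.sqrt_one, mul_one_div, Real.div_sqrt]
        rw [← h5]; ring

/-- The sum of partial fractions is bounded off the poles by the inverse of the Blaschke product. -/
theorem norm_sum_div_sub_le (hpos : ∀ n ∈ F, 0 < l n) (hinj : InjOn l F) (c : ι → ℝ) {w : ℂ}
    (hw : 0 < w.re) (hwl : ∀ n ∈ F, (l n : ℂ) - w ≠ 0) :
    ‖∑ n ∈ F, (c n : ℂ) / ((l n : ℂ) - w)‖ ≤ √(cauchyForm F l c) * √(1 / (2 * w.re)) *
      ∏ n ∈ F, (‖(l n : ℂ) + w‖ / ‖(l n : ℂ) - w‖) := by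
  have hwl' : ∀ n ∈ F, (l n : ℂ) + w ≠ 0 := fun n hn h => by
    have := congrArg Complex.re h
    simp at this
    linarith [hpos n hn]
  have h1 := sum_mul_prod_sub_eq hpos hinj c w
  rw [sum_mul_prod_erase _ _ hwl, sum_mul_prod_erase _ _ hwl'] at h1
  have h2 : ∑ n ∈ F, (c n : ℂ) / ((l n : ℂ) - w)
      = (∏ m ∈ F, ((l m : ℂ) + w)) / (∏ m ∈ F, ((l m : ℂ) - w))
        * ∑ n ∈ F, (dualCoeff F l c n : ℂ) / ((l n : ℂ) + w) := by
    rw [div_mul_eq_mul_div, ← h1]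
    field_simp [Finset.prod_ne_zero_iff.2 hwl]
  have h3 := norm_sum_div_add_le hpos (dualCoeff F l c) hw
  rw [cauchyForm_dualCoeff hpos hinj] at h3
  rw [h2, norm_mul, norm_div, norm_prod, norm_prod, ← Finset.prod_div_distrib, mul_comm]
  gcongr

end Cauchy

/-! ### A Laplace integral along a wedge -/

section Wedge

open Complex

theorem norm_one_add_I_le : ‖(1 + Complex.I : ℂ)‖ ≤ 3 / 2 := by
  rw [← sq_le_sq₀ (norm_nonneg _) (by norm_num), ← normSq_eq_norm_sq]
  simp [normSq_apply]; norm_num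

theorem le_norm_sub_one_add_I_mul {a u : ℝ} (ha : 0 ≤ a) :
    a / 2 ≤ ‖(a : ℂ) - (1 + Complex.I) * u‖ := by
  rw [← sq_le_sq₀ (by positivity) (norm_nonneg _), ← normSq_eq_norm_sq]
  simp [normSq_apply]
  nlinarith [sq_nonneg (a - 2 * u)]

theorem sub_one_add_I_mul_ne_zero {a u : ℝ} (ha : 0 < a) : (a : ℂ) - (1 + Complex.I) * u ≠ 0 :=
  norm_pos_iff.1 (lt_of_lt_of_le (by positivity) (le_norm_sub_one_add_I_mul ha.le))

theorem one_add_le_norm_sub_one_add_I_mul {u : ℝ} (hu : 0 ≤ u) :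
    (1 + u) / 4 ≤ ‖(1 : ℂ) - (1 + Complex.I) * u‖ := by
  rw [← sq_le_sq₀ (by positivity) (norm_nonneg _), ← normSq_eq_norm_sq]
  simp [normSq_apply]
  nlinarith [sq_nonneg (u - 1 / 2)]

theorem norm_exp_wedge (s u : ℝ) : ‖exp (-(s * (1 + Complex.I)) * u)‖ = Real.exp (-(s * u)) := by
  rw [norm_exp]; simp

/-- The function `exp (-s * z) / (a - z)`, multiplied by `dz / du`, on the ray `z = (1 + i) u`. -/
noncomputable def wedgeKernel (a s u : ℝ) : ℂ :=
  (1 + Complex.I) * exp (-(s * (1 + Complex.I)) * u) / (a - (1 + Complex.I) * u)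

theorem continuous_wedgeKernel {a : ℝ} (ha : 0 < a) (s : ℝ) : Continuous (wedgeKernel a s) := by
  unfold wedgeKernel
  exact Continuous.div (by fun_prop) (by fun_prop) fun u => sub_one_add_I_mul_ne_zero ha

theorem norm_wedgeKernel_le {a : ℝ} (ha : 0 < a) (s u : ℝ) :
    ‖wedgeKernel a s u‖ ≤ 3 / a * Real.exp (-(s * u)) := by
  rw [wedgeKernel, norm_div, norm_mul, norm_exp_wedge]
  calc _ ≤ 3 / 2 * Real.exp (-(s * u)) / (a / 2) := by
        gcongr
        exacts [norm_one_add_I_le, le_norm_sub_one_add_I_mul ha.le]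
    _ = _ := by field_simp

theorem integrableOn_wedgeKernel {a s : ℝ} (ha : 0 < a) (hs : 0 < s) :
    IntegrableOn (wedgeKernel a s) (Ioi 0) :=
  Integrable.mono' ((integrableOn_exp_neg_mul_Ioi hs).const_mul (3 / a))
    (continuous_wedgeKernel ha s).aestronglyMeasurable
    (Filter.Eventually.of_forall fun u => norm_wedgeKernel_le ha s u)

theorem integral_ray {s : ℝ} (hs : 0 < s) :
    ∫ u in Ioi (0 : ℝ), (1 + Complex.I) * exp (-(s * (1 + Complex.I)) * u) = ((1 / s : ℝ) : ℂ) := by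
  have h1 : (-((s : ℂ) * (1 + Complex.I))).re < 0 := by simpa using hs
  have h2 : (1 + Complex.I : ℂ) ≠ 0 := fun h => by simpa using congrArg re h
  rw [integral_const_mul, integral_exp_mul_complex_Ioi h1, ofReal_zero, mul_zero, exp_zero,
    neg_div_neg_eq]
  have : (s : ℂ) ≠ 0 := by exact_mod_cast hs.ne'
  push_cast
  field_simp

/-- The imaginary part of the integral of `wedgeKernel 1 s`. Up to the factor `2 i`, it is the integral
of `exp (-s * z) / (1 - z)` along the ray minus that along the conjugate ray. -/
noncomputable def wedgeLaplace (s : ℝ) : ℝ := ∫ u in Ioi (0 : ℝ), (wedgeKernel 1 s u).im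

/-- Differentiation of `exp (s * (1 - z)) / (1 - z)` in `s` removes the denominator. What remains is an
integral along the ray with a real value, so its imaginary part vanishes. -/
theorem hasDerivAt_exp_mul_wedgeLaplace {s : ℝ} (hs : 0 < s) :
    HasDerivAt (fun s => Real.exp s * wedgeLaplace s) 0 s := by
  set f : ℝ → ℝ → ℂ := fun s u => Real.exp s * wedgeKernel 1 s u with hf
  set f' : ℝ → ℝ → ℂ := fun s u =>
    Real.exp s * ((1 + Complex.I) * exp (-(s * (1 + Complex.I)) * u)) with hf'
  have hder : ∀ u s : ℝ, HasDerivAt (fun s => f s u) (f' s u) s := by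
    intro u s
    have h0 : (1 : ℂ) - (1 + Complex.I) * u ≠ 0 := by
      simpa using sub_one_add_I_mul_ne_zero (u := u) one_pos
    have h1 : HasDerivAt (fun z : ℂ =>
          (1 + Complex.I) * exp (z * (1 - (1 + Complex.I) * u)) / (1 - (1 + Complex.I) * u))
        ((1 + Complex.I) * (exp (s * (1 - (1 + Complex.I) * u)) * (1 * (1 - (1 + Complex.I) * u)))
          / (1 - (1 + Complex.I) * u))
        (s : ℂ) :=
      ((((hasDerivAt_id (s : ℂ)).mul_const _).cexp).const_mul _).div_const _
    have h2 := h1.comp_ofReal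
    have e : ∀ t : ℝ, exp ((t : ℂ) * (1 - (1 + Complex.I) * u))
        = Real.exp t * exp (-(t * (1 + Complex.I)) * u) := by
      intro t; rw [ofReal_exp, ← exp_add]; congr 1; ring
    convert h2 using 1
    · funext t; rw [hf, e]; simp only [wedgeKernel, ofReal_one]; ring
    · rw [hf', e]; field_simp
  have hint : ∀ s, 0 < s → IntegrableOn (f s) (Ioi 0) := fun s hs =>
    (integrableOn_wedgeKernel one_pos hs).const_mul _
  have hmain := (hasDerivAt_integral_of_dominated_loc_of_deriv_le
    (μ := volume.restrict (Ioi (0 : ℝ))) (F := f) (F' := f') (x₀ := s)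
    (s := Ioo (s / 2) (2 * s))
    (bound := fun u => Real.exp (2 * s) * (3 / 2 * Real.exp (-(s / 2 * u))))
    (Ioo_mem_nhds (by linarith) (by linarith))
    (Filter.Eventually.of_forall fun t =>
      (continuous_const.mul (continuous_wedgeKernel one_pos t)).aestronglyMeasurable)
    (hint s hs) (by
      refine Continuous.aestronglyMeasurable ?_
      fun_prop)
    (by
      filter_upwards [ae_restrict_mem measurableSet_Ioi] with u hu t ht
      rw [hf', norm_mul, norm_mul, norm_exp_wedge, norm_real, Real.norm_eq_abs, Real.abs_exp]
      have hu' : (0 : ℝ) < u := hu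
      gcongr
      exacts [ht.2.le, norm_one_add_I_le, ht.1.le])
    (((integrableOn_exp_neg_mul_Ioi (by linarith)).const_mul _).const_mul _)
    (Filter.Eventually.of_forall fun u t _ => hder u t)).2
  have h0 : ∫ u in Ioi (0 : ℝ), f' s u = ((Real.exp s * (1 / s) : ℝ) : ℂ) := by
    rw [hf', integral_const_mul, integral_ray hs]; push_cast; rfl
  rw [h0] at hmain
  have him := (imCLM.hasFDerivAt.comp_hasDerivAt s hmain)
  have heq : (fun s => Real.exp s * wedgeLaplace s) =ᶠ[nhds s]
      (imCLM ∘ fun t => ∫ u in Ioi (0 : ℝ), f t u) := by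
    filter_upwards [lt_mem_nhds hs] with t ht
    have := imCLM.integral_comp_comm (hint t ht)
    simp only [Function.comp]
    rw [← this, wedgeLaplace, ← integral_const_mul]
    congr 1; funext u
    simp [hf, -ofReal_exp]
  simpa [-ofReal_exp] using him.congr_of_eventuallyEq heq

/-- The constant that occurs in the inversion formula (its value is `π`). -/
noncomputable def wedgeConst : ℝ := Real.exp 1 * wedgeLaplace 1

theorem wedgeLaplace_eq {s : ℝ} (hs : 0 < s) :
    wedgeLaplace s = wedgeConst * Real.exp (-s) := by
  have h := isOpen_Ioi.is_const_of_deriv_eq_zero (isPreconnected_Ioi (a := (0 : ℝ)))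
    (f := fun s => Real.exp s * wedgeLaplace s)
    (fun t ht => (hasDerivAt_exp_mul_wedgeLaplace ht).differentiableAt.differentiableWithinAt)
    (fun t ht => (hasDerivAt_exp_mul_wedgeLaplace ht).deriv) hs (y := 1) (by simp)
  rw [wedgeConst, ← h, mul_right_comm, ← Real.exp_add]; simp

/-- Integration against `exp (-s)` turns the kernel into a rational function with positive
imaginary part on the ray. -/
theorem wedgeConst_pos : 0 < wedgeConst := by
  set f : ℝ → ℝ → ℂ := fun s u => (Real.exp (-(1 * s)) : ℂ) * wedgeKernel 1 s u with hf
  set g : ℝ → ℝ := fun u => (1 + 2 * u ^ 2) / (1 + 4 * u ^ 4) with hg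
  have hfu : ∀ u s : ℝ, f s u = exp (-(1 + (1 + Complex.I) * u) * s) *
      ((1 + Complex.I) / (1 - (1 + Complex.I) * u)) := by
    intro u s
    have : exp (-(1 + (1 + Complex.I) * u) * s)
        = (Real.exp (-(1 * s)) : ℂ) * exp (-(s * (1 + Complex.I)) * u) := by
      rw [ofReal_exp, ← exp_add]; congr 1; push_cast; ring
    rw [this]; simp only [hf, wedgeKernel]; push_cast; ring
  have hre : ∀ u : ℝ, 0 ≤ u → (-(1 + (1 + Complex.I) * (u : ℂ))).re < 0 := by
    intro u hu; simp; linarith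
  have hnorm : ∀ s u : ℝ, ‖f s u‖ = ‖(1 + Complex.I : ℂ) / (1 - (1 + Complex.I) * u)‖ *
      Real.exp (-((1 + u) * s)) := by
    intro s u
    rw [hfu, norm_mul, norm_exp, mul_comm]
    congr 2; simp; ring
  have hcont : Continuous (Function.uncurry fun u s => f s u) := by
    have h0 : ∀ u : ℝ, (1 : ℂ) - (1 + Complex.I) * u ≠ 0 := fun u => by
      simpa using sub_one_add_I_mul_ne_zero (u := u) one_pos
    have : (Function.uncurry fun u s => f s u) = fun p : ℝ × ℝ =>
        exp (-(1 + (1 + Complex.I) * (p.1 : ℂ)) * (p.2 : ℂ)) *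
          ((1 + Complex.I) / (1 - (1 + Complex.I) * (p.1 : ℂ))) := by
      funext p; exact hfu p.1 p.2
    rw [this]
    refine Continuous.mul (by fun_prop) (Continuous.div (by fun_prop) (by fun_prop) fun p => h0 p.1)
  have hprod : Integrable (Function.uncurry fun u s => f s u)
      ((volume.restrict (Ioi (0 : ℝ))).prod (volume.restrict (Ioi (0 : ℝ)))) := by
    rw [integrable_prod_iff hcont.aestronglyMeasurable]
    constructor
    · filter_upwards [ae_restrict_mem measurableSet_Ioi] with u hu
      simp only [Function.uncurry, hfu]
      exact (integrableOn_exp_mul_complex_Ioi (hre u (le_of_lt hu)) 0).mul_const _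
    · have h1 : ∀ u ∈ Ioi (0 : ℝ), ∫ s in Ioi (0 : ℝ), ‖f s u‖
          = ‖(1 + Complex.I : ℂ) / (1 - (1 + Complex.I) * u)‖ * (1 / (1 + u)) := by
        intro u hu
        have hu' : (0 : ℝ) < u := hu
        simp_rw [hnorm]
        rw [integral_const_mul, integral_exp_neg_mul_Ioi (by linarith)]
      refine Integrable.mono' (integrable_inv_one_add_sq.integrableOn.const_mul 6)
        hcont.norm.aestronglyMeasurable.integral_prod_right' ?_
      filter_upwards [ae_restrict_mem measurableSet_Ioi] with u hu
      have hu' : (0 : ℝ) < u := hu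
      simp only [Function.uncurry]
      rw [h1 u hu, norm_div, Real.norm_of_nonneg (by positivity)]
      have h2 := one_add_le_norm_sub_one_add_I_mul hu'.le
      calc _ ≤ (3 / 2) / ((1 + u) / 4) * (1 / (1 + u)) := by
            gcongr; exact norm_one_add_I_le
        _ = 6 * ((1 + u) ^ 2)⁻¹ := by field_simp; norm_num
        _ ≤ 6 * (1 + u ^ 2)⁻¹ := by gcongr; nlinarith
  have hinner : ∀ u ∈ Ioi (0 : ℝ), (∫ s in Ioi (0 : ℝ), f s u).im = g u := by
    intro u hu
    have hu' : (0 : ℝ) < u := hu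
    simp_rw [hfu]
    rw [integral_mul_const, integral_exp_mul_complex_Ioi (hre u hu'.le), ofReal_zero, mul_zero,
      exp_zero, neg_div_neg_eq]
    have h0 : (1 : ℂ) - (1 + Complex.I) * u ≠ 0 := by
      simpa using sub_one_add_I_mul_ne_zero (u := u) one_pos
    have h0' : (1 : ℂ) + (1 + Complex.I) * u ≠ 0 := fun h => by
      have := hre u hu'.le; rw [h] at this; simp at this
    have h3 : ((1 + 4 * u ^ 4 : ℝ) : ℂ) ≠ 0 := by
      exact_mod_cast (by positivity : (0 : ℝ) < 1 + 4 * u ^ 4).ne'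
    have h4 : 1 / (1 + (1 + Complex.I) * (u : ℂ)) * ((1 + Complex.I) / (1 - (1 + Complex.I) * u))
        = ((1 - 2 * u ^ 2) / (1 + 4 * u ^ 4) : ℝ) + (g u : ℝ) * Complex.I := by
      rw [div_mul_div_comm, one_mul, hg]
      push_cast at h3 ⊢
      rw [div_mul_eq_mul_div, ← add_div, div_eq_div_iff (mul_ne_zero h0' h0) h3]
      linear_combination ((1 - 2 * (u : ℂ) ^ 2 + (1 + 2 * (u : ℂ) ^ 2) * Complex.I) * u ^ 2
        + 2 * (1 + 2 * (u : ℂ) ^ 2) * u ^ 2) * I_sq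
    rw [h4]
    simp only [add_im, ofReal_im, mul_im, I_im, I_re, ofReal_re]
    ring
  have hLHS : ∫ s in Ioi (0 : ℝ), ∫ u in Ioi (0 : ℝ), (f s u).im = wedgeConst / 2 := by
    have : ∀ s ∈ Ioi (0 : ℝ), ∫ u in Ioi (0 : ℝ), (f s u).im
        = wedgeConst * Real.exp (-(2 * s)) := by
      intro s hs
      have h1 : ∀ u, (f s u).im = Real.exp (-(1 * s)) * (wedgeKernel 1 s u).im := by
        intro u; simp [hf, -ofReal_exp]
      simp_rw [h1]
      rw [integral_const_mul]
      change _ * wedgeLaplace s = _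
      rw [wedgeLaplace_eq hs, mul_left_comm, ← Real.exp_add]; congr 2; ring
    rw [setIntegral_congr_fun measurableSet_Ioi this, integral_const_mul,
      integral_exp_neg_mul_Ioi two_pos]; ring
  have hswap : ∫ u in Ioi (0 : ℝ), ∫ s in Ioi (0 : ℝ), (f s u).im
      = ∫ s in Ioi (0 : ℝ), ∫ u in Ioi (0 : ℝ), (f s u).im :=
    integral_integral_swap (f := fun u s => (f s u).im) hprod.im
  have hR : ∫ u in Ioi (0 : ℝ), ∫ s in Ioi (0 : ℝ), (f s u).im = ∫ u in Ioi (0 : ℝ), g u := by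
    refine setIntegral_congr_fun measurableSet_Ioi fun u hu => ?_
    have hi : IntegrableOn (fun s => f s u) (Ioi 0) := by
      simp only [hfu]
      exact (integrableOn_exp_mul_complex_Ioi (hre u (le_of_lt hu)) 0).mul_const _
    rw [← hinner u hu]
    exact imCLM.integral_comp_comm hi
  have hgpos : 0 < ∫ u in Ioi (0 : ℝ), g u := by
    have hgi : IntegrableOn g (Ioi 0) := by
      refine Integrable.mono' (integrable_inv_one_add_sq.integrableOn.const_mul 2)
        (Continuous.aestronglyMeasurable (Continuous.div (by fun_prop) (by fun_prop)
          fun u => by positivity)) (Filter.Eventually.of_forall fun u => ?_)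
      rw [Real.norm_of_nonneg (by positivity), hg]
      simp only
      rw [← div_eq_mul_inv, div_le_div_iff₀ (by positivity) (by positivity)]
      nlinarith [sq_nonneg u, sq_nonneg (u ^ 2), sq_nonneg (2 * u ^ 2 - 1)]
    rw [setIntegral_pos_iff_support_of_nonneg_ae
      (Filter.Eventually.of_forall fun u => by simp only [hg]; positivity) hgi]
    have : Function.support g ∩ Ioi 0 = Ioi 0 := by
      refine inter_eq_right.2 fun u _ => ?_
      have : 0 < g u := by simp only [hg]; positivity
      exact this.ne'
    rw [this]; simp
  rw [← hR, hswap, hLHS] at hgpos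
  linarith

/-- The values of `exp (-a * y)` are represented by the integral of `exp (-y * z) / (a - z)` along the
boundary of a sector around the pole `a`. -/
theorem integral_wedgeKernel_im {a y : ℝ} (ha : 0 < a) (hy : 0 < y) :
    ∫ u in Ioi (0 : ℝ), (wedgeKernel a y u).im = wedgeConst * Real.exp (-(a * y)) := by
  rw [← wedgeLaplace_eq (mul_pos ha hy), wedgeLaplace]
  have h := integral_comp_mul_left_Ioi (fun u => (wedgeKernel a y u).im) 0 ha
  rw [mul_zero] at h
  have h2 : ∀ u, (wedgeKernel 1 (a * y) u).im = a * (wedgeKernel a y (a * u)).im := by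
    intro u
    have ha' : (a : ℂ) ≠ 0 := by exact_mod_cast ha.ne'
    have h0 : (1 : ℂ) - (1 + Complex.I) * u ≠ 0 := by
      simpa using sub_one_add_I_mul_ne_zero (u := u) one_pos
    have h0' : (a : ℂ) - (1 + Complex.I) * (a * u) ≠ 0 := by
      have := sub_one_add_I_mul_ne_zero (u := a * u) ha
      simpa using this
    have : wedgeKernel 1 (a * y) u = (a : ℂ) * wedgeKernel a y (a * u) := by
      rw [wedgeKernel, wedgeKernel]
      push_cast
      rw [show -((a : ℂ) * y * (1 + Complex.I)) * u = -(y * (1 + Complex.I)) * (a * u) by ring,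
        show (a : ℂ) - (1 + Complex.I) * (a * u) = a * (1 - (1 + Complex.I) * u) by ring]
      field_simp
    rw [this, im_ofReal_mul]
  simp_rw [h2]
  rw [integral_const_mul, h, smul_eq_mul]
  field_simp

end Wedge

/-! ### Products over exponents with summable inverses -/

section Products

variable {ι : Type*}

/-- The canonical product of a sequence with summable inverses has exponential type zero. For the
finitely many large `a n`, use `1 + t ≤ exp (s * t) / s` with small `s`. -/
theorem exists_prod_one_add_mul_le {a : ι → ℝ} (ha0 : ∀ n, 0 ≤ a n) (ha : Summable a) {η : ℝ}
    (hη : 0 < η) : ∃ A, 0 < A ∧ ∀ (F : Finset ι) (v : ℝ), 0 ≤ v →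
      ∏ n ∈ F, (1 + a n * v) ≤ A * Real.exp (η * v) := by
  classical
  obtain ⟨G, hG⟩ := summable_iff_vanishing_norm.1 ha (η / 2) (by positivity)
  set S := ∑ n ∈ G, a n with hS
  have hS0 : 0 ≤ S := Finset.sum_nonneg fun n _ => ha0 n
  set s : ℝ := min 1 (η / (2 * (S + 1))) with hs
  have hs0 : 0 < s := lt_min one_pos (by positivity)
  have hs1 : s ≤ 1 := min_le_left _ _
  have hsS : s * S ≤ η / 2 := by
    calc s * S ≤ η / (2 * (S + 1)) * (S + 1) := by
          gcongr
          · exact min_le_right _ _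
          · linarith
      _ = η / 2 := by field_simp
  refine ⟨(1 / s) ^ G.card, by positivity, fun F v hv => ?_⟩
  have h1 : ∏ n ∈ F, (1 + a n * v) ≤ ∏ n ∈ F ∪ G, (1 + a n * v) :=
    Finset.prod_le_prod_of_subset_of_one_le Finset.subset_union_left
      (fun n _ => by have := mul_nonneg (ha0 n) hv; linarith)
      fun n _ _ => by have := mul_nonneg (ha0 n) hv; linarith
  refine h1.trans ?_
  rw [← Finset.sdiff_union_self_eq_union, Finset.prod_union Finset.sdiff_disjoint]
  have h2 : ∏ n ∈ F \ G, (1 + a n * v) ≤ Real.exp (η / 2 * v) := by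
    calc _ ≤ ∏ n ∈ F \ G, Real.exp (a n * v) := by
          refine Finset.prod_le_prod (fun n _ => ?_) fun n _ => ?_
          · have := mul_nonneg (ha0 n) hv; linarith
          · have := Real.add_one_le_exp (a n * v); linarith
      _ = Real.exp ((∑ n ∈ F \ G, a n) * v) := by rw [← Real.exp_sum, Finset.sum_mul]
      _ ≤ _ := by
          gcongr
          have := hG (F \ G) Finset.sdiff_disjoint
          exact (le_abs_self _).trans this.le
  have h3 : ∏ n ∈ G, (1 + a n * v) ≤ (1 / s) ^ G.card * Real.exp (η / 2 * v) := by
    calc _ ≤ ∏ n ∈ G, (1 / s * Real.exp (s * (a n * v))) := by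
          refine Finset.prod_le_prod (fun n _ => ?_) fun n _ => ?_
          · have := mul_nonneg (ha0 n) hv; linarith
          · have h4 := Real.add_one_le_exp (s * (a n * v))
            rw [one_div_mul_eq_div, le_div_iff₀ hs0]
            nlinarith
      _ = (1 / s) ^ G.card * Real.exp (s * S * v) := by
          rw [Finset.prod_mul_distrib, Finset.prod_const, ← Real.exp_sum, hS, mul_assoc,
            Finset.sum_mul, Finset.mul_sum]
      _ ≤ _ := by gcongr
  calc _ ≤ Real.exp (η / 2 * v) * ((1 / s) ^ G.card * Real.exp (η / 2 * v)) := by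
        gcongr
        exact Finset.prod_nonneg fun n _ => by have := mul_nonneg (ha0 n) hv; linarith
    _ = _ := by
        rw [mul_left_comm, ← Real.exp_add]; congr 2; ring

/-- Pointwise bounds for Müntz polynomials: at `x = exp (-y)`, the value is represented by an
integral along a wedge, where the Blaschke product has exponential type zero. -/
theorem exists_abs_sum_exp_le {lam : ι → ℝ} (hpos : ∀ n, 0 < lam n)
    (hinj : Function.Injective lam) (hsum : Summable fun n => 1 / lam n) {y₀ : ℝ} (hy₀ : 0 < y₀) :
    ∃ C, 0 ≤ C ∧ ∀ (F : Finset ι) (c : ι → ℝ) (y : ℝ), y₀ ≤ y →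
      |∑ n ∈ F, c n * Real.exp (-(lam n * y))|
        ≤ C * √(cauchyForm F (fun n => lam n + 1 / 2) c) := by
  classical
  -- On the ray, the factors of the inverse Blaschke product are at most `1 + 6 (1 + u) / lam n`.
  obtain ⟨A, hA, hprod⟩ := exists_prod_one_add_mul_le (a := fun n => 6 * (1 / lam n))
    (fun n => by have := hpos n; positivity) (hsum.mul_left 6) (η := y₀ / 2) (by positivity)
  set B := A * Real.exp (y₀ / 2) with hB
  have hκ := wedgeConst_pos
  refine ⟨wedgeConst⁻¹ * (3 / 2 * B * (2 / y₀)), by positivity, fun F c y hy => ?_⟩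
  set E := √(cauchyForm F (fun n => lam n + 1 / 2) c) with hE
  have hy0 : 0 < y := hy₀.trans_le hy
  have h1 : wedgeConst * ∑ n ∈ F, c n * Real.exp (-(lam n * y))
      = ∫ u in Ioi (0 : ℝ), (∑ n ∈ F, (c n : ℂ) * wedgeKernel (lam n) y u).im := by
    have h2 : ∀ u, (∑ n ∈ F, (c n : ℂ) * wedgeKernel (lam n) y u).im
        = ∑ n ∈ F, c n * (wedgeKernel (lam n) y u).im := by
      intro u; simp
    simp_rw [h2]
    have h3 : ∀ n ∈ F, IntegrableOn (fun u => c n * (wedgeKernel (lam n) y u).im) (Ioi 0) :=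
      fun n _ => (integrableOn_wedgeKernel (hpos n) hy0).im.const_mul (c n)
    rw [integral_finsetSum _ h3, Finset.mul_sum]
    refine Finset.sum_congr rfl fun n _ => ?_
    rw [integral_const_mul, integral_wedgeKernel_im (hpos n) hy0]; ring
  have hbound : ∀ u ∈ Ioi (0 : ℝ), ‖(∑ n ∈ F, (c n : ℂ) * wedgeKernel (lam n) y u).im‖
      ≤ 3 / 2 * B * E * Real.exp (-(y₀ / 2 * u)) := by
    intro u hu
    have hu' : (0 : ℝ) < u := hu
    -- The ray starts at `1 / 2` because the exponents are shifted by `1 / 2`.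
    set w : ℂ := 1 / 2 + (1 + Complex.I) * u with hw
    have hwre : w.re = 1 / 2 + u := by simp [hw]
    have e1 : ∀ n, ((lam n + 1 / 2 : ℝ) : ℂ) - w = (lam n : ℂ) - (1 + Complex.I) * u := by
      intro n; rw [hw]; push_cast; ring
    have h3 := norm_sum_div_sub_le (F := F) (l := fun n => lam n + 1 / 2)
      (fun n _ => by have := hpos n; positivity)
      (fun a _ b _ hab => hinj (by simpa using hab)) c (w := w)
      (by rw [hwre]; positivity)
      (fun n _ => by rw [e1]; exact sub_one_add_I_mul_ne_zero (hpos n))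
    have h4 : ∏ n ∈ F, (‖((lam n + 1 / 2 : ℝ) : ℂ) + w‖ / ‖((lam n + 1 / 2 : ℝ) : ℂ) - w‖)
        ≤ B * Real.exp (y₀ / 2 * u) := by
      calc _ ≤ ∏ n ∈ F, (1 + 6 * (1 / lam n) * (1 + u)) := by
            refine Finset.prod_le_prod (fun n _ => by positivity) fun n _ => ?_
            have h5 := le_norm_sub_one_add_I_mul (u := u) (hpos n).le
            have h6 : 0 < ‖((lam n + 1 / 2 : ℝ) : ℂ) - w‖ := by
              rw [e1]; exact norm_pos_iff.2 (sub_one_add_I_mul_ne_zero (hpos n))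
            have h7 : ‖((lam n + 1 / 2 : ℝ) : ℂ) + w‖
                ≤ ‖((lam n + 1 / 2 : ℝ) : ℂ) - w‖ + (1 + 3 * u) := by
              have e2 : ((lam n + 1 / 2 : ℝ) : ℂ) + w = (((lam n + 1 / 2 : ℝ) : ℂ) - w)
                  + (1 + 2 * ((1 + Complex.I) * u)) := by rw [hw]; ring
              rw [e2]
              refine (norm_add_le _ _).trans ?_
              gcongr
              refine (norm_add_le _ _).trans ?_
              rw [norm_one, norm_mul, norm_mul, Complex.norm_real, Real.norm_of_nonneg hu'.le]
              have := norm_one_add_I_le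
              norm_num
              nlinarith
            rw [div_le_iff₀ h6]
            rw [← e1] at h5
            have hl := hpos n
            have h8 : 1 + 3 * u ≤ 6 * (1 / lam n) * (1 + u) * (lam n / 2) := by
              field_simp; linarith
            have h9 : 6 * (1 / lam n) * (1 + u) * (lam n / 2)
                ≤ 6 * (1 / lam n) * (1 + u) * ‖((lam n + 1 / 2 : ℝ) : ℂ) - w‖ := by gcongr
            linarith
        _ ≤ A * Real.exp (y₀ / 2 * (1 + u)) := hprod F (1 + u) (by positivity)
        _ = _ := by rw [hB, mul_assoc, ← Real.exp_add]; congr 2; ring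
    have h5 : ∑ n ∈ F, (c n : ℂ) * wedgeKernel (lam n) y u
        = (1 + Complex.I) * Complex.exp (-(y * (1 + Complex.I)) * u)
          * ∑ n ∈ F, (c n : ℂ) / (((lam n + 1 / 2 : ℝ) : ℂ) - w) := by
      rw [Finset.mul_sum]
      refine Finset.sum_congr rfl fun n _ => ?_
      rw [e1, wedgeKernel]; ring
    have h6 : √(1 / (2 * w.re)) ≤ 1 := by
      rw [hwre, Real.sqrt_le_one, div_le_one (by positivity)]; linarith
    calc _ ≤ ‖∑ n ∈ F, (c n : ℂ) * wedgeKernel (lam n) y u‖ := Complex.abs_im_le_norm _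
      _ ≤ 3 / 2 * Real.exp (-(y₀ * u)) * (E * 1 * (B * Real.exp (y₀ / 2 * u))) := by
          rw [h5, norm_mul, norm_mul, norm_exp_wedge]
          gcongr
          · exact norm_one_add_I_le
          · refine h3.trans ?_
            gcongr
      _ = _ := by
          rw [show -(y₀ / 2 * u) = -(y₀ * u) + y₀ / 2 * u by ring, Real.exp_add]; ring
  have h2 : |wedgeConst * ∑ n ∈ F, c n * Real.exp (-(lam n * y))|
      ≤ 3 / 2 * B * E * (1 / (y₀ / 2)) := by
    rw [h1, ← Real.norm_eq_abs, ← integral_exp_neg_mul_Ioi (a := y₀ / 2) (by positivity),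
      ← integral_const_mul]
    refine norm_integral_le_of_norm_le
      ((integrableOn_exp_neg_mul_Ioi (by positivity)).const_mul _) ?_
    filter_upwards [ae_restrict_mem measurableSet_Ioi] with u hu using hbound u hu
  rw [abs_mul, abs_of_pos hκ, ← le_div_iff₀' hκ] at h2
  refine h2.trans (le_of_eq ?_)
  field_simp

theorem tendsto_atTop_of_summable_one_div {lam : ι → ℝ} (hpos : ∀ n, 0 < lam n)
    (hsum : Summable fun n => 1 / lam n) : Filter.Tendsto lam Filter.cofinite Filter.atTop := by
  have h1 := hsum.tendsto_cofinite_zero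
  have h2 : Filter.Tendsto (fun n => 1 / lam n) Filter.cofinite (nhdsWithin 0 (Ioi 0)) :=
    tendsto_nhdsWithin_iff.2 ⟨h1, Filter.Eventually.of_forall fun n => by
      have := hpos n; simpa using this⟩
  have h3 := h2.inv_tendsto_nhdsGT_zero
  refine h3.congr fun n => ?_
  simp

theorem add_div_abs_sub_le {a b : ℝ} (hab : a ≠ b) :
    (a + b) / |a - b| ≤ 1 + 2 * b / |a - b| := by
  have h : 0 < |a - b| := abs_pos.2 (sub_ne_zero.2 hab)
  rw [div_le_iff₀ h, add_mul, div_mul_cancel₀ _ h.ne']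
  have := le_abs_self (a - b)
  linarith

/-- The coefficient bounds of `abs_coeff_le` are uniform in the finite set of exponents. -/
theorem exists_prod_erase_le [DecidableEq ι] {l : ι → ℝ} (hpos : ∀ n, 0 < l n)
    (hinj : Function.Injective l) (hsum : Summable fun n => 1 / l n) (n : ι) :
    ∃ C, 0 < C ∧ ∀ F : Finset ι, ∏ m ∈ F.erase n, ((l m + l n) / |l m - l n|) ≤ C := by
  have hln := hpos n
  have hsum' : Summable fun m => 2 * l n / |l m - l n| := by
    refine Summable.of_norm_bounded_eventually (hsum.mul_left (4 * l n)) ?_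
    filter_upwards [(tendsto_atTop_of_summable_one_div hpos hsum).eventually_ge_atTop (2 * l n)]
      with m hm
    rw [Real.norm_of_nonneg (by positivity), abs_of_pos (by linarith), mul_one_div,
      div_le_div_iff₀ (by linarith) (hpos m)]
    nlinarith
  obtain ⟨A, hA, h⟩ := exists_prod_one_add_mul_le (fun m => by positivity) hsum' one_pos
  refine ⟨A * Real.exp (1 * 1), by positivity, fun F => le_trans ?_ (h (F.erase n) 1 zero_le_one)⟩
  refine Finset.prod_le_prod (fun m _ => by have := hpos m; positivity) fun m hm => ?_
  rw [mul_one]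
  exact add_div_abs_sub_le fun h => (Finset.mem_erase.1 hm).1 (hinj h)

/-- Monotone sequences with summable inverses grow faster than linearly, with an explicit error
term. -/
theorem exists_nat_le_mul_add {l : ℕ → ℝ} (hpos : ∀ n, 0 < l n) (hmono : Monotone l)
    (hsum : Summable fun n => 1 / l n) {η : ℝ} (hη : 0 < η) :
    ∃ K : ℝ, 0 ≤ K ∧ ∀ n : ℕ, (n : ℝ) ≤ η * l n + K := by
  obtain ⟨G, hG⟩ := summable_iff_vanishing_norm.1 hsum η hη
  obtain ⟨N, hN⟩ := G.bddAbove
  refine ⟨N + 1, by positivity, fun n => ?_⟩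
  have hln := hpos n
  have hdisj : Disjoint (Finset.Ico (N + 1) n) G := by
    rw [Finset.disjoint_left]
    intro m hm hmG
    have := hN hmG
    have := (Finset.mem_Ico.1 hm).1
    omega
  have h1 := (le_abs_self _).trans (hG _ hdisj).le
  have h2 : ∑ m ∈ Finset.Ico (N + 1) n, 1 / l n ≤ ∑ m ∈ Finset.Ico (N + 1) n, 1 / l m := by
    refine Finset.sum_le_sum fun m hm => ?_
    exact one_div_le_one_div_of_le (hpos m) (hmono (Finset.mem_Ico.1 hm).2.le)
  rw [Finset.sum_const, Nat.card_Ico, nsmul_eq_mul, mul_one_div] at h2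
  have h3 := (div_le_iff₀ hln).1 (h2.trans h1)
  have h4 : (n : ℝ) - (N + 1) ≤ ((n - (N + 1) : ℕ) : ℝ) := by
    have := Nat.le_sub_iff_add_le (m := n - (N+1)) (n := n) (k := N+1)
    rw [sub_le_iff_le_add]
    exact_mod_cast (by omega : n ≤ n - (N + 1) + (N + 1))
  linarith

theorem prod_div_add_one_le {X s : ℝ} (hX : 0 ≤ X) (hs : 0 < s) (J : ℕ) :
    ∏ i ∈ Finset.range J, (X / (i + 1 : ℕ)) ≤ (1 / s) ^ J * Real.exp (s * X) := by
  rw [Finset.prod_div_distrib, Finset.prod_const, Finset.card_range, ← Nat.cast_prod,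
    Finset.prod_range_add_one_eq_factorial]
  have h := Real.pow_div_factorial_le_exp (s * X) (by positivity) J
  calc X ^ J / (J.factorial : ℝ) = (1 / s) ^ J * ((s * X) ^ J / J.factorial) := by
        rw [mul_pow, one_div, inv_pow]; field_simp
    _ ≤ _ := by gcongr

/-- If the gaps are bounded below, then the coefficient bounds grow subexponentially in the
exponent. Of the factors with `l m < 2 * l n` there are `o(l n)`, and they are controlled by a
factorial; the other ones form a product of exponential type zero. -/
theorem exists_sqrt_mul_prod_erase_le {l : ℕ → ℝ} (hpos : ∀ n, 0 < l n)
    (hmono : StrictMono l) (hsum : Summable fun n => 1 / l n) {δ : ℝ} (hδ : 0 < δ)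
    (hgap : ∀ n, l n + δ ≤ l (n + 1)) {η : ℝ} (hη : 0 < η) :
    ∃ C, 0 < C ∧ ∀ (n : ℕ) (F : Finset ℕ),
      √(2 * l n) * ∏ m ∈ F.erase n, ((l m + l n) / |l m - l n|) ≤ C * Real.exp (4 * η * l n) := by
  obtain ⟨A, hA, hAprod⟩ := exists_prod_one_add_mul_le (a := fun m => 4 * (1 / l m))
    (fun m => by have := hpos m; positivity) (hsum.mul_left 4) hη
  set s : ℝ := min 1 (η * δ / 4) with hs
  have hs0 : 0 < s := lt_min one_pos (by positivity)
  have hs1 : s ≤ 1 := min_le_left _ _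
  set B : ℝ := Real.log (1 / s) + 1 with hB
  have hB1 : 1 ≤ B := by
    have := Real.log_nonneg (one_le_one_div hs0 hs1); linarith
  obtain ⟨K, hK, hlin⟩ := exists_nat_le_mul_add hpos hmono.monotone hsum (η := η / (4 * B))
    (by positivity)
  have hgap' : ∀ n j, l n + δ * j ≤ l (n + j) := by
    intro n j
    induction j with
    | zero => simp
    | succ j ih => have := hgap (n + j); push_cast; rw [← add_assoc]; linarith
  have hdist : ∀ m n : ℕ, δ * ((m - n : ℕ) + (n - m : ℕ) : ℝ) ≤ |l m - l n| := by
    intro m n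
    rcases le_total n m with h | h
    · have := hgap' n (m - n)
      rw [Nat.add_sub_cancel' h] at this
      rw [Nat.sub_eq_zero_of_le h]
      refine le_trans ?_ (le_abs_self _)
      push_cast; linarith
    · have := hgap' m (n - m)
      rw [Nat.add_sub_cancel' h] at this
      rw [Nat.sub_eq_zero_of_le h, abs_sub_comm]
      refine le_trans ?_ (le_abs_self _)
      push_cast; linarith
  refine ⟨1 / √η * (Real.exp (4 * B * K) * A), by positivity, fun n F => ?_⟩
  have hln := hpos n
  set J : ℕ := ⌊η / (2 * B) * l n + K⌋₊ with hJ
  have hJle : (J : ℝ) ≤ η / (2 * B) * l n + K := Nat.floor_le (by positivity)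
  have hmJ : ∀ m, l m < 2 * l n → m ≤ J := by
    intro m hm
    refine Nat.le_floor ((hlin m).trans ?_)
    have : η / (4 * B) * l m ≤ η / (4 * B) * (2 * l n) := by gcongr
    have e : η / (4 * B) * (2 * l n) = η / (2 * B) * l n := by field_simp; ring
    linarith
  set Y : ℝ := J + 2 * l n / δ with hY
  have hY0 : 0 ≤ Y := by positivity
  set f : ℕ → ℝ := fun m => (l m + l n) / |l m - l n| with hf
  have hf0 : ∀ m, 0 ≤ f m := fun m => by have := hpos m; positivity
  -- The factors at indices on one side of `n`. These indices have distances at most `J` from `n`.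
  have hside : ∀ (G : Finset ℕ) (d : ℕ → ℕ), (∀ m ∈ G, m ≠ n ∧ l m < 2 * l n) →
      (∀ m ∈ G, d m + 1 = (m - n) + (n - m)) → InjOn d G →
      ∏ m ∈ G, f m ≤ (1 / s) ^ J * Real.exp (s * Y) := by
    intro G d hG hd hdinj
    have hdJ : ∀ m ∈ G, d m < J := by
      intro m hm
      have h1 := hd m hm
      have h2 := hmJ m (hG m hm).2
      have h3 := hmJ n (by linarith)
      omega
    refine le_trans ?_ (prod_div_add_one_le hY0 hs0 J)
    calc ∏ m ∈ G, f m ≤ ∏ m ∈ G, (Y / (d m + 1 : ℕ)) := by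
          refine Finset.prod_le_prod (fun m _ => hf0 m) fun m hm => ?_
          have hd0 : (0 : ℝ) < (d m + 1 : ℕ) := by positivity
          have h1 : δ * (d m + 1 : ℕ) ≤ |l m - l n| := by
            rw [hd m hm]; push_cast; exact hdist m n
          have h2 : (d m + 1 : ℕ) ≤ J := hdJ m hm
          have h2' : ((d m + 1 : ℕ) : ℝ) ≤ J := by exact_mod_cast h2
          calc f m ≤ 1 + 2 * l n / |l m - l n| :=
                add_div_abs_sub_le fun h => (hG m hm).1 (hmono.injective h)
            _ ≤ 1 + 2 * l n / (δ * (d m + 1 : ℕ)) := by gcongr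
            _ ≤ Y / (d m + 1 : ℕ) := by
                rw [hY, le_div_iff₀ hd0, add_mul, one_mul]
                refine add_le_add h2' (le_of_eq ?_)
                field_simp
      _ = ∏ i ∈ G.image d, (Y / (i + 1 : ℕ)) := by rw [Finset.prod_image hdinj]
      _ ≤ _ := by
          refine Finset.prod_le_prod_of_subset_of_one_le ?_ (fun i _ => by positivity)
            fun i hi _ => ?_
          · intro i hi
            obtain ⟨m, hm, rfl⟩ := Finset.mem_image.1 hi
            exact Finset.mem_range.2 (hdJ m hm)
          · rw [one_le_div (by positivity)]
            have h1 : ((i + 1 : ℕ) : ℝ) ≤ J := by exact_mod_cast Finset.mem_range.1 hi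
            have h2 : 0 ≤ 2 * l n / δ := by positivity
            linarith
  have hsplit : F.erase n = ((F.erase n).filter (fun m => l m < 2 * l n ∧ m < n) ∪
      (F.erase n).filter (fun m => l m < 2 * l n ∧ n < m)) ∪
      (F.erase n).filter (fun m => 2 * l n ≤ l m) := by
    ext m
    simp only [Finset.mem_union, Finset.mem_filter, Finset.mem_erase]
    constructor
    · rintro ⟨h1, h2⟩
      rcases lt_or_ge (l m) (2 * l n) with h3 | h3
      · rcases lt_or_gt_of_ne h1 with h4 | h4
        · exact Or.inl (Or.inl ⟨⟨h1, h2⟩, h3, h4⟩)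
        · exact Or.inl (Or.inr ⟨⟨h1, h2⟩, h3, h4⟩)
      · exact Or.inr ⟨⟨h1, h2⟩, h3⟩
    · rintro ((h | h) | h) <;> exact h.1
  have hd1 : Disjoint ((F.erase n).filter (fun m => l m < 2 * l n ∧ m < n))
      ((F.erase n).filter (fun m => l m < 2 * l n ∧ n < m)) := by
    rw [Finset.disjoint_filter]
    intro m _ h1 h2
    exact lt_asymm h1.2 h2.2
  have hd2 : Disjoint ((F.erase n).filter (fun m => l m < 2 * l n ∧ m < n) ∪
      (F.erase n).filter (fun m => l m < 2 * l n ∧ n < m))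
      ((F.erase n).filter (fun m => 2 * l n ≤ l m)) := by
    rw [Finset.disjoint_union_left, Finset.disjoint_filter, Finset.disjoint_filter]
    exact ⟨fun m _ h1 h2 => absurd h1.1 (not_lt.2 h2), fun m _ h1 h2 => absurd h1.1 (not_lt.2 h2)⟩
  have h1 := hside ((F.erase n).filter (fun m => l m < 2 * l n ∧ m < n)) (fun m => n - m - 1)
    (fun m hm => by
      simp only [Finset.mem_filter, Finset.mem_erase] at hm; exact ⟨hm.1.1, hm.2.1⟩)
    (fun m hm => by simp only [Finset.mem_filter] at hm; omega)
    (fun a ha b hb hab => by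
      have ha' := (Finset.mem_filter.1 ha).2.2
      have hb' := (Finset.mem_filter.1 hb).2.2
      simp only at hab; omega)
  have h2 := hside ((F.erase n).filter (fun m => l m < 2 * l n ∧ n < m)) (fun m => m - n - 1)
    (fun m hm => by
      simp only [Finset.mem_filter, Finset.mem_erase] at hm; exact ⟨hm.1.1, hm.2.1⟩)
    (fun m hm => by simp only [Finset.mem_filter] at hm; omega)
    (fun a ha b hb hab => by
      have ha' := (Finset.mem_filter.1 ha).2.2
      have hb' := (Finset.mem_filter.1 hb).2.2
      simp only at hab; omega)
  have h3 : ∏ m ∈ (F.erase n).filter (fun m => 2 * l n ≤ l m), f m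
      ≤ A * Real.exp (η * l n) := by
    refine le_trans (Finset.prod_le_prod (fun m _ => hf0 m) fun m hm => ?_) (hAprod _ _ hln.le)
    simp only [Finset.mem_filter, Finset.mem_erase] at hm
    have hlm := hpos m
    refine (add_div_abs_sub_le fun h => hm.1.1 (hmono.injective h)).trans ?_
    rw [abs_of_pos (by linarith [hm.2])]
    gcongr
    rw [div_le_iff₀ (by linarith [hm.2]), mul_one_div, div_mul_eq_mul_div, div_mul_eq_mul_div,
      le_div_iff₀ hlm]
    nlinarith [hm.2]
  have h4 : (1 / s) ^ J * Real.exp (s * Y) ≤ Real.exp (B * J + η / 2 * l n) := by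
    have e1 : (1 / s) ^ J = Real.exp (Real.log (1 / s) * J) := by
      rw [mul_comm, Real.exp_nat_mul, Real.exp_log (by positivity)]
    rw [e1, ← Real.exp_add]
    refine Real.exp_le_exp.2 ?_
    have e2 : s * (2 * l n / δ) ≤ η / 2 * l n := by
      calc s * (2 * l n / δ) ≤ η * δ / 4 * (2 * l n / δ) := by
            gcongr; exact min_le_right _ _
        _ = η / 2 * l n := by field_simp; norm_num
    have e3 : s * J ≤ 1 * J := by gcongr
    rw [hY, hB]; nlinarith
  have h5 : √(2 * l n) ≤ 1 / √η * Real.exp (η * l n) := by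
    rw [one_div_mul_eq_div, le_div_iff₀ (Real.sqrt_pos.2 hη), ← Real.sqrt_mul (by positivity),
      Real.sqrt_le_left (Real.exp_pos _).le, ← Real.exp_nat_mul]
    have := Real.add_one_le_exp (((2 : ℕ) : ℝ) * (η * l n))
    push_cast at this ⊢
    linarith
  have h6 : 2 * (B * J + η / 2 * l n) ≤ 4 * B * K + 2 * η * l n := by
    have : B * J ≤ B * (η / (2 * B) * l n + K) := by gcongr
    have e : B * (η / (2 * B) * l n + K) = η / 2 * l n + B * K := by field_simp
    nlinarith [mul_nonneg (zero_le_one.trans hB1) hK, mul_pos hη hln]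
  have hp : ∀ G : Finset ℕ, 0 ≤ ∏ m ∈ G, f m := fun G => Finset.prod_nonneg fun m _ => hf0 m
  rw [hsplit, Finset.prod_union hd2, Finset.prod_union hd1]
  calc _ ≤ 1 / √η * Real.exp (η * l n) * (Real.exp (B * J + η / 2 * l n) *
        Real.exp (B * J + η / 2 * l n) * (A * Real.exp (η * l n))) := by
        exact mul_le_mul h5 (mul_le_mul (mul_le_mul (h1.trans h4) (h2.trans h4) (hp _)
          (Real.exp_pos _).le) h3 (hp _) (by positivity))
          (mul_nonneg (mul_nonneg (hp _) (hp _)) (hp _)) (by positivity)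
    _ = 1 / √η * A * (Real.exp (2 * (B * J + η / 2 * l n)) * Real.exp (2 * η * l n)) := by
        rw [two_mul (B * J + η / 2 * l n), mul_assoc 2 η, two_mul (η * l n),
          Real.exp_add (B * J + η / 2 * l n), Real.exp_add (η * l n)]; ring
    _ ≤ 1 / √η * A * (Real.exp (4 * B * K + 2 * η * l n) * Real.exp (2 * η * l n)) := by gcongr
    _ = _ := by
        rw [Real.exp_add, show 4 * η * l n = 2 * η * l n + 2 * η * l n by ring, Real.exp_add]; ring

end Products

/-! ### Müntz polynomials -/

section MuntzPolynomial

variable (𝕜 : Type*) [RCLike 𝕜]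

/-- The exponents shifted by `1 / 2`: the inner product of `x ^ s` and `x ^ t` in `L²([0, 1])` is the
Cauchy kernel at `s + 1 / 2` and `t + 1 / 2`. -/
noncomputable def muntzShift (Λ : ℕ → ℝ≥0) (n : ℕ) : ℝ := (Λ n : ℝ) + 1 / 2

theorem muntzShift_pos (Λ : ℕ → ℝ≥0) (n : ℕ) : 0 < muntzShift Λ n := by
  have := (Λ n).coe_nonneg
  unfold muntzShift; positivity

theorem muntzShift_injective {Λ : ℕ → ℝ≥0} (h : Function.Injective Λ) :
    Function.Injective (muntzShift Λ) := fun a b hab => h (by simpa [muntzShift] using hab)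

theorem inner_muntzMonomialL2 (s t : ℝ≥0) :
    inner 𝕜 (muntzMonomialL2 𝕜 s) (muntzMonomialL2 𝕜 t)
      = ((1 / ((s : ℝ) + 1 / 2 + ((t : ℝ) + 1 / 2)) : ℝ) : 𝕜) := by
  rw [muntzMonomialL2, muntzMonomialL2, ContinuousMap.inner_toLp]
  have h1 : ∀ x : I, muntzMonomial 𝕜 t x * (starRingEnd 𝕜) (muntzMonomial 𝕜 s x)
      = (((x : ℝ) ^ ((s : ℝ) + t) : ℝ) : 𝕜) := by
    intro x
    have hx : 0 ≤ (x : ℝ) := x.2.1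
    simp only [muntzMonomial, ContinuousMap.coe_mk, RCLike.conj_ofReal]
    rw [Real.rpow_add_of_nonneg hx s.coe_nonneg t.coe_nonneg]
    push_cast; ring
  simp_rw [h1]
  rw [integral_ofReal]
  congr 1
  have h2 : ∫ x : I, (x : ℝ) ^ ((s : ℝ) + t) = ∫ x in I, x ^ ((s : ℝ) + t) :=
    integral_subtype_comap measurableSet_Icc fun x : ℝ => x ^ ((s : ℝ) + t)
  rw [h2, integral_Icc_eq_integral_Ioc, ← intervalIntegral.integral_of_le zero_le_one,
    integral_rpow (Or.inl (by have := s.coe_nonneg; have := t.coe_nonneg; linarith))]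
  have : (s : ℝ) + t + 1 ≠ 0 := by positivity
  rw [Real.one_rpow, Real.zero_rpow this, sub_zero]
  congr 1; ring

/-- The Müntz polynomial with coefficients `c`, as an element of `L²([0, 1])`. -/
noncomputable def muntzPoly (Λ : ℕ → ℝ≥0) : (ℕ →₀ 𝕜) →ₗ[𝕜] Lp 𝕜 2 (volume : Measure I) :=
  Finsupp.linearCombination 𝕜 fun n => muntzMonomialL2 𝕜 (Λ n)

variable {𝕜}

theorem norm_muntzPoly_sq (Λ : ℕ → ℝ≥0) (c : ℕ →₀ 𝕜) :
    ‖muntzPoly 𝕜 Λ c‖ ^ 2 = cauchyForm c.support (muntzShift Λ) (fun n => RCLike.re (c n))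
      + cauchyForm c.support (muntzShift Λ) (fun n => RCLike.im (c n)) := by
  have h1 : ((‖muntzPoly 𝕜 Λ c‖ ^ 2 : ℝ) : 𝕜) = ∑ n ∈ c.support, ∑ m ∈ c.support,
      (starRingEnd 𝕜) (c n) * c m * ((1 / (muntzShift Λ n + muntzShift Λ m) : ℝ) : 𝕜) := by
    push_cast
    rw [← inner_self_eq_norm_sq_to_K (𝕜 := 𝕜), muntzPoly, Finsupp.linearCombination_apply,
      Finsupp.sum, sum_inner]
    refine Finset.sum_congr rfl fun n _ => ?_
    rw [inner_sum]
    refine Finset.sum_congr rfl fun m _ => ?_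
    rw [inner_smul_left, inner_smul_right, inner_muntzMonomialL2, ← mul_assoc]
    simp [muntzShift]
  have h2 := congrArg RCLike.re h1
  rw [RCLike.ofReal_re] at h2
  rw [h2, map_sum, cauchyForm, cauchyForm, ← Finset.sum_add_distrib]
  refine Finset.sum_congr rfl fun n _ => ?_
  rw [map_sum, ← Finset.sum_add_distrib]
  refine Finset.sum_congr rfl fun m _ => ?_
  rw [RCLike.re_mul_ofReal, RCLike.mul_re, RCLike.conj_re, RCLike.conj_im]
  ring

theorem sqrt_cauchyForm_re_le (Λ : ℕ → ℝ≥0) (c : ℕ →₀ 𝕜) :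
    √(cauchyForm c.support (muntzShift Λ) (fun n => RCLike.re (c n))) ≤ ‖muntzPoly 𝕜 Λ c‖ := by
  refine Real.sqrt_le_left (norm_nonneg _) |>.2 ?_
  rw [norm_muntzPoly_sq]
  exact le_add_of_nonneg_right (cauchyForm_nonneg (fun n _ => muntzShift_pos Λ n) _)

theorem sqrt_cauchyForm_im_le (Λ : ℕ → ℝ≥0) (c : ℕ →₀ 𝕜) :
    √(cauchyForm c.support (muntzShift Λ) (fun n => RCLike.im (c n))) ≤ ‖muntzPoly 𝕜 Λ c‖ := by
  refine Real.sqrt_le_left (norm_nonneg _) |>.2 ?_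
  rw [norm_muntzPoly_sq]
  exact le_add_of_nonneg_left (cauchyForm_nonneg (fun n _ => muntzShift_pos Λ n) _)

theorem span_muntzMonomialL2_eq (Λ : ℕ → ℝ≥0) (n : ℕ) {f : Lp 𝕜 2 (volume : Measure I)}
    (hf : f ∈ Submodule.span 𝕜 ((fun m => muntzMonomialL2 𝕜 (Λ m)) '' {m | m ≠ n})) :
    ∃ c : ℕ →₀ 𝕜, c n = 0 ∧ muntzPoly 𝕜 Λ c = f := by
  obtain ⟨c, hc, rfl⟩ := (Finsupp.mem_span_image_iff_linearCombination 𝕜).1 hf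
  refine ⟨c, ?_, rfl⟩
  by_contra h
  exact (Finsupp.mem_supported 𝕜 c).1 hc (Finsupp.mem_support_iff.2 h) rfl

/-- The element `x ^ Λ n - p`, with `p` in the span of the other monomials, has the coefficient `1` at
`x ^ Λ n`, so coefficient bounds yield lower bounds of the distance. -/
theorem inv_le_muntzDist {Λ : ℕ → ℝ≥0} (hinj : Function.Injective Λ) {n : ℕ} {C : ℝ} (hC : 0 < C)
    (h : ∀ F : Finset ℕ, √(2 * muntzShift Λ n) * ∏ m ∈ F.erase n,
      ((muntzShift Λ m + muntzShift Λ n) / |muntzShift Λ m - muntzShift Λ n|) ≤ C) :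
    C⁻¹ ≤ muntzDist 𝕜 Λ n := by
  refine (Metric.le_infDist (Submodule.nonempty _)).2 fun f hf => ?_
  obtain ⟨c, hcn, rfl⟩ := span_muntzMonomialL2_eq Λ n hf
  have h1 : muntzMonomialL2 𝕜 (Λ n) - muntzPoly 𝕜 Λ c
      = muntzPoly 𝕜 Λ (Finsupp.single n 1 - c) := by
    rw [map_sub]; simp [muntzPoly]
  rw [dist_eq_norm, h1]
  set c' := Finsupp.single n 1 - c with hc'
  have hc'n : c' n = 1 := by simp [hc', hcn]
  have hmem : n ∈ c'.support := by rw [Finsupp.mem_support_iff, hc'n]; exact one_ne_zero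
  have h2 := abs_coeff_le (fun m _ => muntzShift_pos Λ m) ((muntzShift_injective hinj).injOn)
    (fun m => RCLike.re (c' m)) hmem
  rw [hc'n, RCLike.one_re, abs_one, mul_assoc] at h2
  rw [inv_le_iff_one_le_mul₀ hC]
  refine h2.trans ?_
  exact mul_le_mul (sqrt_cauchyForm_re_le Λ c') (h _) (mul_nonneg (Real.sqrt_nonneg _)
    (Finset.prod_nonneg fun m _ => div_nonneg
      (add_pos (muntzShift_pos Λ m) (muntzShift_pos Λ n)).le (abs_nonneg _))) (norm_nonneg _)

theorem summable_one_div_muntzShift {Λ : ℕ → ℝ≥0} (hpos : ∀ n, 0 < Λ n)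
    (hsum : Summable fun n => 1 / (Λ n : ℝ)) : Summable fun n => 1 / muntzShift Λ n := by
  refine hsum.of_nonneg_of_le (fun n => by have := muntzShift_pos Λ n; positivity) fun n => ?_
  have h : (0 : ℝ) < Λ n := hpos n
  exact one_div_le_one_div_of_le h (by unfold muntzShift; linarith)

variable (𝕜) in
theorem muntzDist_pos {Λ : ℕ → ℝ≥0} (hpos : ∀ n, 0 < Λ n) (hinj : Function.Injective Λ)
    (hsum : Summable fun n => 1 / (Λ n : ℝ)) (n : ℕ) : 0 < muntzDist 𝕜 Λ n := by
  obtain ⟨C, hC, h⟩ := exists_prod_erase_le (muntzShift_pos Λ) (muntzShift_injective hinj)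
    (summable_one_div_muntzShift hpos hsum) n
  have hs : 0 < √(2 * muntzShift Λ n) := Real.sqrt_pos.2 (by have := muntzShift_pos Λ n; positivity)
  refine lt_of_lt_of_le (inv_pos.2 (mul_pos hs hC)) (inv_le_muntzDist hinj (mul_pos hs hC) ?_)
  intro F
  gcongr
  exact h F

/-- A Müntz polynomial with coefficient `c n ≠ 0` is `c n` times the difference of `x ^ Λ n` and a
combination of the other monomials. -/
theorem norm_coeff_mul_muntzDist_le (Λ : ℕ → ℝ≥0) (c : ℕ →₀ 𝕜) (n : ℕ) :
    ‖c n‖ * muntzDist 𝕜 Λ n ≤ ‖muntzPoly 𝕜 Λ c‖ := by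
  by_cases h0 : c n = 0
  · simp [h0]
  have h1 : muntzPoly 𝕜 Λ (c.erase n)
      ∈ Submodule.span 𝕜 ((fun m => muntzMonomialL2 𝕜 (Λ m)) '' {m | m ≠ n}) := by
    refine (Finsupp.mem_span_image_iff_linearCombination 𝕜).2 ⟨c.erase n, ?_, rfl⟩
    rw [Finsupp.mem_supported]
    intro m hm
    rw [Finsupp.support_erase] at hm
    exact (Finset.mem_erase.1 hm).1
  have h2 : muntzPoly 𝕜 Λ c = c n • (muntzMonomialL2 𝕜 (Λ n)
      - (-(c n)⁻¹) • muntzPoly 𝕜 Λ (c.erase n)) := by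
    conv_lhs => rw [← Finsupp.single_add_erase n c]
    rw [map_add, smul_sub, smul_smul, mul_neg, mul_inv_cancel₀ h0, neg_smul, one_smul,
      sub_neg_eq_add]
    simp [muntzPoly]
  rw [h2, norm_smul]
  gcongr
  rw [← dist_eq_norm]
  exact Metric.infDist_le_dist_of_mem (Submodule.smul_mem _ _ h1)

/-- If the gaps are bounded below, then `d n⁻¹` grows subexponentially in `Λ n`. -/
theorem muntzPsiConverges_of_gap {Λ : ℕ → ℝ≥0} (hpos : ∀ n, 0 < Λ n) (hmono : StrictMono Λ)
    (hsum : Summable fun n => 1 / (Λ n : ℝ)) {δ : ℝ} (hδ : 0 < δ)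
    (hgap : ∀ n, (Λ n : ℝ) + δ ≤ Λ (n + 1)) : MuntzPsiConverges 𝕜 Λ := by
  intro x hx
  rcases hx.1.eq_or_lt with rfl | hx0
  · refine summable_zero.congr fun n => ?_
    rw [Real.zero_rpow (by have := hpos n; exact_mod_cast this.ne'), mul_zero]
  set y := -Real.log x with hy
  have hy0 : 0 < y := neg_pos.2 (Real.log_neg hx0 hx.2)
  obtain ⟨C, hC, h⟩ := exists_sqrt_mul_prod_erase_le (muntzShift_pos Λ)
    (fun a b hab => by have := hmono hab; simpa [muntzShift] using this)
    (summable_one_div_muntzShift hpos hsum) hδ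
    (fun n => by have := hgap n; unfold muntzShift; linarith) (η := y / 8) (by positivity)
  refine Summable.of_nonneg_of_le (f := fun n => C * Real.exp (y / 4) * (2 / y) * (1 / (Λ n : ℝ)))
    (fun n => mul_nonneg (inv_nonneg.2 Metric.infDist_nonneg) (Real.rpow_nonneg hx.1 _))
    (fun n => ?_) (hsum.mul_left _)
  have hl : (0 : ℝ) < Λ n := hpos n
  have h1 := inv_le_muntzDist (𝕜 := 𝕜) hmono.injective (n := n)
    (C := C * Real.exp (4 * (y / 8) * muntzShift Λ n)) (by positivity) (h n)
  have h2 : (muntzDist 𝕜 Λ n)⁻¹ ≤ C * Real.exp (4 * (y / 8) * muntzShift Λ n) :=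
    inv_le_of_inv_le₀ (by positivity) h1
  have h3 : x ^ (Λ n : ℝ) = Real.exp (-(y * Λ n)) := by
    rw [Real.rpow_def_of_pos hx0, hy]; congr 1; ring
  rw [h3]
  have h4 : Real.exp (-(y / 2 * Λ n)) ≤ 2 / y * (1 / (Λ n : ℝ)) := by
    rw [Real.exp_neg, inv_le_comm₀ (Real.exp_pos _) (by positivity)]
    have := Real.add_one_le_exp (y / 2 * Λ n)
    have e : (2 / y * (1 / (Λ n : ℝ)))⁻¹ = y / 2 * Λ n := by field_simp
    linarith
  calc _ ≤ C * Real.exp (4 * (y / 8) * muntzShift Λ n) * Real.exp (-(y * Λ n)) := by gcongr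
    _ = C * Real.exp (y / 4) * Real.exp (-(y / 2 * Λ n)) := by
        rw [mul_assoc, ← Real.exp_add, mul_assoc C, ← Real.exp_add, muntzShift]; congr 2; ring
    _ ≤ C * Real.exp (y / 4) * (2 / y * (1 / (Λ n : ℝ))) := by gcongr
    _ = _ := by ring

/-- Müntz polynomials are bounded on `[0, b]` by their norm in `L²([0, 1])` if `b < 1`. -/
theorem exists_norm_sum_rpow_le {Λ : ℕ → ℝ≥0} (hpos : ∀ n, 0 < Λ n) (hinj : Function.Injective Λ)
    (hsum : Summable fun n => 1 / (Λ n : ℝ)) {b : ℝ} (hb : b < 1) :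
    ∃ C, 0 ≤ C ∧ ∀ (c : ℕ →₀ 𝕜) (x : ℝ), 0 ≤ x → x ≤ b →
      ‖∑ n ∈ c.support, c n * ((x ^ (Λ n : ℝ) : ℝ) : 𝕜)‖ ≤ C * ‖muntzPoly 𝕜 Λ c‖ := by
  rcases le_or_gt b 0 with hb0 | hb0
  · refine ⟨0, le_rfl, fun c x hx0 hxb => ?_⟩
    have hx : x = 0 := le_antisymm (hxb.trans hb0) hx0
    rw [Finset.sum_eq_zero, norm_zero, zero_mul]
    intro n _
    rw [hx, Real.zero_rpow (by have := hpos n; exact_mod_cast this.ne')]; simp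
  obtain ⟨C, hC, h⟩ := exists_abs_sum_exp_le (lam := fun n => (Λ n : ℝ)) hpos
    (fun a b hab => hinj (by simpa using hab)) hsum (y₀ := -Real.log b)
    (neg_pos.2 (Real.log_neg hb0 hb))
  refine ⟨2 * C, by positivity, fun c x hx0 hxb => ?_⟩
  rcases hx0.eq_or_lt with rfl | hx0
  · rw [Finset.sum_eq_zero, norm_zero]
    · positivity
    · intro n _
      rw [Real.zero_rpow (by have := hpos n; exact_mod_cast this.ne')]; simp
  have hx : ∀ n, x ^ (Λ n : ℝ) = Real.exp (-((Λ n : ℝ) * -Real.log x)) := by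
    intro n; rw [Real.rpow_def_of_pos hx0]; congr 1; ring
  have hlog : -Real.log b ≤ -Real.log x := neg_le_neg (Real.log_le_log hx0 hxb)
  have h1 := h c.support (fun n => RCLike.re (c n)) _ hlog
  have h2 := h c.support (fun n => RCLike.im (c n)) _ hlog
  have hnorm : ∀ z : 𝕜, ‖z‖ ≤ |RCLike.re z| + |RCLike.im z| := by
    intro z
    rw [← abs_of_nonneg (norm_nonneg z), ← abs_of_nonneg (add_nonneg (abs_nonneg (RCLike.re z))
      (abs_nonneg (RCLike.im z))), ← sq_le_sq, ← RCLike.normSq_eq_def', RCLike.normSq_apply]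
    have := mul_nonneg (abs_nonneg (RCLike.re z)) (abs_nonneg (RCLike.im z))
    nlinarith [abs_mul_abs_self (RCLike.re z), abs_mul_abs_self (RCLike.im z)]
  refine (hnorm _).trans ?_
  have e1 : RCLike.re (∑ n ∈ c.support, c n * ((x ^ (Λ n : ℝ) : ℝ) : 𝕜))
      = ∑ n ∈ c.support, RCLike.re (c n) * Real.exp (-((Λ n : ℝ) * -Real.log x)) := by
    rw [map_sum]
    refine Finset.sum_congr rfl fun n _ => ?_
    rw [RCLike.re_mul_ofReal, hx]
  have e2 : RCLike.im (∑ n ∈ c.support, c n * ((x ^ (Λ n : ℝ) : ℝ) : 𝕜))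
      = ∑ n ∈ c.support, RCLike.im (c n) * Real.exp (-((Λ n : ℝ) * -Real.log x)) := by
    rw [map_sum]
    refine Finset.sum_congr rfl fun n _ => ?_
    rw [RCLike.im_mul_ofReal, hx]
  rw [e1, e2]
  have h3 := mul_le_mul_of_nonneg_left (sqrt_cauchyForm_re_le Λ c) hC
  have h4 := mul_le_mul_of_nonneg_left (sqrt_cauchyForm_im_le Λ c) hC
  calc _ ≤ _ := add_le_add (h1.trans h3) (h2.trans h4)
    _ = _ := by ring

end MuntzPolynomial

/-! ### Operators given by families of functionals -/

section FunctionalOperator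

variable {𝕜 H X : Type*} [RCLike 𝕜]
  [NormedAddCommGroup H] [InnerProductSpace 𝕜 H]

theorem HilbertSchmidtBound.opNorm_le {K : Type*} [NormedAddCommGroup K] [InnerProductSpace 𝕜 K]
    {A : H →L[𝕜] K} {h : ℝ} (hA : HilbertSchmidtBound A h) : ‖A‖ ≤ √h := by
  refine A.opNorm_le_bound (Real.sqrt_nonneg _) fun f => ?_
  by_cases hf : f = 0
  · simp [hf]
  have hf' : ‖f‖ ≠ 0 := by simpa using hf
  have h1 := hA 1 (fun _ => ((‖f‖⁻¹ : ℝ) : 𝕜) • f)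
    ⟨fun _ => by rw [norm_smul]; simp [hf'], fun i j hij => absurd (Subsingleton.elim i j) hij⟩
  rw [Fin.sum_univ_one, map_smul, norm_smul, RCLike.norm_ofReal, abs_inv, abs_norm] at h1
  have h2 := Real.le_sqrt_of_sq_le h1
  rwa [inv_mul_le_iff₀ (by positivity), mul_comm] at h2

theorem norm_sq_eq_integral [MeasurableSpace X] {ν : Measure X} (f : Lp 𝕜 2 ν) :
    ‖f‖ ^ 2 = ∫ x, ‖f x‖ ^ 2 ∂ν := by
  have h1 : ((‖f‖ ^ 2 : ℝ) : 𝕜) = ((∫ x, ‖f x‖ ^ 2 ∂ν : ℝ) : 𝕜) := by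
    push_cast
    rw [← inner_self_eq_norm_sq_to_K (𝕜 := 𝕜), L2.inner_def, ← integral_ofReal]
    congr 1
    funext x
    rw [inner_self_eq_norm_sq_to_K]
    push_cast; rfl
  exact_mod_cast h1

/-- A family of functionals `ℓ x` with `‖ℓ x‖ ^ 2` bounded by an integrable function `B` defines
a Hilbert-Schmidt operator `f ↦ (x ↦ ℓ x f)` with values in `L²`, by Bessel's inequality. -/
theorem exists_operator_of_functionals [CompleteSpace H] [MeasurableSpace X] {ν : Measure X}
    {l : X → H →L[𝕜] 𝕜} {B : X → ℝ} (hmeas : ∀ f, AEStronglyMeasurable (fun x => l x f) ν)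
    (hB : Integrable B ν) (hl : ∀ᵐ x ∂ν, ‖l x‖ ^ 2 ≤ B x) :
    ∃ T : H →L[𝕜] Lp 𝕜 2 ν, (∀ f, T f =ᵐ[ν] fun x => l x f) ∧
      HilbertSchmidtBound T (∫ x, B x ∂ν) := by
  have hptw : ∀ f, ∀ᵐ x ∂ν, ‖l x f‖ ^ 2 ≤ B x * ‖f‖ ^ 2 := by
    intro f
    filter_upwards [hl] with x hx
    calc ‖l x f‖ ^ 2 ≤ (‖l x‖ * ‖f‖) ^ 2 := by gcongr; exact (l x).le_opNorm f
      _ = ‖l x‖ ^ 2 * ‖f‖ ^ 2 := mul_pow _ _ _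
      _ ≤ _ := by gcongr
  have hmem : ∀ f, MemLp (fun x => l x f) 2 ν := by
    intro f
    rw [memLp_two_iff_integrable_sq_norm (hmeas f)]
    refine (hB.mul_const (‖f‖ ^ 2)).mono' ((hmeas f).norm.pow 2) ?_
    filter_upwards [hptw f] with x hx
    rwa [Real.norm_of_nonneg (by positivity)]
  have hnorm : ∀ f, ‖(hmem f).toLp‖ ^ 2 = ∫ x, ‖l x f‖ ^ 2 ∂ν := by
    intro f
    rw [norm_sq_eq_integral]
    refine integral_congr_ae ?_
    filter_upwards [(hmem f).coeFn_toLp] with x hx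
    rw [hx]
  let L : H →ₗ[𝕜] Lp 𝕜 2 ν :=
    { toFun := fun f => (hmem f).toLp
      map_add' := fun f g => by
        rw [← MemLp.toLp_add]
        exact MemLp.toLp_congr _ _ (Filter.Eventually.of_forall fun x => by simp)
      map_smul' := fun c f => by
        rw [RingHom.id_apply, ← MemLp.toLp_const_smul]
        exact MemLp.toLp_congr _ _ (Filter.Eventually.of_forall fun x => by simp) }
  have hL : ∀ f, ‖L f‖ ≤ √(∫ x, B x ∂ν) * ‖f‖ := by
    intro f
    have h1 : ‖L f‖ ^ 2 ≤ (∫ x, B x ∂ν) * ‖f‖ ^ 2 := by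
      change ‖(hmem f).toLp‖ ^ 2 ≤ _
      rw [hnorm, ← integral_mul_const]
      exact integral_mono_ae ((memLp_two_iff_integrable_sq_norm (hmeas f)).1 (hmem f))
        (hB.mul_const _) (hptw f)
    rw [← Real.sqrt_sq (norm_nonneg f), ← Real.sqrt_mul' _ (sq_nonneg _)]
    exact Real.le_sqrt_of_sq_le h1
  refine ⟨L.mkContinuous _ hL, fun f => (hmem f).coeFn_toLp, fun r g hg => ?_⟩
  have h1 : ∀ i, ‖L.mkContinuous _ hL (g i)‖ ^ 2 = ∫ x, ‖l x (g i)‖ ^ 2 ∂ν := fun i => hnorm (g i)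
  simp_rw [h1]
  have hint : ∀ i ∈ Finset.univ, Integrable (fun x => ‖l x (g i)‖ ^ 2) ν := fun i _ =>
    (memLp_two_iff_integrable_sq_norm (hmeas (g i))).1 (hmem (g i))
  rw [← integral_finsetSum _ hint]
  refine integral_mono_ae (integrable_finsetSum _ hint) hB ?_
  filter_upwards [hl] with x hx
  refine le_trans ?_ hx
  have h2 := hg.sum_inner_products_le (x := (InnerProductSpace.toDual 𝕜 H).symm (l x))
    (s := Finset.univ)
  rw [LinearIsometryEquiv.norm_map] at h2
  refine le_trans (le_of_eq (Finset.sum_congr rfl fun i _ => ?_)) h2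
  rw [← norm_inner_symm, InnerProductSpace.toDual_symm_apply]

end FunctionalOperator

/-! ### Point evaluations and coefficients on the Müntz space -/

/-- A strictly increasing sequence of positive exponents with summable inverses. -/
structure IsMuntzSequence (Λ : ℕ → ℝ≥0) : Prop where
  pos : ∀ n, 0 < Λ n
  strictMono : StrictMono Λ
  summable : Summable fun n => 1 / (Λ n : ℝ)

section MuntzFunctional

variable (𝕜 : Type*) [RCLike 𝕜] (Λ : ℕ → ℝ≥0)

/-- Müntz polynomials as elements of the Müntz space. -/
noncomputable def muntzPolyMem : (ℕ →₀ 𝕜) →ₗ[𝕜] muntzSpace 𝕜 Λ :=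
  (muntzPoly 𝕜 Λ).codRestrict (muntzSpace 𝕜 Λ) fun c => subset_closure
    (Finsupp.mem_span_range_iff_exists_finsupp.2 ⟨c, rfl⟩)

theorem denseRange_muntzPolyMem : DenseRange (muntzPolyMem 𝕜 Λ) := by
  intro f
  have h : (f : Lp 𝕜 2 (volume : Measure I))
      ∈ closure (Subtype.val '' range (muntzPolyMem 𝕜 Λ)) := by
    refine closure_mono ?_ f.2
    intro g hg
    obtain ⟨c, rfl⟩ := Finsupp.mem_span_range_iff_exists_finsupp.1 hg
    exact ⟨muntzPolyMem 𝕜 Λ c, ⟨c, rfl⟩, rfl⟩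
  rw [Topology.IsInducing.subtypeVal.closure_eq_preimage_closure_image]
  exact h

/-- The value at `t` of the continuous representative of an element of the Müntz space. For
`0 ≤ t < 1` it is bounded on Müntz polynomials and extended by continuity; for other `t` it may be
the junk value `0` of `LinearMap.extendOfNorm`. -/
noncomputable def muntzEval (t : ℝ) : muntzSpace 𝕜 Λ →L[𝕜] 𝕜 :=
  (Finsupp.linearCombination 𝕜 fun n => ((t ^ (Λ n : ℝ) : ℝ) : 𝕜)).extendOfNorm
    (muntzPolyMem 𝕜 Λ)

/-- The coefficient of `x ^ Λ n`, extended by continuity to the Müntz space. -/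
noncomputable def muntzCoeff (n : ℕ) : muntzSpace 𝕜 Λ →L[𝕜] 𝕜 :=
  (Finsupp.lapply n : (ℕ →₀ 𝕜) →ₗ[𝕜] 𝕜).extendOfNorm (muntzPolyMem 𝕜 Λ)

/-- The monomial `x ^ Λ n` as an element of the Müntz space. -/
noncomputable def muntzMonomialMem (n : ℕ) : muntzSpace 𝕜 Λ :=
  muntzPolyMem 𝕜 Λ (Finsupp.single n 1)

variable {𝕜 Λ}

theorem coe_muntzMonomialMem (n : ℕ) :
    (muntzMonomialMem 𝕜 Λ n : Lp 𝕜 2 (volume : Measure I)) = muntzMonomialL2 𝕜 (Λ n) := by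
  change muntzPoly 𝕜 Λ (Finsupp.single n 1) = _
  simp [muntzPoly]

theorem muntzPolyMem_eq_sum (c : ℕ →₀ 𝕜) :
    muntzPolyMem 𝕜 Λ c = ∑ n ∈ c.support, c n • muntzMonomialMem 𝕜 Λ n := by
  conv_lhs => rw [← Finsupp.sum_single c]
  rw [Finsupp.sum, map_sum]
  refine Finset.sum_congr rfl fun n _ => ?_
  rw [muntzMonomialMem, ← map_smul]; simp

/-- Continuous linear maps on the Müntz space are determined by their values on monomials. -/
theorem muntzSpace_clm_ext {K : Type*} [NormedAddCommGroup K] [NormedSpace 𝕜 K]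
    {S T : muntzSpace 𝕜 Λ →L[𝕜] K}
    (h : ∀ n, S (muntzMonomialMem 𝕜 Λ n) = T (muntzMonomialMem 𝕜 Λ n)) : S = T := by
  have h1 : (S : muntzSpace 𝕜 Λ → K) = T := by
    refine (denseRange_muntzPolyMem 𝕜 Λ).equalizer S.continuous T.continuous ?_
    funext c
    simp only [Function.comp, muntzPolyMem_eq_sum, map_sum, map_smul, h]
  exact DFunLike.coe_injective h1

theorem muntzPsi_nonneg_term {x : ℝ} (hx : 0 ≤ x) (n : ℕ) :
    0 ≤ (muntzDist 𝕜 Λ n)⁻¹ * x ^ (Λ n : ℝ) :=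
  mul_nonneg (inv_nonneg.2 Metric.infDist_nonneg) (Real.rpow_nonneg hx _)

theorem muntzPsi_nonneg {x : ℝ} (hx : 0 ≤ x) : 0 ≤ muntzPsi 𝕜 Λ x :=
  tsum_nonneg (muntzPsi_nonneg_term hx)

theorem muntzPsi_mono (hψ : MuntzPsiConverges 𝕜 Λ) {x y : ℝ} (hx : 0 ≤ x) (hxy : x ≤ y)
    (hy : y < 1) : muntzPsi 𝕜 Λ x ≤ muntzPsi 𝕜 Λ y := by
  refine (hψ x ⟨hx, hxy.trans_lt hy⟩).tsum_le_tsum (fun n => ?_) (hψ y ⟨hx.trans hxy, hy⟩)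
  refine mul_le_mul_of_nonneg_left ?_ (inv_nonneg.2 Metric.infDist_nonneg)
  exact Real.rpow_le_rpow hx hxy (Λ n).coe_nonneg

namespace IsMuntzSequence

variable (hΛ : IsMuntzSequence Λ)
include hΛ

theorem exists_norm_eval_poly_le {b : ℝ} (hb : b < 1) :
    ∃ C, 0 ≤ C ∧ ∀ t, 0 ≤ t → t ≤ b → ∀ c : ℕ →₀ 𝕜,
      ‖Finsupp.linearCombination 𝕜 (fun n => ((t ^ (Λ n : ℝ) : ℝ) : 𝕜)) c‖
        ≤ C * ‖muntzPolyMem 𝕜 Λ c‖ := by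
  obtain ⟨C, hC, h⟩ := exists_norm_sum_rpow_le (𝕜 := 𝕜) hΛ.pos hΛ.strictMono.injective
    hΛ.summable hb
  exact ⟨C, hC, fun t ht htb c => h c t ht htb⟩

theorem muntzEval_poly {t : ℝ} (ht : 0 ≤ t) (ht1 : t < 1) (c : ℕ →₀ 𝕜) :
    muntzEval 𝕜 Λ t (muntzPolyMem 𝕜 Λ c)
      = ∑ n ∈ c.support, c n * ((t ^ (Λ n : ℝ) : ℝ) : 𝕜) := by
  obtain ⟨C, -, h⟩ := hΛ.exists_norm_eval_poly_le (𝕜 := 𝕜) ht1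
  exact LinearMap.extendOfNorm_eq (denseRange_muntzPolyMem 𝕜 Λ) ⟨C, h t ht le_rfl⟩ c

theorem muntzEval_monomial {t : ℝ} (ht : 0 ≤ t) (ht1 : t < 1) (n : ℕ) :
    muntzEval 𝕜 Λ t (muntzMonomialMem 𝕜 Λ n) = ((t ^ (Λ n : ℝ) : ℝ) : 𝕜) := by
  obtain ⟨C, -, h⟩ := hΛ.exists_norm_eval_poly_le (𝕜 := 𝕜) ht1
  rw [muntzMonomialMem, muntzEval,
    LinearMap.extendOfNorm_eq (denseRange_muntzPolyMem 𝕜 Λ) ⟨C, h t ht le_rfl⟩]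
  simp

theorem exists_norm_muntzEval_le (𝕜 : Type*) [RCLike 𝕜] {b : ℝ} (hb : b < 1) :
    ∃ C, 0 ≤ C ∧ ∀ t, 0 ≤ t → t ≤ b → ‖muntzEval 𝕜 Λ t‖ ≤ C := by
  obtain ⟨C, hC, h⟩ := hΛ.exists_norm_eval_poly_le (𝕜 := 𝕜) hb
  exact ⟨C, hC, fun t ht htb =>
    LinearMap.opNorm_extendOfNorm_le (denseRange_muntzPolyMem 𝕜 Λ) hC (h t ht htb)⟩

theorem norm_coeff_le (c : ℕ →₀ 𝕜) (n : ℕ) :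
    ‖c n‖ ≤ (muntzDist 𝕜 Λ n)⁻¹ * ‖muntzPolyMem 𝕜 Λ c‖ := by
  rw [inv_mul_eq_div, le_div_iff₀ (muntzDist_pos 𝕜 hΛ.pos hΛ.strictMono.injective hΛ.summable n)]
  exact norm_coeff_mul_muntzDist_le Λ c n

theorem muntzCoeff_poly (c : ℕ →₀ 𝕜) (n : ℕ) : muntzCoeff 𝕜 Λ n (muntzPolyMem 𝕜 Λ c) = c n :=
  LinearMap.extendOfNorm_eq (denseRange_muntzPolyMem 𝕜 Λ) ⟨_, fun c => hΛ.norm_coeff_le c n⟩ c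

theorem norm_muntzCoeff_le (n : ℕ) : ‖muntzCoeff 𝕜 Λ n‖ ≤ (muntzDist 𝕜 Λ n)⁻¹ :=
  LinearMap.opNorm_extendOfNorm_le (denseRange_muntzPolyMem 𝕜 Λ)
    (inv_nonneg.2 Metric.infDist_nonneg) fun c => hΛ.norm_coeff_le c n

theorem muntzCoeff_monomial (n m : ℕ) :
    muntzCoeff 𝕜 Λ n (muntzMonomialMem 𝕜 Λ m) = if m = n then 1 else 0 := by
  rw [muntzMonomialMem, hΛ.muntzCoeff_poly, Finsupp.single_apply]

theorem norm_muntzEval_le_muntzPsi (hψ : MuntzPsiConverges 𝕜 Λ) {t : ℝ} (ht : 0 ≤ t)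
    (ht1 : t < 1) : ‖muntzEval 𝕜 Λ t‖ ≤ muntzPsi 𝕜 Λ t := by
  refine LinearMap.opNorm_extendOfNorm_le (denseRange_muntzPolyMem 𝕜 Λ) (muntzPsi_nonneg ht)
    fun c => ?_
  rw [Finsupp.linearCombination_apply, Finsupp.sum, muntzPsi]
  calc _ ≤ ∑ n ∈ c.support, (muntzDist 𝕜 Λ n)⁻¹ * t ^ (Λ n : ℝ) * ‖muntzPolyMem 𝕜 Λ c‖ := by
        refine norm_sum_le_of_le _ fun n _ => ?_
        rw [smul_eq_mul, norm_mul, RCLike.norm_ofReal, abs_of_nonneg (Real.rpow_nonneg ht _),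
          mul_right_comm]
        exact mul_le_mul_of_nonneg_right (hΛ.norm_coeff_le c n) (Real.rpow_nonneg ht _)
    _ ≤ _ := by
        rw [← Finset.sum_mul]
        gcongr
        exact (hψ t ⟨ht, ht1⟩).sum_le_tsum _ fun n _ => muntzPsi_nonneg_term ht n

/-- Elements of the Müntz space are locally uniform limits of Müntz polynomials on `[0, 1)`. -/
theorem continuousOn_muntzEval (f : muntzSpace 𝕜 Λ) :
    ContinuousOn (fun t => muntzEval 𝕜 Λ t f) (Ico 0 1) := by
  have hmain : ∀ b < 1, ContinuousOn (fun t => muntzEval 𝕜 Λ t f) (Icc 0 b) := by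
    intro b hb
    obtain ⟨C, hC, h⟩ := hΛ.exists_norm_muntzEval_le 𝕜 hb
    refine continuousOn_of_uniform_approx_of_continuousOn fun u hu => ?_
    obtain ⟨ε, hε, hεu⟩ := Metric.mem_uniformity_dist.1 hu
    obtain ⟨c, hc⟩ := (denseRange_muntzPolyMem 𝕜 Λ).exists_dist_lt f
      (ε := ε / (C + 1)) (by positivity)
    refine ⟨fun t => ∑ n ∈ c.support, c n * ((t ^ (Λ n : ℝ) : ℝ) : 𝕜), ?_, fun t ht => hεu ?_⟩
    · refine Continuous.continuousOn ?_
      refine continuous_finsetSum _ fun n _ => continuous_const.mul ?_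
      exact RCLike.continuous_ofReal.comp (Real.continuous_rpow_const (Λ n).coe_nonneg)
    · change dist (muntzEval 𝕜 Λ t f) (∑ n ∈ c.support, c n * ((t ^ (Λ n : ℝ) : ℝ) : 𝕜)) < ε
      rw [← hΛ.muntzEval_poly ht.1 (ht.2.trans_lt hb), dist_eq_norm, ← map_sub]
      calc _ ≤ C * ‖f - muntzPolyMem 𝕜 Λ c‖ :=
            ((muntzEval 𝕜 Λ t).le_opNorm _).trans (by gcongr; exact h t ht.1 ht.2)
        _ ≤ C * (ε / (C + 1)) := by rw [← dist_eq_norm]; gcongr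
        _ < ε := by
            rw [mul_div_assoc', div_lt_iff₀ (by positivity)]; nlinarith
  intro t ht
  have h1 := hmain ((t + 1) / 2) (by linarith [ht.2]) t ⟨ht.1, by linarith [ht.2]⟩
  refine h1.mono_of_mem_nhdsWithin ?_
  rw [mem_nhdsWithin]
  exact ⟨Iio ((t + 1) / 2), isOpen_Iio, by simp; linarith [ht.2], fun s hs => ⟨hs.2.1, hs.1.le⟩⟩

end IsMuntzSequence

end MuntzFunctional

/-! ### Embeddings, dilations and the Volterra operator -/

section MuntzOperator

variable {𝕜 : Type*} [RCLike 𝕜] {Λ : ℕ → ℝ≥0}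

namespace IsMuntzSequence

variable (hΛ : IsMuntzSequence Λ)
include hΛ

theorem aestronglyMeasurable_muntzEval {ν : Measure I} {φ : I → ℝ} (hφ : Continuous φ)
    (hφ0 : ∀ t, 0 ≤ φ t) {b : ℝ} (hb : b < 1) (hle : ∀ᵐ t ∂ν, φ t ≤ b) (f : muntzSpace 𝕜 Λ) :
    AEStronglyMeasurable (fun t => muntzEval 𝕜 Λ (φ t) f) ν := by
  have hs : MeasurableSet {t | φ t ≤ b} := (isClosed_le hφ continuous_const).measurableSet
  have h1 : ContinuousOn (fun t => muntzEval 𝕜 Λ (φ t) f) {t | φ t ≤ b} :=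
    (hΛ.continuousOn_muntzEval f).comp hφ.continuousOn fun t ht =>
      ⟨hφ0 t, lt_of_le_of_lt ht hb⟩
  have h2 := h1.aestronglyMeasurable (μ := ν) hs
  have hr : ν.restrict {t | φ t ≤ b} = ν := Measure.restrict_eq_self_of_ae_mem hle
  rw [hr] at h2
  exact h2

/-- The operator `f ↦ f ∘ φ` from the Müntz space to `L²(ν)`, for `φ` with values in `[0, b]`
almost everywhere. It is a Hilbert-Schmidt operator. -/
theorem exists_evalOperator (𝕜 : Type*) [RCLike 𝕜] {ν : Measure I} [IsFiniteMeasure ν] {φ : I → ℝ}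
    (hφ : Continuous φ) (hφ0 : ∀ t, 0 ≤ φ t) {b : ℝ} (hb : b < 1) (hle : ∀ᵐ t ∂ν, φ t ≤ b) :
    ∃ T : muntzSpace 𝕜 Λ →L[𝕜] Lp 𝕜 2 ν, (∀ f, T f =ᵐ[ν] fun t => muntzEval 𝕜 Λ (φ t) f) ∧
      ∀ C : ℝ, (∀ᵐ t ∂ν, ‖muntzEval 𝕜 Λ (φ t)‖ ≤ C) →
        HilbertSchmidtBound T (C ^ 2 * ν.real univ) := by
  have hex : ∀ C : ℝ, (∀ᵐ t ∂ν, ‖muntzEval 𝕜 Λ (φ t)‖ ≤ C) →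
      ∃ T : muntzSpace 𝕜 Λ →L[𝕜] Lp 𝕜 2 ν, (∀ f, T f =ᵐ[ν] fun t => muntzEval 𝕜 Λ (φ t) f) ∧
        HilbertSchmidtBound T (C ^ 2 * ν.real univ) := by
    intro C hC
    obtain ⟨T, hT, hHS⟩ := exists_operator_of_functionals (ν := ν) (B := fun _ => C ^ 2)
      (hΛ.aestronglyMeasurable_muntzEval (𝕜 := 𝕜) hφ hφ0 hb hle) (integrable_const _)
      (by filter_upwards [hC] with t ht; gcongr)
    refine ⟨T, hT, ?_⟩
    rwa [integral_const, smul_eq_mul, mul_comm] at hHS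
  obtain ⟨C₀, -, h₀⟩ := hΛ.exists_norm_muntzEval_le 𝕜 hb
  obtain ⟨T, hT, -⟩ := hex C₀ (by filter_upwards [hle] with t ht using h₀ _ (hφ0 t) ht)
  refine ⟨T, hT, fun C hC => ?_⟩
  obtain ⟨T', hT', hHS⟩ := hex C hC
  have : T = T' := ContinuousLinearMap.ext fun f => Lp.ext ((hT f).trans (hT' f).symm)
  rwa [this]

/-- An element of the Müntz space agrees almost everywhere with its continuous representative. -/
theorem coe_ae_eq_muntzEval (f : muntzSpace 𝕜 Λ) :
    ((f : Lp 𝕜 2 (volume : Measure I)) : I → 𝕜) =ᵐ[volume] fun t => muntzEval 𝕜 Λ t f := by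
  -- On `[0, b]`, both sides are continuous in `f` and agree on monomials.
  have h1 : ∀ b : ℝ, b < 1 → ∀ᵐ t : I, (t : ℝ) ≤ b →
      ((f : Lp 𝕜 2 (volume : Measure I)) : I → 𝕜) t = muntzEval 𝕜 Λ t f := by
    intro b hb
    set s : Set I := {t | (t : ℝ) ≤ b} with hs
    have hsm : MeasurableSet s := (isClosed_le continuous_subtype_val continuous_const).measurableSet
    obtain ⟨T, hT, -⟩ := hΛ.exists_evalOperator 𝕜 (ν := volume.restrict s) continuous_subtype_val
      (fun t => t.2.1) hb (ae_restrict_mem hsm)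
    have hTR : T = (LpToLpRestrictCLM I 𝕜 𝕜 volume 2 s).comp (muntzSpace 𝕜 Λ).subtypeL := by
      refine muntzSpace_clm_ext fun n => Lp.ext ?_
      refine (hT _).trans ?_
      have h2 : ∀ᵐ t ∂(volume.restrict s : Measure I), muntzMonomialL2 𝕜 (Λ n) t
          = muntzMonomial 𝕜 (Λ n) t :=
        ae_restrict_of_ae
          (ContinuousMap.coeFn_toLp (p := 2) (𝕜 := 𝕜) volume (muntzMonomial 𝕜 (Λ n)))
      have h3 := LpToLpRestrictCLM_coeFn (F := 𝕜) 𝕜 s (muntzMonomialL2 𝕜 (Λ n))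
      filter_upwards [h2, h3, ae_restrict_mem hsm] with t ht2 ht3 hts
      rw [ContinuousLinearMap.comp_apply, Submodule.subtypeL_apply, coe_muntzMonomialMem, ht3, ht2,
        hΛ.muntzEval_monomial t.2.1 (lt_of_le_of_lt hts hb)]
      rfl
    have h2 := hT f
    rw [hTR] at h2
    have h3 := LpToLpRestrictCLM_coeFn (F := 𝕜) 𝕜 s (f : Lp 𝕜 2 (volume : Measure I))
    have h4 := h3.symm.trans h2
    rwa [Filter.EventuallyEq, ae_restrict_iff' hsm] at h4
  have h2 : ∀ n : ℕ, ∀ᵐ t : I, (t : ℝ) ≤ 1 - 1 / (n + 1 : ℝ) →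
      ((f : Lp 𝕜 2 (volume : Measure I)) : I → 𝕜) t = muntzEval 𝕜 Λ t f := fun n =>
    h1 _ (by have : (0 : ℝ) < 1 / (n + 1 : ℝ) := by positivity
             linarith)
  have h3 : ∀ᵐ t : I, t ≠ 1 := by simp [ae_iff]
  filter_upwards [ae_all_iff.2 h2, h3] with t ht ht1
  have h4 : (t : ℝ) < 1 := lt_of_le_of_ne t.2.2 fun h => ht1 (Subtype.ext h)
  obtain ⟨n, hn⟩ := exists_nat_one_div_lt (sub_pos.2 h4)
  exact ht n (by linarith)

/-- The dilation `f ↦ f (ρ ·)` maps the Müntz space to itself and is a Hilbert-Schmidt operator. -/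
theorem exists_dilation (𝕜 : Type*) [RCLike 𝕜] {ρ : ℝ} (hρ : 0 ≤ ρ) (hρ1 : ρ < 1) :
    ∃ D : muntzSpace 𝕜 Λ →L[𝕜] muntzSpace 𝕜 Λ,
      (∀ n, D (muntzMonomialMem 𝕜 Λ n) = ((ρ ^ (Λ n : ℝ) : ℝ) : 𝕜) • muntzMonomialMem 𝕜 Λ n) ∧
      ∃ h, HilbertSchmidtBound D h := by
  have hle : ∀ᵐ t : I, ρ * (t : ℝ) ≤ ρ :=
    Filter.Eventually.of_forall fun t => mul_le_of_le_one_right hρ t.2.2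
  obtain ⟨T, hT, hHS⟩ := hΛ.exists_evalOperator 𝕜 (ν := volume) (φ := fun t : I => ρ * (t : ℝ))
    (continuous_const.mul continuous_subtype_val) (fun t => mul_nonneg hρ t.2.1) hρ1 hle
  obtain ⟨C, -, hC⟩ := hΛ.exists_norm_muntzEval_le 𝕜 hρ1
  have hHS' := hHS C (by filter_upwards [hle] with t ht using hC _ (mul_nonneg hρ t.2.1) ht)
  have hmono : ∀ n, T (muntzMonomialMem 𝕜 Λ n)
      = ((ρ ^ (Λ n : ℝ) : ℝ) : 𝕜) • muntzMonomialL2 𝕜 (Λ n) := by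
    intro n
    refine Lp.ext ((hT _).trans ?_)
    filter_upwards [Lp.coeFn_smul ((ρ ^ (Λ n : ℝ) : ℝ) : 𝕜) (muntzMonomialL2 𝕜 (Λ n)), hle,
      ContinuousMap.coeFn_toLp (p := 2) (𝕜 := 𝕜) volume (muntzMonomial 𝕜 (Λ n))] with t h1 h2 h3
    rw [h1, hΛ.muntzEval_monomial (mul_nonneg hρ t.2.1) (h2.trans_lt hρ1), Pi.smul_apply,
      muntzMonomialL2, h3, Real.mul_rpow hρ t.2.1]
    simp [muntzMonomial]
  have hmem : ∀ f, T f ∈ muntzSpace 𝕜 Λ := by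
    intro f
    refine (denseRange_muntzPolyMem 𝕜 Λ).induction_on
      (p := fun f => T f ∈ muntzSpace 𝕜 Λ) f ?_ fun c => ?_
    · exact (Submodule.isClosed_topologicalClosure _).preimage T.continuous
    · rw [muntzPolyMem_eq_sum, map_sum]
      refine Submodule.sum_mem _ fun n _ => ?_
      rw [map_smul, hmono, ← coe_muntzMonomialMem]
      exact Submodule.smul_mem _ _ (Submodule.smul_mem _ _ (Subtype.coe_prop _))
  refine ⟨T.codRestrict _ hmem, fun n => Subtype.ext ?_, _, fun r g hg => hHS' r g hg⟩
  rw [ContinuousLinearMap.coe_codRestrict_apply, hmono, Submodule.coe_smul, coe_muntzMonomialMem]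

theorem muntzEval_dilation_pow {ρ : ℝ} (hρ : 0 ≤ ρ) (hρ1 : ρ < 1)
    {D : muntzSpace 𝕜 Λ →L[𝕜] muntzSpace 𝕜 Λ}
    (hD : ∀ n, D (muntzMonomialMem 𝕜 Λ n) = ((ρ ^ (Λ n : ℝ) : ℝ) : 𝕜) • muntzMonomialMem 𝕜 Λ n)
    (k : ℕ) {t : ℝ} (ht : 0 ≤ t) (ht1 : t < 1) (f : muntzSpace 𝕜 Λ) :
    muntzEval 𝕜 Λ t ((D ^ k) f) = muntzEval 𝕜 Λ (ρ ^ k * t) f := by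
  have hpow : ∀ n, (D ^ k) (muntzMonomialMem 𝕜 Λ n)
      = (((ρ ^ (Λ n : ℝ)) ^ k : ℝ) : 𝕜) • muntzMonomialMem 𝕜 Λ n := by
    intro n
    induction k with
    | zero => simp
    | succ k ih =>
      rw [pow_succ', ContinuousLinearMap.mul_def, ContinuousLinearMap.comp_apply, ih, map_smul,
        hD, smul_smul]
      push_cast; rw [pow_succ]
  have h : (muntzEval 𝕜 Λ t).comp (D ^ k) = muntzEval 𝕜 Λ (ρ ^ k * t) := by
    refine muntzSpace_clm_ext fun n => ?_
    have hk : ρ ^ k * t < 1 := lt_of_le_of_lt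
      (mul_le_of_le_one_left ht (pow_le_one₀ hρ hρ1.le)) ht1
    rw [ContinuousLinearMap.comp_apply, hpow, map_smul, hΛ.muntzEval_monomial ht ht1,
      hΛ.muntzEval_monomial (by positivity) hk, Real.mul_rpow (by positivity) ht,
      ← Real.rpow_natCast, ← Real.rpow_natCast, ← Real.rpow_mul hρ, ← Real.rpow_mul hρ,
      mul_comm (Λ n : ℝ)]
    push_cast; rfl
  exact DFunLike.congr_fun h f

/-- The embedding factors through powers of dilations, which are Hilbert-Schmidt operators. -/
theorem schattenSum_evalOperator_lt_top {μ : Measure I} [IsFiniteMeasure μ] {b : ℝ} (hb0 : 0 < b)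
    (hb : b < 1) (hμ : ∀ᵐ t : I ∂μ, (t : ℝ) ≤ b) {T : muntzSpace 𝕜 Λ →L[𝕜] Lp 𝕜 2 μ}
    (hT : ∀ f, T f =ᵐ[μ] fun t => muntzEval 𝕜 Λ t f) {q : ℝ} (hq : 0 < q) :
    schattenSum q T < ⊤ := by
  refine schattenSum_lt_top_of_dominated (fun k hk => ?_) hq
  have hk0 : (k : ℝ) ≠ 0 := by positivity
  set b' := (1 + b) / 2 with hb'
  have hb'0 : 0 < b' := by positivity
  have hb'1 : b' < 1 := by linarith
  set ρ := b' ^ (1 / (k : ℝ)) with hρ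
  have hρ0 : 0 ≤ ρ := by positivity
  have hρ1 : ρ < 1 := Real.rpow_lt_one hb'0.le hb'1 (by positivity)
  have hρk : ρ ^ k = b' := by
    rw [hρ, ← Real.rpow_natCast, ← Real.rpow_mul hb'0.le, one_div_mul_cancel hk0, Real.rpow_one]
  obtain ⟨D, hD, h, hh⟩ := hΛ.exists_dilation 𝕜 hρ0 hρ1
  have hbb : b / b' < 1 := by rw [div_lt_one hb'0]; linarith
  have hle : ∀ᵐ t : I ∂μ, (t : ℝ) / b' ≤ b / b' := by
    filter_upwards [hμ] with t ht; gcongr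
  obtain ⟨E, hE, -⟩ := hΛ.exists_evalOperator 𝕜 (ν := μ) (φ := fun t : I => (t : ℝ) / b')
    (continuous_subtype_val.div_const _) (fun t => div_nonneg t.2.1 hb'0.le) hbb hle
  refine ⟨D, h, ‖E‖, hh, norm_nonneg E, fun z => ?_⟩
  have hz : T z = E ((D ^ k) z) := by
    refine Lp.ext ((hT z).trans ((hE _).trans ?_).symm)
    filter_upwards [hle] with t ht
    rw [hΛ.muntzEval_dilation_pow hρ0 hρ1 hD k (div_nonneg t.2.1 hb'0.le) (ht.trans_lt hbb), hρk,
      mul_div_cancel₀ _ hb'0.ne']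
  rw [hz]
  exact E.le_opNorm _

end IsMuntzSequence

end MuntzOperator

section Volterra

/-- The Volterra operator on `L²([0, 1])`: the square of its Hilbert-Schmidt norm is `1 / 2`, and
it integrates monomials. -/
theorem exists_volterra (𝕜 : Type*) [RCLike 𝕜] :
    ∃ V : Lp 𝕜 2 (volume : Measure I) →L[𝕜] Lp 𝕜 2 (volume : Measure I),
      HilbertSchmidtBound V (1 / 2) ∧
      ∀ s : ℝ≥0, V (muntzMonomialL2 𝕜 s)
        = ((1 / ((s : ℝ) + 1) : ℝ) : 𝕜) • muntzMonomialL2 𝕜 (s + 1) := by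
  -- The functionals `f ↦ ∫ x in 0..t, f x` have norm `√t`.
  set l : I → Lp 𝕜 2 (volume : Measure I) →L[𝕜] 𝕜 := fun t =>
    innerSL 𝕜 (indicatorConstLp 2 (measurableSet_Iic (a := t)) (measure_ne_top _ _) (1 : 𝕜)) with hl
  have hlf : ∀ t f, l t f = ∫ x in Iic t, f x := fun t f => by
    rw [hl]; exact L2.inner_indicatorConstLp_one _ _ f
  have hvol : ∀ t : I, (volume : Measure I).real (Iic t) = t := by
    intro t
    rw [Measure.real, unitInterval.volume_Iic, ENNReal.toReal_ofReal t.2.1]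
  have hnorm : ∀ t, ‖l t‖ ^ 2 ≤ (t : ℝ) := by
    intro t
    rw [hl]
    simp only [innerSL_apply_norm]
    rw [norm_indicatorConstLp two_ne_zero ENNReal.ofNat_ne_top, hvol, norm_one, one_mul,
      ← Real.rpow_natCast, ← Real.rpow_mul t.2.1]
    simp
  have hmeas : ∀ f, AEStronglyMeasurable (fun t => l t f) (volume : Measure I) := by
    intro f
    have h1 : StronglyMeasurable fun p : I × I => (Iic p.1).indicator (fun x => f x) p.2 := by
      have h2 : (fun p : I × I => (Iic p.1).indicator (fun x => f x) p.2)
          = {p : I × I | p.2 ≤ p.1}.indicator fun p => f p.2 := by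
        funext p
        simp [indicator]
      rw [h2]
      exact ((Lp.stronglyMeasurable f).comp_measurable measurable_snd).indicator
        (measurableSet_le measurable_snd measurable_fst)
    have h3 := h1.integral_prod_right' (ν := (volume : Measure I))
    refine h3.aestronglyMeasurable.congr (Filter.Eventually.of_forall fun t => ?_)
    simp only
    rw [hlf, integral_indicator measurableSet_Iic]
  have hint : ∫ t : I, (t : ℝ) = 1 / 2 := by
    have h2 : ∫ x : I, (x : ℝ) = ∫ x in I, x :=
      integral_subtype_comap measurableSet_Icc fun x : ℝ => x
    rw [h2, integral_Icc_eq_integral_Ioc, ← intervalIntegral.integral_of_le zero_le_one,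
      integral_id]
    norm_num
  obtain ⟨V, hV, hHS⟩ := exists_operator_of_functionals hmeas
    (B := fun t : I => (t : ℝ)) (Continuous.integrable_of_hasCompactSupport continuous_subtype_val
      (HasCompactSupport.of_compactSpace _)) (Filter.Eventually.of_forall hnorm)
  refine ⟨V, by rwa [hint] at hHS, fun s => Lp.ext ((hV _).trans ?_)⟩
  filter_upwards [Lp.coeFn_smul ((1 / ((s : ℝ) + 1) : ℝ) : 𝕜) (muntzMonomialL2 𝕜 (s + 1)),
    ContinuousMap.coeFn_toLp (p := 2) (𝕜 := 𝕜) volume (muntzMonomial 𝕜 (s + 1))] with t h1 h2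
  have h2' : muntzMonomialL2 𝕜 (s + 1) t = muntzMonomial 𝕜 (s + 1) t := h2
  rw [h1, Pi.smul_apply, h2', hlf]
  have h3 : ∫ x in Iic t, muntzMonomialL2 𝕜 s x = ∫ x in Iic t, muntzMonomial 𝕜 s x :=
    integral_congr_ae (ae_restrict_of_ae
      (ContinuousMap.coeFn_toLp (p := 2) (𝕜 := 𝕜) volume (muntzMonomial 𝕜 s)))
  have h4 : ∫ x in Iic t, (x : ℝ) ^ (s : ℝ) = (t : ℝ) ^ ((s : ℝ) + 1) / ((s : ℝ) + 1) := by
    have e1 : ∫ x in Iic t, (x : ℝ) ^ (s : ℝ)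
        = ∫ x : I, (Iic (t : ℝ)).indicator (fun x : ℝ => x ^ (s : ℝ)) x := by
      rw [← integral_indicator measurableSet_Iic]
      rfl
    rw [e1]
    have e2 := integral_subtype_comap (measurableSet_Icc (a := (0 : ℝ)) (b := 1))
      (μ := (volume : Measure ℝ)) fun x : ℝ => (Iic (t : ℝ)).indicator (fun x : ℝ => x ^ (s : ℝ)) x
    refine e2.trans ?_
    rw [setIntegral_indicator measurableSet_Iic]
    have e3 : Icc (0 : ℝ) 1 ∩ Iic (t : ℝ) = Icc 0 (t : ℝ) := by
      ext x; simp only [mem_inter_iff, mem_Icc, mem_Iic]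
      exact ⟨fun h => ⟨h.1.1, h.2⟩, fun h => ⟨⟨h.1, h.2.trans t.2.2⟩, h.2⟩⟩
    rw [e3, integral_Icc_eq_integral_Ioc, ← intervalIntegral.integral_of_le t.2.1,
      integral_rpow (Or.inl (by have := s.coe_nonneg; linarith)), Real.zero_rpow (by positivity),
      sub_zero]
  rw [h3]
  simp only [muntzMonomial, ContinuousMap.coe_mk]
  rw [integral_ofReal, h4, smul_eq_mul]
  push_cast
  ring

end Volterra

/-! ### Termwise differentiation of series of real powers -/

section RpowSeries

variable {ι : Type*} {c s : ι → ℝ}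

/-- The series `∑ c i * x ^ s i` converges absolutely for `0 < x < 1`, and its exponents, which may
be negative, are bounded below. -/
structure RpowSummable (c s : ι → ℝ) : Prop where
  bddBelow : ∃ m, ∀ i, m ≤ s i
  summable : ∀ x ∈ Ioo (0 : ℝ) 1, Summable fun i => |c i| * x ^ s i

theorem abs_mul_rpow_le {r m s : ℝ} (hr : 0 < r) (hr1 : r < 1) (hs : m ≤ s) :
    |s| * r ^ s ≤ (-Real.log r)⁻¹ + |m| * r ^ m := by
  have hlog : 0 < -Real.log r := neg_pos.2 (Real.log_neg hr hr1)
  have hm0 : 0 ≤ |m| * r ^ m := by positivity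
  rcases le_total 0 s with h | h
  · have h1 : s * r ^ s ≤ (-Real.log r)⁻¹ := by
      rw [← one_div, le_div_iff₀ hlog, Real.rpow_def_of_pos hr]
      have h2 := Real.add_one_le_exp (-(Real.log r * s))
      have h3 : Real.exp (-(Real.log r * s)) * Real.exp (Real.log r * s) = 1 := by
        rw [← Real.exp_add]; simp
      have h4 := Real.exp_pos (Real.log r * s)
      nlinarith
    rw [abs_of_nonneg h]; linarith
  · have h1 : |s| ≤ |m| := by
      rw [abs_of_nonpos h, abs_of_nonpos (hs.trans h)]; linarith
    have h2 : r ^ s ≤ r ^ m := Real.rpow_le_rpow_of_exponent_ge hr hr1.le hs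
    have h3 : |s| * r ^ s ≤ |m| * r ^ m :=
      mul_le_mul h1 h2 (Real.rpow_nonneg hr.le _) (abs_nonneg _)
    have := inv_pos.2 hlog
    linarith

/-- The terms of the derived series at `x` are dominated by those of the series at `(x + 1) / 2`. -/
theorem RpowSummable.derived (h : RpowSummable c s) :
    RpowSummable (fun i => c i * s i) (fun i => s i - 1) := by
  obtain ⟨m, hm⟩ := h.bddBelow
  refine ⟨⟨m - 1, fun i => by linarith [hm i]⟩, fun x hx => ?_⟩
  set y := (x + 1) / 2 with hy
  have hy0 : 0 < y := by have := hx.1; positivity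
  have hxy : x < y := by linarith [hx.2]
  have hy1 : y < 1 := by linarith [hx.2]
  have hr : 0 < x / y := div_pos hx.1 hy0
  have hr1 : x / y < 1 := (div_lt_one hy0).2 hxy
  set K := (-Real.log (x / y))⁻¹ + |m| * (x / y) ^ m
  refine Summable.of_nonneg_of_le (fun i => mul_nonneg (abs_nonneg _) (Real.rpow_nonneg hx.1.le _))
    (fun i => ?_) ((h.summable y ⟨hy0, hy1⟩).mul_left (x⁻¹ * K))
  have h1 := abs_mul_rpow_le hr hr1 (hm i)
  have h2 : x ^ s i = y ^ s i * (x / y) ^ s i := by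
    rw [← Real.mul_rpow hy0.le hr.le, mul_div_cancel₀ _ hy0.ne']
  rw [Real.rpow_sub_one hx.1.ne', h2, abs_mul]
  have h3 := Real.rpow_nonneg hy0.le (s i)
  calc |c i| * |s i| * (y ^ s i * (x / y) ^ s i / x)
      = x⁻¹ * (|c i| * y ^ s i) * (|s i| * (x / y) ^ s i) := by ring
    _ ≤ x⁻¹ * (|c i| * y ^ s i) * K := by
        have := hx.1
        gcongr
    _ = x⁻¹ * K * (|c i| * y ^ s i) := by ring

theorem rpow_le_rpow_add_rpow {a b y : ℝ} (s : ℝ) (ha : 0 < a) (hay : a ≤ y) (hyb : y ≤ b) :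
    y ^ s ≤ a ^ s + b ^ s := by
  have hy := ha.trans_le hay
  rcases le_total 0 s with h | h
  · have := Real.rpow_le_rpow hy.le hyb h
    have := Real.rpow_nonneg ha.le s
    linarith
  · have := Real.rpow_le_rpow_of_nonpos ha hay h
    have := Real.rpow_nonneg (hy.le.trans hyb) s
    linarith

theorem RpowSummable.hasDerivAt (h : RpowSummable c s) {x : ℝ} (hx : x ∈ Ioo (0 : ℝ) 1) :
    HasDerivAt (fun x => ∑' i, c i * x ^ s i) (∑' i, c i * s i * x ^ (s i - 1)) x := by
  obtain ⟨a, ha0, hax⟩ := exists_between hx.1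
  obtain ⟨b, hxb, hb1⟩ := exists_between hx.2
  have hu := (h.derived.summable a ⟨ha0, hax.trans hx.2⟩).add
    (h.derived.summable b ⟨hx.1.trans hxb, hb1⟩)
  refine hasDerivAt_tsum_of_isPreconnected (𝕜 := ℝ) hu isOpen_Ioo isPreconnected_Ioo
    (g := fun i x => c i * x ^ s i) (g' := fun i x => c i * s i * x ^ (s i - 1))
    (fun i y hy => ?_) (fun i y hy => ?_) (y₀ := x) ⟨hax, hxb⟩ ?_ ⟨hax, hxb⟩
  · have := (Real.hasDerivAt_rpow_const (x := y) (p := s i)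
      (Or.inl (ha0.trans hy.1).ne')).const_mul (c i)
    rwa [← mul_assoc] at this
  · rw [norm_mul, Real.norm_eq_abs, Real.norm_of_nonneg (Real.rpow_nonneg (ha0.trans hy.1).le _),
      ← mul_add]
    gcongr
    exact rpow_le_rpow_add_rpow _ ha0 hy.1.le hy.2.le
  · refine Summable.of_norm ((h.summable x hx).congr fun i => ?_)
    rw [norm_mul, Real.norm_eq_abs, Real.norm_of_nonneg (Real.rpow_nonneg hx.1.le _)]

theorem RpowSummable.contDiffOn (h : RpowSummable c s) :
    ContDiffOn ℝ ∞ (fun x => ∑' i, c i * x ^ s i) (Ioo 0 1) := by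
  rw [contDiffOn_infty]
  intro n
  induction n generalizing c s with
  | zero =>
    rw [Nat.cast_zero, contDiffOn_zero]
    exact fun x hx => (h.hasDerivAt hx).continuousAt.continuousWithinAt
  | succ n ih =>
    rw [Nat.cast_succ, contDiffOn_succ_iff_deriv_of_isOpen isOpen_Ioo]
    refine ⟨fun x hx => (h.hasDerivAt hx).differentiableAt.differentiableWithinAt, by simp, ?_⟩
    exact (ih h.derived).congr fun x hx => (h.hasDerivAt hx).deriv

/-- The coefficient `s (s - 1) ⋯ (s - k + 1)` in the `k`-th derivative of `x ^ s`. -/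
noncomputable def fallingProd (k : ℕ) (s : ℝ) : ℝ := ∏ j ∈ Finset.range k, (s - j)

theorem fallingProd_succ' (k : ℕ) (s : ℝ) : fallingProd (k + 1) s = s * fallingProd k (s - 1) := by
  rw [fallingProd, Finset.prod_range_succ', mul_comm, fallingProd]
  push_cast
  rw [sub_zero]
  congr 1
  exact Finset.prod_congr rfl fun j _ => by ring

theorem fallingProd_pos_of_le {k : ℕ} {s : ℝ} (h : (k : ℝ) ≤ s) : 0 < fallingProd k s := by
  refine Finset.prod_pos fun j hj => ?_
  have : (j : ℝ) < k := by exact_mod_cast Finset.mem_range.1 hj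
  linarith

theorem RpowSummable.derived_iterate (h : RpowSummable c s) (k : ℕ) :
    RpowSummable (fun i => c i * fallingProd k (s i)) (fun i => s i - k) := by
  induction k generalizing c s with
  | zero => simpa [fallingProd] using h
  | succ k ih =>
    convert ih h.derived using 2 with i i
    · rw [fallingProd_succ', mul_assoc]
    · push_cast; ring

theorem RpowSummable.iteratedDeriv_eq (h : RpowSummable c s) (k : ℕ) {x : ℝ}
    (hx : x ∈ Ioo (0 : ℝ) 1) :
    iteratedDeriv k (fun x => ∑' i, c i * x ^ s i) x
      = ∑' i, c i * fallingProd k (s i) * x ^ (s i - k) := by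
  induction k generalizing c s with
  | zero => simp [fallingProd]
  | succ k ih =>
    rw [iteratedDeriv_succ']
    have h1 : deriv (fun x => ∑' i, c i * x ^ s i)
        =ᶠ[nhds x] fun x => ∑' i, c i * s i * x ^ (s i - 1) := by
      filter_upwards [isOpen_Ioo.mem_nhds hx] with y hy using (h.hasDerivAt hy).deriv
    rw [h1.iteratedDeriv_eq, ih h.derived]
    refine tsum_congr fun i => ?_
    rw [fallingProd_succ', mul_assoc (c i)]
    congr 2
    push_cast; ring

end RpowSeries

/-! ### Derivatives of `ψ` -/

section MuntzPsiSmooth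

variable {𝕜 : Type*} [RCLike 𝕜] {Λ : ℕ → ℝ≥0}

theorem MuntzPsiConverges.rpowSummable (hψ : MuntzPsiConverges 𝕜 Λ) :
    RpowSummable (fun n => (muntzDist 𝕜 Λ n)⁻¹) (fun n => (Λ n : ℝ)) := by
  refine ⟨⟨0, fun n => (Λ n).coe_nonneg⟩, fun x hx => (hψ x ⟨hx.1.le, hx.2⟩).congr fun n => ?_⟩
  have h : 0 ≤ (muntzDist 𝕜 Λ n)⁻¹ := inv_nonneg.2 Metric.infDist_nonneg
  rw [abs_of_nonneg h]

theorem MuntzPsiConverges.contDiffOn (hψ : MuntzPsiConverges 𝕜 Λ) :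
    ContDiffOn ℝ ∞ (muntzPsi 𝕜 Λ) (Ioo 0 1) :=
  hψ.rpowSummable.contDiffOn

theorem MuntzPsiConverges.rpowSummable_from (hψ : MuntzPsiConverges 𝕜 Λ) (k : ℕ) :
    RpowSummable (fun n : {n : ℕ // (k : ℝ≥0) ≤ Λ n} => (muntzDist 𝕜 Λ n)⁻¹)
      (fun n => (Λ n : ℝ)) :=
  ⟨⟨0, fun n => (Λ n).coe_nonneg⟩, fun x hx =>
    (hψ.rpowSummable.summable x hx).comp_injective Subtype.val_injective⟩

theorem muntzPsiFrom_eq_muntzPsi {k : ℕ} (hk : ∀ n, (k : ℝ≥0) ≤ Λ n) :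
    muntzPsiFrom 𝕜 Λ k = muntzPsi 𝕜 Λ := by
  funext x
  exact (Equiv.subtypeUnivEquiv hk).tsum_eq fun n => (muntzDist 𝕜 Λ n)⁻¹ * x ^ (Λ n : ℝ)

end MuntzPsiSmooth

/-! ### The quantitative Schatten bound -/

section SchattenBound

variable {𝕜 : Type*} [RCLike 𝕜] {Λ : ℕ → ℝ≥0}

/-- An absolutely convergent series of rank one operators built from a biorthogonal system. -/
theorem exists_sum_rankOne {H K : Type*} [NormedAddCommGroup H] [NormedSpace 𝕜 H]
    [NormedAddCommGroup K] [NormedSpace 𝕜 K] [CompleteSpace K] {l : ℕ → H →L[𝕜] 𝕜} {e : ℕ → H}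
    (he : ∀ n m, l n (e m) = if m = n then 1 else 0) {p : ℕ → Prop} [DecidablePred p] {v : ℕ → K}
    {u : {n // p n} → ℝ} (hu : Summable u) (hv : ∀ n : {n // p n}, ‖l n‖ * ‖v n‖ ≤ u n) :
    ∃ D : H →L[𝕜] K, ‖D‖ ≤ ∑' n, u n ∧ ∀ n, D (e n) = if p n then v n else 0 := by
  have htu : ∀ n : {n // p n}, ‖(l n).smulRight (v n)‖ ≤ u n := fun n => by
    rw [ContinuousLinearMap.norm_smulRight_apply]
    exact hv n
  have hts : Summable fun n : {n // p n} => (l n).smulRight (v n) :=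
    Summable.of_norm_bounded hu htu
  refine ⟨_, tsum_of_norm_bounded hu.hasSum htu, fun m => ?_⟩
  have h1 := hts.hasSum.mapL (ContinuousLinearMap.apply 𝕜 K (e m))
  refine h1.unique ?_
  have h2 : ∀ n : {n // p n}, ContinuousLinearMap.apply 𝕜 K (e m) ((l n).smulRight (v n))
      = (if m = n then (1 : 𝕜) else 0) • v n := fun n => by
    rw [ContinuousLinearMap.apply_apply, ContinuousLinearMap.smulRight_apply, he]
  simp only [h2]
  split_ifs with hm
  · have h3 := hasSum_single (f := fun n : {n // p n} => (if m = n then (1 : 𝕜) else 0) • v n)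
      ⟨m, hm⟩ fun n hn => by rw [if_neg fun h => hn (Subtype.ext h.symm), zero_smul]
    simpa using h3
  · convert hasSum_zero using 2 with n
    rw [if_neg fun h => hm (by rw [h]; exact n.2), zero_smul]

theorem norm_muntzMonomialL2_le_one (s : ℝ≥0) : ‖muntzMonomialL2 𝕜 s‖ ≤ 1 := by
  have h : ∀ᵐ t : I, ‖muntzMonomialL2 𝕜 s t‖ ≤ 1 := by
    filter_upwards [ContinuousMap.coeFn_toLp (p := 2) (𝕜 := 𝕜) volume (muntzMonomial 𝕜 s)]
      with t ht
    have ht' : muntzMonomialL2 𝕜 s t = muntzMonomial 𝕜 s t := ht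
    rw [ht', muntzMonomial, ContinuousMap.coe_mk, RCLike.norm_ofReal,
      abs_of_nonneg (Real.rpow_nonneg t.2.1 _)]
    exact Real.rpow_le_one t.2.1 t.2.2 s.coe_nonneg
  refine (Lp.norm_le_of_ae_bound zero_le_one h).trans ?_
  simp [measureUnivNNReal]

theorem volterra_pow_monomial {V : Lp 𝕜 2 (volume : Measure I) →L[𝕜] Lp 𝕜 2 (volume : Measure I)}
    (hV : ∀ s : ℝ≥0, V (muntzMonomialL2 𝕜 s)
      = ((1 / ((s : ℝ) + 1) : ℝ) : 𝕜) • muntzMonomialL2 𝕜 (s + 1)) (k : ℕ) (s : ℝ≥0) :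
    (V ^ k) (muntzMonomialL2 𝕜 s)
      = (((fallingProd k ((s : ℝ) + k))⁻¹ : ℝ) : 𝕜) • muntzMonomialL2 𝕜 (s + k) := by
  induction k generalizing s with
  | zero => simp [fallingProd]
  | succ k ih =>
    rw [pow_succ, ContinuousLinearMap.mul_def, ContinuousLinearMap.comp_apply, hV, map_smul, ih,
      smul_smul, ← RCLike.ofReal_mul]
    have h1 : s + 1 + (k : ℝ≥0) = s + ((k + 1 : ℕ) : ℝ≥0) := by push_cast; ring
    have h2 : (s : ℝ) + ((k + 1 : ℕ) : ℝ) = ((s + 1 : ℝ≥0) : ℝ) + k := by push_cast; ring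
    rw [h1, h2]
    congr 3
    rw [fallingProd, fallingProd, Finset.prod_range_succ, mul_inv, mul_comm, one_div]
    congr 2
    push_cast; ring

namespace IsMuntzSequence

variable (hΛ : IsMuntzSequence Λ)
include hΛ

theorem finite_setOf_lt (k : ℝ≥0) : {n | Λ n < k}.Finite := by
  have h := (tendsto_atTop_of_summable_one_div (fun n => NNReal.coe_pos.2 (hΛ.pos n))
    hΛ.summable).eventually_ge_atTop (k : ℝ)
  rw [Filter.eventually_cofinite] at h
  exact h.subset fun n (hn : Λ n < k) => not_le.2 (NNReal.coe_lt_coe.2 hn)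

/-- The `k`-th derivative of the part of `f (ρ ·)` with exponents at least `k`. Applied to it, the
`k`-th power of the Volterra operator recovers this part. On a monomial `x ^ Λ n` with `Λ n < k` the
derivative is replaced by zero; there the truncated difference `Λ n - k` does not matter. -/
theorem exists_derivedDilation (hψ : MuntzPsiConverges 𝕜 Λ) (k : ℕ) {ρ : ℝ}
    (hρ : ρ ∈ Ioo (0 : ℝ) 1) :
    ∃ D : muntzSpace 𝕜 Λ →L[𝕜] Lp 𝕜 2 (volume : Measure I),
      ‖D‖ ≤ iteratedDeriv k (muntzPsiFrom 𝕜 Λ k) ρ ∧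
      ∀ n, D (muntzMonomialMem 𝕜 Λ n) = if (k : ℝ≥0) ≤ Λ n then
        ((ρ ^ (Λ n : ℝ) * fallingProd k (Λ n) : ℝ) : 𝕜) • muntzMonomialL2 𝕜 (Λ n - k) else 0 := by
  have hρ0 := hρ.1.le
  have hd : ∀ n, 0 ≤ (muntzDist 𝕜 Λ n)⁻¹ := fun n => inv_nonneg.2 Metric.infDist_nonneg
  have hfp : ∀ n : {n : ℕ // (k : ℝ≥0) ≤ Λ n}, 0 ≤ fallingProd k (Λ n) := fun n =>
    (fallingProd_pos_of_le (by exact_mod_cast n.2)).le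
  have hus : Summable fun n : {n : ℕ // (k : ℝ≥0) ≤ Λ n} =>
      (muntzDist 𝕜 Λ n)⁻¹ * fallingProd k (Λ n) * ρ ^ ((Λ n : ℝ) - k) := by
    refine (((hψ.rpowSummable_from k).derived_iterate k).summable ρ hρ).congr fun n => ?_
    rw [abs_of_nonneg (mul_nonneg (hd n) (hfp n))]
  have h1 : iteratedDeriv k (muntzPsiFrom 𝕜 Λ k) ρ = _ :=
    (hψ.rpowSummable_from k).iteratedDeriv_eq k hρ
  rw [h1]
  refine exists_sum_rankOne (l := muntzCoeff 𝕜 Λ) (e := muntzMonomialMem 𝕜 Λ)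
    (K := Lp 𝕜 2 (volume : Measure I)) hΛ.muntzCoeff_monomial hus (v := fun n =>
      ((ρ ^ (Λ n : ℝ) * fallingProd k (Λ n) : ℝ) : 𝕜) • muntzMonomialL2 𝕜 (Λ n - k)) fun n => ?_
  refine (mul_le_mul_of_nonneg_right (hΛ.norm_muntzCoeff_le n) (norm_nonneg _)).trans ?_
  have h2 := norm_muntzMonomialL2_le_one (𝕜 := 𝕜) (Λ n - k)
  have h3 : ρ ^ (Λ n : ℝ) ≤ ρ ^ ((Λ n : ℝ) - k) :=
    Real.rpow_le_rpow_of_exponent_ge hρ.1 hρ.2.le (by simp)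
  have h4 := Real.rpow_nonneg hρ0 (Λ n : ℝ)
  rw [norm_smul, RCLike.norm_ofReal, abs_of_nonneg (mul_nonneg h4 (hfp n)),
    mul_assoc (muntzDist 𝕜 Λ n)⁻¹]
  refine mul_le_mul_of_nonneg_left ?_ (hd n)
  rw [mul_comm (fallingProd k _)]
  exact (mul_le_of_le_one_right (mul_nonneg h4 (hfp n)) h2).trans
    (mul_le_mul_of_nonneg_right h3 (hfp n))

/-- On the common kernel of the coefficient functionals with exponents less than `k`, the norm of
the dilation is that of the `k`-th power of the Volterra operator applied to a bounded operator. -/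
theorem norm_dilation_eq_of_coeff_eq_zero {k : ℕ} {ρ : ℝ}
    {V : Lp 𝕜 2 (volume : Measure I) →L[𝕜] Lp 𝕜 2 (volume : Measure I)}
    (hV : ∀ s : ℝ≥0, V (muntzMonomialL2 𝕜 s)
      = ((1 / ((s : ℝ) + 1) : ℝ) : 𝕜) • muntzMonomialL2 𝕜 (s + 1))
    {D : muntzSpace 𝕜 Λ →L[𝕜] muntzSpace 𝕜 Λ}
    (hD : ∀ n, D (muntzMonomialMem 𝕜 Λ n) = ((ρ ^ (Λ n : ℝ) : ℝ) : 𝕜) • muntzMonomialMem 𝕜 Λ n)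
    {D' : muntzSpace 𝕜 Λ →L[𝕜] Lp 𝕜 2 (volume : Measure I)}
    (hD' : ∀ n, D' (muntzMonomialMem 𝕜 Λ n) = if (k : ℝ≥0) ≤ Λ n then
      ((ρ ^ (Λ n : ℝ) * fallingProd k (Λ n) : ℝ) : 𝕜) • muntzMonomialL2 𝕜 (Λ n - k) else 0)
    {z : muntzSpace 𝕜 Λ} (hz : ∀ n, Λ n < k → muntzCoeff 𝕜 Λ n z = 0) :
    ‖D z‖ = ‖(V ^ k) (D' z)‖ := by
  have hfin := hΛ.finite_setOf_lt k
  set R : muntzSpace 𝕜 Λ →L[𝕜] Lp 𝕜 2 (volume : Measure I) :=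
    ∑ n ∈ hfin.toFinset, (muntzCoeff 𝕜 Λ n).smulRight
      (((ρ ^ (Λ n : ℝ) : ℝ) : 𝕜) • muntzMonomialL2 𝕜 (Λ n)) with hR
  have hRa : ∀ f, R f = ∑ n ∈ hfin.toFinset, muntzCoeff 𝕜 Λ n f •
      (((ρ ^ (Λ n : ℝ) : ℝ) : 𝕜) • muntzMonomialL2 𝕜 (Λ n)) := fun f => by
    rw [hR, sum_apply]; rfl
  have hdec : (muntzSpace 𝕜 Λ).subtypeL.comp D = (V ^ k).comp D' + R := by
    refine muntzSpace_clm_ext fun m => ?_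
    rw [ContinuousLinearMap.comp_apply, add_apply,
      ContinuousLinearMap.comp_apply, hD, hD', map_smul, Submodule.subtypeL_apply,
      coe_muntzMonomialMem, hRa]
    simp only [hΛ.muntzCoeff_monomial, ite_smul, one_smul, zero_smul]
    rw [Finset.sum_ite_eq]
    by_cases hm : (k : ℝ≥0) ≤ Λ m
    · have hm' : m ∉ hfin.toFinset := by simpa using hm
      have hc : ((Λ m - k : ℝ≥0) : ℝ) + k = Λ m := by
        rw [NNReal.coe_sub hm, NNReal.coe_natCast, sub_add_cancel]
      have hpos : fallingProd k (Λ m) ≠ 0 := (fallingProd_pos_of_le (by exact_mod_cast hm)).ne'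
      rw [if_pos hm, if_neg hm', add_zero, map_smul, volterra_pow_monomial hV, hc, smul_smul,
        ← RCLike.ofReal_mul, mul_inv_cancel_right₀ hpos, tsub_add_cancel_of_le hm]
    · have hm' : m ∈ hfin.toFinset := by simpa using hm
      rw [if_neg hm, if_pos hm', map_zero, zero_add]
  have h1 := DFunLike.congr_fun hdec z
  rw [add_apply, hRa, Finset.sum_eq_zero, add_zero] at h1
  · rw [← ContinuousLinearMap.comp_apply, ← h1]; rfl
  · intro n hn
    rw [hz n (by simpa using hn), zero_smul]

/-- The bound for the sum of powers of singular values: `schattenSum_le_of_dominated` for the Volterra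
operator, with the coefficients of exponent less than `k` as the exceptional map. -/
theorem schattenSum_evalOperator_le (hψ : MuntzPsiConverges 𝕜 Λ) {μ : Measure I}
    [IsFiniteMeasure μ] {b b' : ℝ} (hb0 : 0 < b) (hbb' : b < b') (hb' : b' < 1)
    (hμ : ∀ᵐ t : I ∂μ, (t : ℝ) ≤ b) {T : muntzSpace 𝕜 Λ →L[𝕜] Lp 𝕜 2 μ}
    (hT : ∀ f, T f =ᵐ[μ] fun t => muntzEval 𝕜 Λ t f) {k : ℕ} (hk : 1 ≤ k) :
    schattenSum (2 / k) T ≤ ENNReal.ofReal ((2 : ℝ) ^ (-(k : ℝ) / 2) * b' ^ (-(1 : ℝ) / 2) *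
        iteratedDeriv k (muntzPsiFrom 𝕜 Λ k) b' * muntzPsi 𝕜 Λ (b / b') *
        √(μ.real univ)) ^ (2 / k : ℝ) + ({n : ℕ | Λ n < k}.ncard : ℝ≥0∞) *
      ENNReal.ofReal (muntzPsi 𝕜 Λ b * √(μ.real univ)) ^ (2 / k : ℝ) := by
  have hk0 : (0 : ℝ) < k := by exact_mod_cast hk
  have hq : (0 : ℝ) ≤ 2 / k := by positivity
  have hb'0 : 0 < b' := hb0.trans hbb'
  have hbb : b / b' < 1 := (div_lt_one hb'0).2 hbb'
  -- The norm of an evaluation operator is at most its Hilbert-Schmidt norm.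
  have hnorm : ∀ {φ : I → ℝ} {c : ℝ} {S : muntzSpace 𝕜 Λ →L[𝕜] Lp 𝕜 2 μ}, Continuous φ →
      (∀ t, 0 ≤ φ t) → c < 1 → (∀ᵐ t ∂μ, φ t ≤ c) →
      (∀ f, S f =ᵐ[μ] fun t => muntzEval 𝕜 Λ (φ t) f) → 0 ≤ c →
      ‖S‖ ≤ muntzPsi 𝕜 Λ c * √(μ.real univ) := by
    intro φ c S hφ hφ0 hc hle hS hc0
    obtain ⟨S', hS', hHS⟩ := hΛ.exists_evalOperator 𝕜 hφ hφ0 hc hle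
    have hSS : S = S' := ContinuousLinearMap.ext fun f => Lp.ext ((hS f).trans (hS' f).symm)
    have h1 := (hHS (muntzPsi 𝕜 Λ c) (by
      filter_upwards [hle] with t ht
      exact (hΛ.norm_muntzEval_le_muntzPsi hψ (hφ0 t) (ht.trans_lt hc)).trans
        (muntzPsi_mono hψ (hφ0 t) ht hc))).opNorm_le
    rwa [Real.sqrt_mul (sq_nonneg _), Real.sqrt_sq (muntzPsi_nonneg hc0), ← hSS] at h1
  have hle : ∀ᵐ t : I ∂μ, (t : ℝ) / b' ≤ b / b' := by
    filter_upwards [hμ] with t ht; gcongr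
  have hTn := hnorm continuous_subtype_val (fun t => t.2.1) (hbb'.trans hb') hμ hT hb0.le
  obtain ⟨D, hD, -⟩ := hΛ.exists_dilation 𝕜 hb'0.le hb'
  obtain ⟨D', hD'n, hD'⟩ := hΛ.exists_derivedDilation hψ k ⟨hb'0, hb'⟩
  obtain ⟨V, hVHS, hV⟩ := exists_volterra 𝕜
  obtain ⟨E, hE, -⟩ := hΛ.exists_evalOperator 𝕜 (ν := μ) (φ := fun t : I => (t : ℝ) / b')
    (continuous_subtype_val.div_const _) (fun t => div_nonneg t.2.1 hb'0.le) hbb hle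
  have hEn := hnorm (continuous_subtype_val.div_const _) (fun t => div_nonneg t.2.1 hb'0.le) hbb hle
    hE (by positivity)
  have hTE : ∀ z, T z = E (D z) := by
    intro z
    refine Lp.ext ((hT z).trans ((hE _).trans ?_).symm)
    filter_upwards [hle] with t ht
    have h1 := hΛ.muntzEval_dilation_pow hb'0.le hb' hD 1 (div_nonneg t.2.1 hb'0.le)
      (ht.trans_lt hbb) z
    rwa [pow_one, pow_one, mul_div_cancel₀ _ hb'0.ne'] at h1
  have hfin := hΛ.finite_setOf_lt k
  have : Fintype {n | Λ n < k} := hfin.fintype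
  set P : muntzSpace 𝕜 Λ →ₗ[𝕜] EuclideanSpace 𝕜 {n | Λ n < k} :=
    (WithLp.linearEquiv 2 𝕜 ({n | Λ n < k} → 𝕜)).symm.toLinearMap ∘ₗ
      LinearMap.pi fun n => (muntzCoeff 𝕜 Λ n : muntzSpace 𝕜 Λ →ₗ[𝕜] 𝕜) with hP
  have hcard : Module.finrank 𝕜 (EuclideanSpace 𝕜 {n | Λ n < k}) ≤ {n : ℕ | Λ n < k}.ncard := by
    rw [finrank_euclideanSpace, ← Nat.card_eq_fintype_card, Nat.card_coe_set_eq]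
  have hmain := schattenSum_le_of_dominated (T := T) (P := P) (D := D') (C := ‖E‖) hk hcard hVHS
    (norm_nonneg E) fun z hz => by
      have hz' : ∀ n, Λ n < k → muntzCoeff 𝕜 Λ n z = 0 := fun n hn =>
        congrArg (fun w : EuclideanSpace 𝕜 {n | Λ n < k} => w ⟨n, hn⟩) hz
      rw [hTE, ← hΛ.norm_dilation_eq_of_coeff_eq_zero hV hD hD' hz']
      exact E.le_opNorm _
  refine hmain.trans ?_
  set Y := iteratedDeriv k (muntzPsiFrom 𝕜 Λ k) b'
  have hY : 0 ≤ Y := (norm_nonneg D').trans hD'n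
  set M := √(μ.real univ)
  have hM : 0 ≤ M := Real.sqrt_nonneg _
  have hψ1 : 0 ≤ muntzPsi 𝕜 Λ (b / b') := muntzPsi_nonneg (by positivity)
  have hψ2 : 0 ≤ muntzPsi 𝕜 Λ b := muntzPsi_nonneg hb0.le
  have h2 : (0 : ℝ) ≤ 2 ^ (-(k : ℝ) / 2) := by positivity
  have h2k : ((2 : ℝ) ^ (-(k : ℝ) / 2)) ^ (2 / k : ℝ) = 1 / 2 := by
    rw [← Real.rpow_mul zero_le_two, show -(k : ℝ) / 2 * (2 / k) = -1 by field_simp,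
      Real.rpow_neg_one, one_div]
  -- The estimate holds without the factor `b' ^ (-1 / 2)`, which is at least `1`.
  have hb1 : 1 ≤ b' ^ (-(1 : ℝ) / 2) :=
    Real.one_le_rpow_of_pos_of_le_one_of_nonpos hb'0 hb'.le (by norm_num)
  rw [ENNReal.ofReal_rpow_of_nonneg (by positivity) hq,
    ENNReal.ofReal_rpow_of_nonneg (by positivity) hq, ← ENNReal.ofReal_natCast,
    ← ENNReal.ofReal_mul (by positivity), ← ENNReal.ofReal_add (by positivity) (by positivity),
    add_comm]
  refine ENNReal.ofReal_le_ofReal (add_le_add ?_ ?_)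
  · rw [← h2k, ← Real.mul_rpow (by positivity) h2]
    refine Real.rpow_le_rpow (by positivity) ?_ hq
    calc ‖E‖ * ‖D'‖ * 2 ^ (-(k : ℝ) / 2)
        ≤ muntzPsi 𝕜 Λ (b / b') * M * Y * 2 ^ (-(k : ℝ) / 2) := by gcongr
      _ = 2 ^ (-(k : ℝ) / 2) * 1 * Y * muntzPsi 𝕜 Λ (b / b') * M := by ring
      _ ≤ _ := by gcongr
  · gcongr

end IsMuntzSequence

end SchattenBound

theorem mainTheorem3 (𝕜 : Type*) [RCLike 𝕜] (Λ : ℕ → ℝ≥0) (hpos : ∀ n, 0 < Λ n)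
    (hmono : StrictMono Λ) (hsum : Summable fun n => 1 / (Λ n : ℝ)) :
    (∀ n, 0 < muntzDist 𝕜 Λ n) ∧
    ((∃ δ : ℝ, 0 < δ ∧ ∀ n, (Λ n : ℝ) + δ ≤ Λ (n + 1)) → MuntzPsiConverges 𝕜 Λ) ∧
    (MuntzPsiConverges 𝕜 Λ → ContDiffOn ℝ ∞ (muntzPsi 𝕜 Λ) (Ioo 0 1)) ∧
    ∀ (μ : Measure I) [IsFiniteMeasure μ] (ε : ℝ), 0 < ε → ε < 1 →
      μ.support ⊆ {x : I | (x : ℝ) ≤ 1 - ε} →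
      ∃ T : muntzSpace 𝕜 Λ →L[𝕜] Lp 𝕜 2 μ, IsMuntzEmbedding 𝕜 T ∧
        (∀ q : ℝ, 0 < q → IsSchatten q T) ∧
        (MuntzPsiConverges 𝕜 Λ → ∀ k : ℕ, 1 ≤ k → ∀ b' : ℝ, 1 - ε < b' → b' < 1 →
          ((∀ n, (k : ℝ≥0) ≤ Λ n) →
            schattenNorm (2 / k) T ≤
              ENNReal.ofReal ((2 : ℝ) ^ (-(k : ℝ) / 2) * b' ^ (-(1 : ℝ) / 2) *
                iteratedDeriv k (muntzPsi 𝕜 Λ) b' * muntzPsi 𝕜 Λ ((1 - ε) / b') *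
                √(μ.real univ))) ∧
          schattenNorm (2 / k) T ^ (2 / k : ℝ) ≤
            ENNReal.ofReal ((2 : ℝ) ^ (-(k : ℝ) / 2) * b' ^ (-(1 : ℝ) / 2) *
                iteratedDeriv k (muntzPsiFrom 𝕜 Λ k) b' * muntzPsi 𝕜 Λ ((1 - ε) / b') *
                √(μ.real univ)) ^ (2 / k : ℝ) +
              ({n : ℕ | Λ n < k}.ncard : ℝ≥0∞) *
                ENNReal.ofReal (muntzPsi 𝕜 Λ (1 - ε) * √(μ.real univ)) ^ (2 / k : ℝ)) := by
  have hΛ : IsMuntzSequence Λ := ⟨hpos, hmono, hsum⟩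
  refine ⟨muntzDist_pos 𝕜 hpos hmono.injective hsum,
    fun ⟨δ, hδ, hgap⟩ => muntzPsiConverges_of_gap hpos hmono hsum hδ hgap,
    fun hψ => hψ.contDiffOn, fun μ _ ε hε hε1 hμ => ?_⟩
  have hb0 : 0 < 1 - ε := by linarith
  have hb1 : 1 - ε < 1 := by linarith
  have hle : ∀ᵐ t : I ∂μ, (t : ℝ) ≤ 1 - ε := by
    filter_upwards [Measure.support_mem_ae (μ := μ)] with t ht using hμ ht
  obtain ⟨T, hT, hHS⟩ := hΛ.exists_evalOperator 𝕜 (ν := μ) continuous_subtype_val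
    (fun t => t.2.1) hb1 hle
  refine ⟨T, fun f => ⟨fun t => muntzEval 𝕜 Λ t f, ?_, hΛ.coe_ae_eq_muntzEval f, hT f⟩,
    fun q hq => ⟨?_, hΛ.schattenSum_evalOperator_lt_top hb0 hb1 hle hT hq⟩,
    fun hψ k hk b' hb hb' => ?_⟩
  · exact (hΛ.continuousOn_muntzEval f).comp continuous_subtype_val.continuousOn
      fun t ht => ⟨t.2.1, ht⟩
  · obtain ⟨C, -, hC⟩ := hΛ.exists_norm_muntzEval_le 𝕜 hb1
    exact (hHS C (by filter_upwards [hle] with t ht using hC t t.2.1 ht)).isCompactOperator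
  · have hk0 : (0 : ℝ) < k := by exact_mod_cast hk
    have hbound := hΛ.schattenSum_evalOperator_le hψ hb0 hb hb' hle hT hk
    refine ⟨fun hkΛ => ?_, ?_⟩
    · have hempty : {n : ℕ | Λ n < k} = ∅ :=
        eq_empty_of_forall_notMem fun n hn => not_lt.2 (hkΛ n) hn
      rw [muntzPsiFrom_eq_muntzPsi hkΛ, hempty, ncard_empty, Nat.cast_zero, zero_mul,
        add_zero] at hbound
      rw [schattenNorm, one_div]
      exact ENNReal.rpow_inv_le_iff (by positivity) |>.2 hbound
    · rw [schattenNorm, ← ENNReal.rpow_mul, one_div_mul_cancel (by positivity), ENNReal.rpow_one]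
      exact hbound
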